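/- Let $s\in(0,1)$, let $N\ge 1$ be an integer with $N>2s$, put $2^*=\frac{2N}{N-2s}$, and let $q>p\ge 2^*-1=\frac{N+2s}{N-2s}$. Let $\Omega\subset\mathbb R^N$ be a nonempty bounded open set with $C^\infty$ boundary that is star-shaped with respect to one of its points. Notation. Functions are real-valued and measurable. For functions $u,v$ on $\mathbb R^N$ put $$\langle u,v\rangle=\int_{\mathbb R^N}\int_{\mathbb R^N}\frac{(u(x)-u(y))(v(x)-v(y))}{|x-y|^{N+2s}}\,dx\,dy,\qquad [u]^2=\langle u,u\rangle .$$ Let $X_0(\Omega)=\{v\in L^2(\mathbb R^N): [v]^2<\infty,\ v=0 \text{ a.e. in }\mathbb R^N\setminus\Omega\}$, and let $D^{s,2}(\mathbb R^N)$ be the closure of $C_c^\infty(\mathbb R^N)$ with respect to $[\,\cdot\,]$, realized in $L^{2^*}(\mathbb R^N)$. For $\varepsilon>0$, a solution of $$(-\Delta)^su=u^p-\varepsilon u^q,\quad u>0\ \text{ in }\Omega,\qquad u=0\ \text{ in }\mathbb R^N\setminus\Omega \tag{$P_\varepsilon$}$$ is a function $u\in X_0(\Omega)\cap L^{q+1}(\Omega)$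 with $u>0$ in $\Omega$ such that for every $\varphi\in X_0(\Omega)$ the functions $u^p\varphi$ and $u^q\varphi$ are integrable on $\Omega$ and $$\langle u,\varphi\rangle=\int_\Omega u^p\varphi\,dx-\varepsilon\int_\Omega u^q\varphi\,dx .$$ If $p>2^*-1$, put, for a domain $D\subseteq\mathbb R^N$, $$F(u,D)=\frac12\,\frac{[u]^2}{\int_D|u|^{p+1}dx}+\frac1{q+1}\,\frac{\int_D|u|^{q+1}dx}{\left(\int_D|u|^{p+1}dx\right)^{l}},\qquad l=\frac{2s(q+1)-N(p-1)}{2s(p+1)-N(p-1)},$$ $$\mathcal K=\inf\Big\{F(u,\mathbb R^N): u\in D^{s,2}(\mathbb R^N)\cap L^{q+1}(\mathbb R^N),\ \int_{\mathbb R^N}|u|^{p+1}dx=1\Big\}.$$ If $p=2^*-1$, put $$S(u)=\frac{[u]^2}{\left(\int_\Omega|u|^{p+1}dx\right)^{2/(p+1)}},\qquad \mathcal S=\inf_{u\in D^{s,2}(\mathbb R^N)\setminus\{0\}}\frac{[u]^2}{\left(\int_{\mathbb R^N}|u|^{2^*}dx\right)^{2/2^*}} .$$ Theorem. There exist $\varepsilon_n>0$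 with $\varepsilon_n\to0$ and $\lambda_n>0$ with $(\lambda_n)$ bounded above and bounded away from zero, such that (i) for every $n$ there is a solution $u_n$ of $(P_{\varepsilon_n})$; (ii) if $p>2^*-1$, then $F(\lambda_nu_n,\Omega)\to\mathcal K$ and $\int_\Omega u_n^{p+1}dx\to0$ as $n\to\infty$; (iii) if $p=2^*-1$, then $S(u_n)\to\mathcal S$ as $n\to\infty$, and there are constants $A,B>0$ such that $A<\int_\Omega u_n^{p+1}dx<B$ for all $n$. -/

import Mathlib

open MeasureTheory Filter Topology
open scoped ContDiff

/-- The boundary of `Ω` is smooth: near each boundary point, `Ω` is the sublevel set `{ψ < 0}` of a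
smooth function `ψ` whose differential does not vanish. -/
def HasSmoothBoundary {N : ℕ} (Ω : Set (EuclideanSpace ℝ (Fin N))) : Prop :=
  ∀ x₀ ∈ frontier Ω, ∃ (U : Set (EuclideanSpace ℝ (Fin N))) (ψ : EuclideanSpace ℝ (Fin N) → ℝ),
    IsOpen U ∧ x₀ ∈ U ∧ ContDiffOn ℝ ∞ ψ U ∧ (∀ x ∈ U, fderiv ℝ ψ x ≠ 0) ∧
      Ω ∩ U = {x ∈ U | ψ x < 0}

/-- The critical Sobolev exponent `2* = 2N / (N - 2s)`, used for `N > 2s`. -/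
noncomputable def critExp (N : ℕ) (s : ℝ) : ℝ := 2 * N / (N - 2 * s)

/-- The integrand `(u(x) - u(y)) (v(x) - v(y)) / |x - y|^(N + 2s)` on `ℝ^N × ℝ^N`. -/
noncomputable def gagliardoDensity {N : ℕ} (s : ℝ) (u v : EuclideanSpace ℝ (Fin N) → ℝ)
    (z : EuclideanSpace ℝ (Fin N) × EuclideanSpace ℝ (Fin N)) : ℝ :=
  (u z.1 - u z.2) * (v z.1 - v z.2) / ‖z.1 - z.2‖ ^ ((N : ℝ) + 2 * s)

/-- The Gagliardo form `∬ (u(x) - u(y)) (v(x) - v(y)) / |x - y|^(N + 2s) dx dy` over all of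
`ℝ^N × ℝ^N`. -/
noncomputable def gagliardoForm {N : ℕ} (s : ℝ) (u v : EuclideanSpace ℝ (Fin N) → ℝ) : ℝ :=
  ∫ z, gagliardoDensity s u v z

/-- The squared Gagliardo seminorm of `u` is finite. -/
def HasFiniteGagliardo {N : ℕ} (s : ℝ) (u : EuclideanSpace ℝ (Fin N) → ℝ) : Prop :=
  Integrable (gagliardoDensity s u u)

/-- The fractional Sobolev space `H^s(ℝ^N)` (real functions, as representatives). -/
def MemHs {N : ℕ} (s : ℝ) (u : EuclideanSpace ℝ (Fin N) → ℝ) : Prop :=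
  MemLp u 2 ∧ HasFiniteGagliardo s u

/-- `X_0(Ω) = {v ∈ H^s(ℝ^N) : v = 0 a.e. in ℝ^N \ Ω}`. -/
def MemX0 {N : ℕ} (Ω : Set (EuclideanSpace ℝ (Fin N))) (s : ℝ)
    (v : EuclideanSpace ℝ (Fin N) → ℝ) : Prop :=
  MemHs s v ∧ ∀ᵐ x, x ∉ Ω → v x = 0

/-- `L^r(Ω)` for a real exponent `r`. -/
def MemLpOn {N : ℕ} (Ω : Set (EuclideanSpace ℝ (Fin N))) (r : ℝ)
    (u : EuclideanSpace ℝ (Fin N) → ℝ) : Prop :=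
  MemLp u (ENNReal.ofReal r) (volume.restrict Ω)

/-- `D^{s,2}(ℝ^N)`: the closure of `C_c^∞(ℝ^N)` for the Gagliardo seminorm. Since the seminorm
does not see additive constants, the closure is realized, as usual, inside `L^{2*}(ℝ^N)`. -/
def MemDs2 {N : ℕ} (s : ℝ) (u : EuclideanSpace ℝ (Fin N) → ℝ) : Prop :=
  MemLpOn Set.univ (critExp N s) u ∧
    ∃ φ : ℕ → EuclideanSpace ℝ (Fin N) → ℝ,
      (∀ k, ContDiff ℝ ∞ (φ k) ∧ HasCompactSupport (φ k)) ∧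
      (∀ k, HasFiniteGagliardo s (u - φ k)) ∧
      Tendsto (fun k => gagliardoForm s (u - φ k) (u - φ k)) atTop (𝓝 0)

/-- `u` is a weak solution of `(-Δ)^s u = u^p - ε u^q` in `Ω`, `u > 0` in `Ω`, `u = 0` outside `Ω`,
in the class `X_0(Ω) ∩ L^{q+1}(Ω)`, tested against all of `X_0(Ω)`. Both integrals on the
right-hand side are required to converge. -/
def IsWeakSolution {N : ℕ} (Ω : Set (EuclideanSpace ℝ (Fin N))) (s p q ε : ℝ)
    (u : EuclideanSpace ℝ (Fin N) → ℝ) : Prop :=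
  MemX0 Ω s u ∧ MemLpOn Ω (q + 1) u ∧ (∀ x ∈ Ω, 0 < u x) ∧
    ∀ φ : EuclideanSpace ℝ (Fin N) → ℝ, MemX0 Ω s φ →
      IntegrableOn (fun x => u x ^ p * φ x) Ω ∧
      IntegrableOn (fun x => u x ^ q * φ x) Ω ∧
      gagliardoForm s u φ = (∫ x in Ω, u x ^ p * φ x) - ε * ∫ x in Ω, u x ^ q * φ x

/-- The supercritical functional
`F(u, Ω) = (1/2) [u]² / ∫_Ω |u|^{p+1} + (1/(q+1)) ∫_Ω |u|^{q+1} / (∫_Ω |u|^{p+1})^l`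
with `l = (2s(q+1) - N(p-1)) / (2s(p+1) - N(p-1))`. -/
noncomputable def functionalF {N : ℕ} (s p q : ℝ) (Ω : Set (EuclideanSpace ℝ (Fin N)))
    (u : EuclideanSpace ℝ (Fin N) → ℝ) : ℝ :=
  1 / 2 * (gagliardoForm s u u / ∫ x in Ω, |u x| ^ (p + 1)) +
    1 / (q + 1) * ((∫ x in Ω, |u x| ^ (q + 1)) /
      (∫ x in Ω, |u x| ^ (p + 1)) ^
        ((2 * s * (q + 1) - N * (p - 1)) / (2 * s * (p + 1) - N * (p - 1))))

/-- The Sobolev quotient `S(u) = [u]² / (∫_Ω |u|^{p+1})^{2/(p+1)}`. -/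
noncomputable def functionalS {N : ℕ} (s p : ℝ) (Ω : Set (EuclideanSpace ℝ (Fin N)))
    (u : EuclideanSpace ℝ (Fin N) → ℝ) : ℝ :=
  gagliardoForm s u u / (∫ x in Ω, |u x| ^ (p + 1)) ^ (2 / (p + 1))

/-- `𝒦 = inf {F(u, ℝ^N) : u ∈ D^{s,2}(ℝ^N) ∩ L^{q+1}(ℝ^N), ∫ |u|^{p+1} = 1}`. -/
noncomputable def constK (N : ℕ) (s p q : ℝ) : ℝ :=
  sInf {r : ℝ | ∃ u : EuclideanSpace ℝ (Fin N) → ℝ,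
    MemDs2 s u ∧ MemLpOn Set.univ (q + 1) u ∧ ∫ x, |u x| ^ (p + 1) = 1 ∧
      r = functionalF s p q Set.univ u}

/-- The Sobolev constant
`𝒮 = inf {[u]² / (∫ |u|^{2*})^{2/2*} : u ∈ D^{s,2}(ℝ^N), u ≠ 0}`. -/
noncomputable def constS (N : ℕ) (s : ℝ) : ℝ :=
  sInf {r : ℝ | ∃ u : EuclideanSpace ℝ (Fin N) → ℝ,
    MemDs2 s u ∧ ¬ (u =ᵐ[volume] 0) ∧
      r = gagliardoForm s u u / (∫ x, |u x| ^ critExp N s) ^ (2 / critExp N s)}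

/-!
The solutions are multiples of minimizers. For `δ > 0`, let `w` minimize
`½ [w]² + δ/(q+1) ∫ |w|^{q+1}` over `X_0(Ω) ∩ L^{q+1}` subject to `∫ |w|^{p+1} = 1`. The minimizer
solves `(-Δ)^s w = μ w^p - δ w^q` with `μ = [w]² + δ ∫ |w|^{q+1}`, and `u = μ^{1/(p-1)} w` solves
the equation with `ε = δ μ^{(1-q)/(p-1)}`. It remains to let `δ` vary along a sequence and to compare
the minimal energies with the infima over `ℝ^N`.

*Existence and regularity of the minimizer* (`exists_positive_minimizer`). Since `Ω` is bounded,
sequences of bounded energy are compact in `L²` (`exists_subseq_tendsto_eLpNorm`), and as `p + 1` lies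
strictly between `2` and `q + 1`, the constraint passes to the limit, however large `p` is
(`integral_rpow_eq_of_tendsto`). The Euler–Lagrange equation is first obtained for bounded test
functions. The right-hand side `μ w^p - δ w^q` is nonpositive where `w` is large, so `w` is bounded
(`ae_le_of_minimizer`), which in turn admits all test functions in `X_0(Ω)`. Positivity is the
nonlocal strong maximum principle (`ae_pos_of_weak_equation`).

*Reduction to compactly supported functions.* Every function of `D^{s,2}(ℝ^N)` is approximated by
bounded functions of bounded support that it dominates pointwise (`exists_trial_approx`), and
conversely such functions belong to `D^{s,2}(ℝ^N)` by mollification (`memDs2_of_bounded`). Both infima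
are therefore infima over trial functions, and a dilation about a point of the open set `Ω` squeezes
a trial function into `Ω`.

*Supercritical case* (`supercritical_solutions`). `F` is invariant under `R^{2s/(p-1)} u(R ·)`, while
this dilation multiplies `∫ |u|^{p+1}` by a negative power of `R`. On functions supported in `Ω` of
mass `∫ |u|^{p+1} = c^{p+1}`, minimizing `F` is the minimization above for a suitable `δ` depending
on `c`, and as `c → 0` every trial function fits into `Ω`; hence the minima converge to `𝒦`. The
constant `𝒦` is positive by the Sobolev inequality (`exists_pos_le_functionalF`), so the factors
`λ = c μ^{-1/(p-1)}` stay bounded away from `0` and infinity, and `l < 1` forces `ε → 0`.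

*Critical case* (`critical_solutions`). The Sobolev quotient is scale invariant, so as `δ → 0` the
minimal energies converge to `𝒮 / 2`. This forces `[w]² → 𝒮` and `δ ∫ |w|^{q+1} → 0`, so that
`μ → 𝒮 > 0`.
-/

/-! ### The Gagliardo form as an `L²` inner product -/

section Gagliardo

variable {N : ℕ}

local notation "𝔼" => EuclideanSpace ℝ (Fin N)

/-- The weighted difference quotient `(u(x) - u(y)) / |x - y|^((N + 2s)/2)`. The Gagliardo form of
`u` and `v` is the `L²(ℝ^N × ℝ^N)` inner product of their difference quotients. -/
noncomputable def gagliardoQuotient (s : ℝ) (u : 𝔼 → ℝ) (z : 𝔼 × 𝔼) : ℝ :=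
  (u z.1 - u z.2) / ‖z.1 - z.2‖ ^ (((N : ℝ) + 2 * s) / 2)

theorem gagliardoDensity_eq_mul (s : ℝ) (u v : 𝔼 → ℝ) (z : 𝔼 × 𝔼) :
    gagliardoDensity s u v z = gagliardoQuotient s u z * gagliardoQuotient s v z := by
  have h : ‖z.1 - z.2‖ ^ ((N : ℝ) + 2 * s) =
      ‖z.1 - z.2‖ ^ (((N : ℝ) + 2 * s) / 2) * ‖z.1 - z.2‖ ^ (((N : ℝ) + 2 * s) / 2) := by
    rw [← sq, ← Real.rpow_mul_natCast (norm_nonneg _)]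
    congr 1
    push_cast
    ring
  rw [gagliardoDensity, gagliardoQuotient, gagliardoQuotient, div_mul_div_comm, h]

theorem gagliardoQuotient_add (s : ℝ) (u v : 𝔼 → ℝ) :
    gagliardoQuotient s (u + v) = gagliardoQuotient s u + gagliardoQuotient s v := by
  funext z
  simp only [gagliardoQuotient, Pi.add_apply]
  ring

theorem gagliardoQuotient_smul (s c : ℝ) (u : 𝔼 → ℝ) :
    gagliardoQuotient s (c • u) = c • gagliardoQuotient s u := by
  funext z
  simp only [gagliardoQuotient, Pi.smul_apply, smul_eq_mul]
  ring

theorem ae_prod_of_ae {P : 𝔼 → Prop} (h : ∀ᵐ x, P x) : ∀ᵐ z : 𝔼 × 𝔼, P z.1 ∧ P z.2 := by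
  have h1 : ∀ᵐ z : 𝔼 × 𝔼, P z.1 := by
    rw [Measure.volume_eq_prod]
    exact Measure.quasiMeasurePreserving_fst.ae h
  have h2 : ∀ᵐ z : 𝔼 × 𝔼, P z.2 := by
    rw [Measure.volume_eq_prod]
    exact Measure.quasiMeasurePreserving_snd.ae h
  exact h1.and h2

theorem gagliardoQuotient_congr_ae (s : ℝ) {u v : 𝔼 → ℝ} (h : u =ᵐ[volume] v) :
    gagliardoQuotient s u =ᵐ[volume] gagliardoQuotient s v := by
  filter_upwards [ae_prod_of_ae h] with z hz
  rw [gagliardoQuotient, gagliardoQuotient, hz.1, hz.2]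

theorem measurable_norm_sub_rpow (a : ℝ) :
    Measurable (fun z : 𝔼 × 𝔼 => ‖z.1 - z.2‖ ^ a) :=
  (measurable_fst.sub measurable_snd).norm.pow_const a

theorem aestronglyMeasurable_gagliardoQuotient (s : ℝ) {u : 𝔼 → ℝ}
    (hu : AEStronglyMeasurable u volume) :
    AEStronglyMeasurable (gagliardoQuotient s u) volume := by
  have h1 : AEStronglyMeasurable (fun z : 𝔼 × 𝔼 => u z.1) volume := by
    rw [Measure.volume_eq_prod]; exact hu.comp_fst
  have h2 : AEStronglyMeasurable (fun z : 𝔼 × 𝔼 => u z.2) volume := by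
    rw [Measure.volume_eq_prod]; exact hu.comp_snd
  have := ((h1.sub h2).aemeasurable.div
    (measurable_norm_sub_rpow (((N : ℝ) + 2 * s) / 2)).aemeasurable)
  exact this.aestronglyMeasurable

theorem hasFiniteGagliardo_iff {s : ℝ} {u : 𝔼 → ℝ} (hu : AEStronglyMeasurable u volume) :
    HasFiniteGagliardo s u ↔ MemLp (gagliardoQuotient s u) 2 volume := by
  rw [memLp_two_iff_integrable_sq (aestronglyMeasurable_gagliardoQuotient s hu),
    HasFiniteGagliardo]
  have : gagliardoDensity s u u = fun z => gagliardoQuotient s u z ^ 2 := by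
    funext z
    rw [gagliardoDensity_eq_mul, sq]
  rw [this]

theorem gagliardoForm_eq_integral_mul (s : ℝ) (u v : 𝔼 → ℝ) :
    gagliardoForm s u v = ∫ z, gagliardoQuotient s u z * gagliardoQuotient s v z := by
  simp only [gagliardoForm, gagliardoDensity_eq_mul]

theorem gagliardoForm_self (s : ℝ) (u : 𝔼 → ℝ) :
    gagliardoForm s u u = ∫ z, gagliardoQuotient s u z ^ 2 := by
  simp only [gagliardoForm, gagliardoDensity_eq_mul, sq]

theorem gagliardoForm_self_nonneg (s : ℝ) (u : 𝔼 → ℝ) : 0 ≤ gagliardoForm s u u := by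
  rw [gagliardoForm_self]
  positivity

theorem gagliardoForm_congr_ae (s : ℝ) {u u' v v' : 𝔼 → ℝ} (h : u =ᵐ[volume] u')
    (h' : v =ᵐ[volume] v') : gagliardoForm s u v = gagliardoForm s u' v' := by
  rw [gagliardoForm_eq_integral_mul, gagliardoForm_eq_integral_mul]
  apply integral_congr_ae
  filter_upwards [gagliardoQuotient_congr_ae s h, gagliardoQuotient_congr_ae s h'] with z h1 h2
  rw [h1, h2]

theorem gagliardoForm_smul_smul (s a b : ℝ) (u v : 𝔼 → ℝ) :
    gagliardoForm s (a • u) (b • v) = a * b * gagliardoForm s u v := by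
  rw [gagliardoForm_eq_integral_mul, gagliardoForm_eq_integral_mul, ← integral_const_mul]
  congr 1
  funext z
  simp only [gagliardoQuotient_smul, Pi.smul_apply, smul_eq_mul]
  ring

/-- The squared seminorm, as the square of an `L²` seminorm with values in `[0, ∞]`. -/
theorem ofReal_gagliardoForm_self {s : ℝ} {u : 𝔼 → ℝ}
    (hu : MemLp (gagliardoQuotient s u) 2 volume) :
    ENNReal.ofReal (gagliardoForm s u u) = ∫⁻ z, ENNReal.ofReal (gagliardoQuotient s u z ^ 2) := by
  rw [gagliardoForm_self, ofReal_integral_eq_lintegral_ofReal hu.integrable_sq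
    (Eventually.of_forall fun z => sq_nonneg _)]

theorem abs_gagliardoQuotient (s : ℝ) (u : 𝔼 → ℝ) (z : 𝔼 × 𝔼) :
    |gagliardoQuotient s u z| =
      |u z.1 - u z.2| / ‖z.1 - z.2‖ ^ (((N : ℝ) + 2 * s) / 2) := by
  rw [gagliardoQuotient, abs_div, abs_of_nonneg (Real.rpow_nonneg (norm_nonneg _) _)]

theorem abs_gagliardoQuotient_le (s : ℝ) {u v : 𝔼 → ℝ} {z : 𝔼 × 𝔼}
    (h : |v z.1 - v z.2| ≤ |u z.1 - u z.2|) :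
    |gagliardoQuotient s v z| ≤ |gagliardoQuotient s u z| := by
  rw [abs_gagliardoQuotient, abs_gagliardoQuotient]
  gcongr

theorem memLp_gagliardoQuotient_of_le {s : ℝ} {u v : 𝔼 → ℝ} (hv : AEStronglyMeasurable v volume)
    (hu : MemLp (gagliardoQuotient s u) 2 volume)
    (h : ∀ x y, |v x - v y| ≤ |u x - u y|) : MemLp (gagliardoQuotient s v) 2 volume :=
  hu.mono (aestronglyMeasurable_gagliardoQuotient s hv)
    (Eventually.of_forall fun z => abs_gagliardoQuotient_le s (h z.1 z.2))

theorem gagliardoForm_self_le_of_le {s : ℝ} {u v : 𝔼 → ℝ}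
    (hu : MemLp (gagliardoQuotient s u) 2 volume)
    (h : ∀ x y, |v x - v y| ≤ |u x - u y|) : gagliardoForm s v v ≤ gagliardoForm s u u := by
  rw [gagliardoForm_self, gagliardoForm_self]
  refine integral_mono_of_nonneg (Eventually.of_forall fun z => sq_nonneg _) hu.integrable_sq
    (Eventually.of_forall fun z => ?_)
  exact sq_le_sq.mpr (abs_gagliardoQuotient_le s (h z.1 z.2))

/-- The square root of the squared seminorm is an `L²` norm. -/
theorem sqrt_gagliardoForm_self {s : ℝ} {u : 𝔼 → ℝ}
    (hu : MemLp (gagliardoQuotient s u) 2 volume) :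
    √(gagliardoForm s u u) = (eLpNorm (gagliardoQuotient s u) 2 volume).toReal := by
  have h2 : (0 : ℝ) ≤ (eLpNorm (gagliardoQuotient s u) 2 volume).toReal := ENNReal.toReal_nonneg
  rw [Real.sqrt_eq_iff_mul_self_eq (gagliardoForm_self_nonneg s u) h2, gagliardoForm_self,
    hu.eLpNorm_eq_integral_rpow_norm (by norm_num) (by norm_num),
    ENNReal.toReal_ofReal (by positivity)]
  simp only [ENNReal.toReal_ofNat, Real.rpow_ofNat, Real.norm_eq_abs, sq_abs]
  rw [← Real.rpow_add_of_nonneg (by positivity) (by norm_num) (by norm_num)]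
  norm_num

/-- A function whose increments are dominated by the sum of those of `u` and `v` has finite seminorm,
bounded by the triangle inequality. -/
theorem sqrt_gagliardoForm_le_add {s : ℝ} {u v w : 𝔼 → ℝ}
    (hu : MemLp (gagliardoQuotient s u) 2 volume) (hv : MemLp (gagliardoQuotient s v) 2 volume)
    (hw : AEStronglyMeasurable w volume)
    (h : ∀ x y, |w x - w y| ≤ |u x - u y| + |v x - v y|) :
    MemLp (gagliardoQuotient s w) 2 volume ∧
      √(gagliardoForm s w w) ≤ √(gagliardoForm s u u) + √(gagliardoForm s v v) := by
  have hb : ∀ z, ‖gagliardoQuotient s w z‖ ≤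
      ‖|gagliardoQuotient s u z| + |gagliardoQuotient s v z|‖ := by
    intro z
    rw [Real.norm_eq_abs, Real.norm_eq_abs, abs_of_nonneg (a := _ + _) (by positivity),
      abs_gagliardoQuotient, abs_gagliardoQuotient, abs_gagliardoQuotient, ← add_div]
    gcongr
    exact h z.1 z.2
  have hW : MemLp (gagliardoQuotient s w) 2 volume :=
    (hu.abs.add hv.abs).mono (aestronglyMeasurable_gagliardoQuotient s hw) (Eventually.of_forall hb)
  refine ⟨hW, ?_⟩
  rw [sqrt_gagliardoForm_self hu, sqrt_gagliardoForm_self hv, sqrt_gagliardoForm_self hW,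
    ← ENNReal.toReal_add hu.eLpNorm_ne_top hv.eLpNorm_ne_top]
  refine ENNReal.toReal_mono (ENNReal.add_ne_top.mpr ⟨hu.eLpNorm_ne_top, hv.eLpNorm_ne_top⟩) ?_
  calc eLpNorm (gagliardoQuotient s w) 2 volume
      ≤ eLpNorm (fun z => |gagliardoQuotient s u z| + |gagliardoQuotient s v z|) 2 volume :=
        eLpNorm_mono hb
    _ ≤ eLpNorm (fun z => |gagliardoQuotient s u z|) 2 volume +
        eLpNorm (fun z => |gagliardoQuotient s v z|) 2 volume :=
        eLpNorm_add_le hu.abs.1 hv.abs.1 (by norm_num)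
    _ = _ := by
        rw [← eLpNorm_norm (gagliardoQuotient s u), ← eLpNorm_norm (gagliardoQuotient s v)]
        rfl

theorem memX0_iff {Ω : Set 𝔼} {s : ℝ} {v : 𝔼 → ℝ} :
    MemX0 Ω s v ↔ MemLp v 2 ∧ MemLp (gagliardoQuotient s v) 2 volume ∧ ∀ᵐ x, x ∉ Ω → v x = 0 := by
  rw [MemX0, MemHs, and_assoc]
  exact ⟨fun h => ⟨h.1, (hasFiniteGagliardo_iff h.1.1).1 h.2.1, h.2.2⟩,
    fun h => ⟨h.1, (hasFiniteGagliardo_iff h.1.1).2 h.2.1, h.2.2⟩⟩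

/-! ### Lipschitz functions of bounded support have finite seminorm -/

/-- The radial kernel `min(1, |h|²) / |h|^(N + 2s)` is integrable: `2 - 2s > 0` at the origin,
`2s > 0` at infinity. -/
theorem integrable_min_one_sq_div (hN : 0 < N) {s : ℝ} (hs0 : 0 < s) (hs1 : s < 1) :
    Integrable (fun h : 𝔼 => min 1 (‖h‖ ^ 2) / ‖h‖ ^ ((N : ℝ) + 2 * s)) := by
  have : Nonempty (Fin N) := ⟨⟨0, hN⟩⟩
  have : Nontrivial 𝔼 := inferInstance
  rw [integrable_fun_norm_addHaar volume (f := fun r : ℝ => min 1 (r ^ 2) / r ^ ((N : ℝ) + 2 * s)),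
    finrank_euclideanSpace_fin, ← Set.Ioc_union_Ioi_eq_Ioi zero_le_one, integrableOn_union]
  constructor
  · have h : IntegrableOn (fun r : ℝ => r ^ (1 - 2 * s)) (Set.Ioc 0 1) :=
      (intervalIntegrable_iff_integrableOn_Ioc_of_le zero_le_one).1
        (intervalIntegral.intervalIntegrable_rpow' (by linarith))
    refine h.congr_fun (fun r hr => ?_) measurableSet_Ioc
    have hr0 : 0 < r := hr.1
    simp only [smul_eq_mul]
    rw [min_eq_right (by nlinarith [hr.2]), mul_div_assoc', ← Real.rpow_natCast,
      ← Real.rpow_natCast, ← Real.rpow_add hr0, ← Real.rpow_sub hr0]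
    congr 1
    rw [Nat.cast_sub (by omega)]
    push_cast
    ring
  · have h : IntegrableOn (fun r : ℝ => r ^ (-1 - 2 * s)) (Set.Ioi 1) :=
      integrableOn_Ioi_rpow_of_lt (by linarith) zero_lt_one
    refine h.congr_fun (fun r hr => ?_) measurableSet_Ioi
    have hr1 : 1 < r := hr
    have hr0 : 0 < r := by linarith
    simp only [smul_eq_mul]
    rw [min_eq_left (by nlinarith), mul_div_assoc', mul_one, ← Real.rpow_natCast,
      ← Real.rpow_sub hr0]
    congr 1
    rw [Nat.cast_sub (by omega)]
    push_cast
    ring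

theorem memLp_gagliardoQuotient_of_lipschitz (hN : 0 < N) {s : ℝ} (hs0 : 0 < s) (hs1 : s < 1)
    {u : 𝔼 → ℝ} {C R : ℝ} (hC : ∀ x y, |u x - u y| ≤ C * ‖x - y‖) (hb : ∀ x, |u x| ≤ C)
    (hsupp : ∀ x, R < ‖x‖ → u x = 0) : MemLp (gagliardoQuotient s u) 2 volume := by
  have hC0 : 0 ≤ C := (abs_nonneg _).trans (hb 0)
  have hcont : Continuous u := by
    refine continuous_iff_continuousAt.2 fun x => ?_
    have h0 : Tendsto (fun y => C * ‖y - x‖) (𝓝 x) (𝓝 0) := by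
      have : Continuous (fun y => C * ‖y - x‖) := by fun_prop
      simpa using this.tendsto x
    exact tendsto_iff_norm_sub_tendsto_zero.2
      (squeeze_zero (fun _ => norm_nonneg _) (fun y => hC y x) h0)
  have hu := hcont.aestronglyMeasurable (μ := (volume : Measure 𝔼))
  rw [← hasFiniteGagliardo_iff hu]
  set k : 𝔼 → ℝ := fun h => min 1 (‖h‖ ^ 2) / ‖h‖ ^ ((N : ℝ) + 2 * s) with hk
  have hkint : Integrable k := integrable_min_one_sq_div hN hs0 hs1
  set χ : 𝔼 → ℝ := (Metric.closedBall 0 R).indicator 1 with hχ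
  have hχint : Integrable χ := by
    rw [hχ, integrable_indicator_iff measurableSet_closedBall]
    exact integrableOn_const (measure_closedBall_lt_top.ne)
  have hk_even : ∀ h, k (-h) = k h := fun h => by simp [hk]
  have hI2 : Integrable (fun z : 𝔼 × 𝔼 => χ z.2 * k (z.1 - z.2)) := by
    rw [Measure.volume_eq_prod]
    exact hχint.convolution_integrand (ContinuousLinearMap.mul ℝ ℝ) hkint
  have hI1 : Integrable (fun z : 𝔼 × 𝔼 => χ z.1 * k (z.1 - z.2)) := by
    rw [Measure.volume_eq_prod] at hI2 ⊢
    refine hI2.swap.congr (Eventually.of_forall fun z => ?_)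
    simp only [Function.comp, Prod.fst_swap, Prod.snd_swap]
    rw [← hk_even, neg_sub]
  have hbound := (hI1.add hI2).const_mul (4 * C ^ 2)
  refine hbound.mono ?_ (Eventually.of_forall fun z => ?_)
  · have h := aestronglyMeasurable_gagliardoQuotient s hu
    exact (h.mul h).congr (Eventually.of_forall fun z => (gagliardoDensity_eq_mul s u u z).symm)
  · have hk0 : 0 ≤ k (z.1 - z.2) := by
      simp only [hk]; positivity
    have hχ0 : ∀ x, 0 ≤ χ x := fun x => Set.indicator_nonneg (fun _ _ => zero_le_one) x
    simp only [Pi.add_apply]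
    rw [Real.norm_of_nonneg (r := _ * _) (by have := hχ0 z.1; have := hχ0 z.2; positivity),
      ← add_mul]
    have hd : ‖gagliardoDensity s u u z‖ = (u z.1 - u z.2) ^ 2 / ‖z.1 - z.2‖ ^ ((N : ℝ) + 2 * s) := by
      rw [gagliardoDensity, ← sq, Real.norm_of_nonneg (by positivity)]
    rw [hd]
    by_cases hz : ‖z.1‖ ≤ R ∨ ‖z.2‖ ≤ R
    · have h1 : 1 ≤ χ z.1 + χ z.2 := by
        rcases hz with h | h
        · have : χ z.1 = 1 := Set.indicator_of_mem (by simpa using h) _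
          linarith [hχ0 z.2]
        · have : χ z.2 = 1 := Set.indicator_of_mem (by simpa using h) _
          linarith [hχ0 z.1]
      have h2 : (u z.1 - u z.2) ^ 2 ≤ 4 * C ^ 2 * min 1 (‖z.1 - z.2‖ ^ 2) := by
        rw [mul_min_of_nonneg _ _ (by positivity), le_min_iff]
        have hb1 := abs_le.1 (hb z.1)
        have hb2 := abs_le.1 (hb z.2)
        constructor
        · nlinarith
        · have h0 := mul_nonneg hC0 (norm_nonneg (z.1 - z.2))
          have := sq_le_sq' (by linarith [abs_nonneg (u z.1 - u z.2)]) (hC z.1 z.2)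
          rw [sq_abs] at this
          nlinarith [sq_nonneg (C * ‖z.1 - z.2‖)]
      calc (u z.1 - u z.2) ^ 2 / ‖z.1 - z.2‖ ^ ((N : ℝ) + 2 * s)
          ≤ (4 * C ^ 2 * min 1 (‖z.1 - z.2‖ ^ 2)) / ‖z.1 - z.2‖ ^ ((N : ℝ) + 2 * s) := by gcongr
        _ = 4 * C ^ 2 * (1 * k (z.1 - z.2)) := by simp only [hk]; ring
        _ ≤ _ := by gcongr
    · push Not at hz
      rw [hsupp _ hz.1, hsupp _ hz.2]
      have := hχ0 z.1
      have := hχ0 z.2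
      simp only [sub_self, ne_eq, OfNat.ofNat_ne_zero, not_false_eq_true, zero_pow, zero_div]
      positivity

theorem memLp_gagliardoQuotient_of_contDiff (hN : 0 < N) {s : ℝ} (hs0 : 0 < s) (hs1 : s < 1)
    {φ : 𝔼 → ℝ} (hφ : ContDiff ℝ ∞ φ) (hc : HasCompactSupport φ) :
    MemLp (gagliardoQuotient s φ) 2 volume := by
  obtain ⟨C, hC⟩ := hφ.lipschitzWith_of_hasCompactSupport hc (by simp)
  obtain ⟨M, hM⟩ := hc.exists_bound_of_continuous hφ.continuous
  obtain ⟨R, hR⟩ := hc.isCompact.isBounded.subset_closedBall (0 : 𝔼)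
  refine memLp_gagliardoQuotient_of_lipschitz (C := max C M) (R := R) hN hs0 hs1 (fun x y => ?_)
    (fun x => (hM x).trans (le_max_right _ _)) (fun x hx => ?_)
  · have := hC.dist_le_mul x y
    rw [Real.dist_eq, dist_eq_norm] at this
    exact this.trans (by gcongr; exact le_max_left _ _)
  · by_contra h
    have := hR (subset_tsupport _ h)
    rw [mem_closedBall_zero_iff] at this
    linarith

end Gagliardo

/-! ### The fractional Sobolev inequality -/

section Sobolev

variable {N : ℕ}

local notation "𝔼" => EuclideanSpace ℝ (Fin N)

theorem two_lt_critExp {s : ℝ} (hs0 : 0 < s) (hN : 2 * s < (N : ℝ)) : 2 < critExp N s := by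
  rw [critExp, lt_div_iff₀ (by linarith)]
  linarith

theorem volume_ball_eq (hN : 0 < N) (x : 𝔼) {r : ℝ} (hr : 0 ≤ r) :
    volume (Metric.ball x r) =
      ENNReal.ofReal (r ^ (N : ℝ) * (volume (Metric.ball (0 : 𝔼) 1)).toReal) := by
  have : Nonempty (Fin N) := ⟨⟨0, hN⟩⟩
  rw [Measure.addHaar_ball volume x hr, finrank_euclideanSpace_fin,
    ENNReal.ofReal_mul (by positivity), ENNReal.ofReal_toReal measure_ball_lt_top.ne,
    Real.rpow_natCast]

/-- Pointwise core of the Sobolev inequality: on the ball around `x` whose volume is twice the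
Markov bound for `{|u| > |u x| / 2}`, at least half of the points `y` have `|u x - u y| ≥ |u x|/2`. -/
theorem le_lintegral_gagliardoQuotient_sq (hN0 : 0 < N) {s m P : ℝ} (hs0 : 0 < s) (hm : 0 < m)
    {u : 𝔼 → ℝ} (hu : Measurable u) (hP : 0 < P)
    (huP : ∫⁻ y, ENNReal.ofReal (|u y| ^ m) = ENNReal.ofReal P) {x : 𝔼} (hx : u x ≠ 0)
    {β : ℝ} (hb : β = (volume (Metric.ball (0 : 𝔼) 1)).toReal) :
    ENNReal.ofReal (β / 8 * (2 * 2 ^ m / β) ^ (-(2 * s / N)) * P ^ (-(2 * s / N)) *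
        |u x| ^ (2 + m * (2 * s / N))) ≤
      ∫⁻ y, ENNReal.ofReal (gagliardoQuotient s u (x, y) ^ 2) := by
  have hb0 : 0 < β := by
    rw [hb]
    exact ENNReal.toReal_pos (Metric.measure_ball_pos _ _ one_pos).ne' measure_ball_lt_top.ne
  have hNr : (0 : ℝ) < N := by exact_mod_cast hN0
  set t := |u x| with ht
  have ht0 : 0 < t := abs_pos.2 hx
  set V : ℝ := 2 * 2 ^ m * P / t ^ m with hV
  have hV0 : 0 < V := by positivity
  set r : ℝ := (V / β) ^ (1 / (N : ℝ)) with hr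
  have hr0 : 0 < r := by positivity
  have hrN : r ^ (N : ℝ) = V / β := by
    rw [hr, ← Real.rpow_mul (by positivity), one_div_mul_cancel hNr.ne', Real.rpow_one]
  have hball : volume (Metric.ball x r) = ENNReal.ofReal V := by
    rw [volume_ball_eq hN0 x hr0.le, ← hb, hrN, div_mul_cancel₀ _ hb0.ne']
  set B : Set 𝔼 := {y | t / 2 ≤ |u y|} with hB
  have hBmeas : MeasurableSet B := measurableSet_le measurable_const hu.abs
  have hmarkov : volume B ≤ ENNReal.ofReal (V / 2) := by
    have h := mul_meas_ge_le_lintegral (μ := (volume : Measure 𝔼))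
      (f := fun y => ENNReal.ofReal (|u y| ^ m)) (by fun_prop) (ENNReal.ofReal ((t / 2) ^ m))
    rw [huP] at h
    have hsub : B ⊆ {y | ENNReal.ofReal ((t / 2) ^ m) ≤ ENNReal.ofReal (|u y| ^ m)} := fun y hy =>
      ENNReal.ofReal_le_ofReal (Real.rpow_le_rpow (by positivity) hy hm.le)
    have h2 : ENNReal.ofReal ((t / 2) ^ m) * volume B ≤ ENNReal.ofReal P :=
      (mul_le_mul_right (measure_mono hsub) _).trans h
    have hpos : 0 < (t / 2) ^ m := by positivity
    have h3 : volume B ≤ ENNReal.ofReal P / ENNReal.ofReal ((t / 2) ^ m) := by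
      rw [ENNReal.le_div_iff_mul_le (Or.inl (by simpa using hpos)) (Or.inl ENNReal.ofReal_ne_top),
        mul_comm]
      exact h2
    refine h3.trans (le_of_eq ?_)
    rw [← ENNReal.ofReal_div_of_pos hpos]
    congr 1
    rw [hV, Real.div_rpow ht0.le (by norm_num)]
    field_simp
  set A : Set 𝔼 := Metric.ball x r \ B with hA
  have hAmeas : MeasurableSet A := measurableSet_ball.diff hBmeas
  have hAvol : ENNReal.ofReal (V / 2) ≤ volume A := by
    have h1 : volume (Metric.ball x r) - volume B ≤ volume A := le_measure_sdiff
    refine le_trans ?_ h1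
    rw [hball]
    calc ENNReal.ofReal (V / 2) = ENNReal.ofReal V - ENNReal.ofReal (V / 2) := by
          rw [← ENNReal.ofReal_sub _ (by positivity)]; congr 1; ring
      _ ≤ _ := tsub_le_tsub_left hmarkov _
  have hlow : ∀ y ∈ A, ENNReal.ofReal (t ^ 2 / 4 / r ^ ((N : ℝ) + 2 * s)) ≤
      ENNReal.ofReal (gagliardoQuotient s u (x, y) ^ 2) := by
    intro y hy
    apply ENNReal.ofReal_le_ofReal
    have hy2 : |u y| < t / 2 := not_le.1 hy.2
    have hxy : x ≠ y := by
      rintro rfl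
      linarith
    have hd0 : 0 < ‖x - y‖ := norm_pos_iff.2 (sub_ne_zero.2 hxy)
    have hd : ‖x - y‖ ≤ r := by
      have := hy.1
      rw [Metric.mem_ball, dist_comm, dist_eq_norm] at this
      exact this.le
    rw [sq (gagliardoQuotient s u (x, y)), ← gagliardoDensity_eq_mul, gagliardoDensity]
    have hnum : t ^ 2 / 4 ≤ (u x - u y) * (u x - u y) := by
      have h1 : t - |u y| ≤ |u x - u y| := abs_sub_abs_le_abs_sub _ _
      rw [← abs_mul_abs_self]
      nlinarith
    dsimp only
    gcongr
    exact mul_self_nonneg _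
  calc ENNReal.ofReal (β / 8 * (2 * 2 ^ m / β) ^ (-(2 * s / N)) * P ^ (-(2 * s / N)) *
        t ^ (2 + m * (2 * s / N)))
      = ENNReal.ofReal (t ^ 2 / 4 / r ^ ((N : ℝ) + 2 * s)) * ENNReal.ofReal (V / 2) := by
        rw [← ENNReal.ofReal_mul (by positivity)]
        congr 1
        have h1 : r ^ (2 * s) = (2 * 2 ^ m / β) ^ (2 * s / N) * P ^ (2 * s / N) /
            t ^ (m * (2 * s / N)) := by
          rw [hr, ← Real.rpow_mul (by positivity), Real.rpow_mul ht0.le,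
            ← Real.mul_rpow (by positivity) (by positivity),
            ← Real.div_rpow (by positivity) (by positivity)]
          congr 1
          · rw [hV]; field_simp
          · field_simp
        rw [Real.rpow_add hr0, hrN, h1, Real.rpow_neg (by positivity), Real.rpow_neg hP.le,
          Real.rpow_add ht0, Real.rpow_two]
        field_simp
        norm_num
    _ ≤ ENNReal.ofReal (t ^ 2 / 4 / r ^ ((N : ℝ) + 2 * s)) * volume A := by gcongr
    _ = ∫⁻ y in A, ENNReal.ofReal (t ^ 2 / 4 / r ^ ((N : ℝ) + 2 * s)) := by
        rw [setLIntegral_const]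
    _ ≤ ∫⁻ y in A, ENNReal.ofReal (gagliardoQuotient s u (x, y) ^ 2) :=
        setLIntegral_mono' hAmeas hlow
    _ ≤ _ := setLIntegral_le_lintegral _ _

theorem integrable_rpow_abs_of_memLp {α : Type*} [MeasurableSpace α] {μ : Measure α} {r : ℝ}
    (hr : 0 < r) {u : α → ℝ} (hu : MemLp u (ENNReal.ofReal r) μ) :
    Integrable (fun x => |u x| ^ r) μ := by
  have h := hu.integrable_norm_rpow (by simpa using hr) ENNReal.ofReal_ne_top
  simpa only [ENNReal.toReal_ofReal hr.le, Real.norm_eq_abs] using h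

theorem memLp_of_integrable_rpow_abs {α : Type*} [MeasurableSpace α] {μ : Measure α} {r : ℝ}
    (hr : 0 < r) {u : α → ℝ} (hu : AEStronglyMeasurable u μ)
    (h : Integrable (fun x => |u x| ^ r) μ) : MemLp u (ENNReal.ofReal r) μ := by
  refine (integrable_norm_rpow_iff hu (by simpa using hr) ENNReal.ofReal_ne_top).1 ?_
  simpa only [ENNReal.toReal_ofReal hr.le, Real.norm_eq_abs] using h

theorem sobolev_inequality_of_measurable {s : ℝ} (hs0 : 0 < s)
    (hN : 2 * s < (N : ℝ)) : ∃ c : ℝ, 0 < c ∧ ∀ u : 𝔼 → ℝ, Measurable u →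
      MemLp u (ENNReal.ofReal (critExp N s)) → MemLp (gagliardoQuotient s u) 2 volume →
      c * (∫ x, |u x| ^ critExp N s) ^ (2 / critExp N s) ≤ gagliardoForm s u u := by
  have hNr : (0 : ℝ) < N := by linarith
  have hN0 : 0 < N := by exact_mod_cast hNr
  set m := critExp N s with hm
  have hm2 : 2 < m := two_lt_critExp hs0 hN
  set β := (volume (Metric.ball (0 : 𝔼) 1)).toReal with hb
  have hb0 : 0 < β :=
    ENNReal.toReal_pos (Metric.measure_ball_pos _ _ one_pos).ne' measure_ball_lt_top.ne
  refine ⟨β / 8 * (2 * 2 ^ m / β) ^ (-(2 * s / N)), by positivity, fun u hu hum hug => ?_⟩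
  have hint := integrable_rpow_abs_of_memLp (by linarith) hum
  set P := ∫ x, |u x| ^ m with hP
  have hP0 : 0 ≤ P := by positivity
  rcases hP0.eq_or_lt with h0 | hPpos
  · rw [← h0, Real.zero_rpow (by positivity), mul_zero]
    exact gagliardoForm_self_nonneg s u
  have hPl : ∫⁻ y, ENNReal.ofReal (|u y| ^ m) = ENNReal.ofReal P := by
    rw [hP, ofReal_integral_eq_lintegral_ofReal hint
      (Eventually.of_forall fun x => by positivity)]
  have hexp : 2 + m * (2 * s / N) = m := by
    have : (N : ℝ) - 2 * s ≠ 0 := by linarith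
    rw [hm, critExp]; field_simp; ring
  set c := β / 8 * (2 * 2 ^ m / β) ^ (-(2 * s / N)) with hc
  have hc0 : 0 < c := by positivity
  have hmain : ENNReal.ofReal (c * P ^ (-(2 * s / N)) * P) ≤
      ENNReal.ofReal (gagliardoForm s u u) := by
    rw [ofReal_gagliardoForm_self hug, Measure.volume_eq_prod, lintegral_prod _
      ((aestronglyMeasurable_gagliardoQuotient s hu.aestronglyMeasurable).aemeasurable.pow_const
        2).ennreal_ofReal,
      ENNReal.ofReal_mul (by positivity), ← hPl, ← lintegral_const_mul _ (by fun_prop)]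
    refine lintegral_mono fun x => ?_
    by_cases hx : u x = 0
    · simp only [hx, abs_zero]
      rw [Real.zero_rpow (by positivity)]
      simp
    · have h := le_lintegral_gagliardoQuotient_sq hN0 hs0 (by linarith) hu hPpos hPl hx hb
      rwa [hexp, ENNReal.ofReal_mul (by positivity)] at h
  rw [ENNReal.ofReal_le_ofReal_iff (gagliardoForm_self_nonneg s u)] at hmain
  have hPow : P ^ (2 / m) = P ^ (-(2 * s / N)) * P := by
    rw [← Real.rpow_add_one hPpos.ne']
    congr 1
    have : (N : ℝ) - 2 * s ≠ 0 := by linarith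
    rw [hm, critExp]; field_simp; ring
  rw [hPow, ← mul_assoc]
  exact hmain

/-- The fractional Sobolev inequality, for functions already known to lie in `L^{2*}`. -/
theorem sobolev_inequality {s : ℝ} (hs0 : 0 < s)
    (hN : 2 * s < (N : ℝ)) : ∃ c : ℝ, 0 < c ∧ ∀ u : 𝔼 → ℝ,
      MemLp u (ENNReal.ofReal (critExp N s)) → MemLp (gagliardoQuotient s u) 2 volume →
      c * (∫ x, |u x| ^ critExp N s) ^ (2 / critExp N s) ≤ gagliardoForm s u u := by
  obtain ⟨c, hc, h⟩ := sobolev_inequality_of_measurable hs0 hN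
  refine ⟨c, hc, fun u hu hug => ?_⟩
  have hae := hu.1.ae_eq_mk
  have := h (hu.1.mk u) hu.1.stronglyMeasurable_mk.measurable (hu.ae_eq hae)
    (hug.ae_eq (gagliardoQuotient_congr_ae s hae))
  rw [gagliardoForm_congr_ae s hae hae]
  convert this using 3
  exact integral_congr_ae (hae.mono fun x hx => by dsimp only; rw [← hx])

end Sobolev

/-! ### Smooth approximation of compactly supported functions -/

section Density

variable {N : ℕ}

local notation "𝔼" => EuclideanSpace ℝ (Fin N)

instance isAddHaarMeasure_volume_prod : (volume : Measure (𝔼 × 𝔼)).IsAddHaarMeasure := by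
  rw [Measure.volume_eq_prod]
  infer_instance

theorem measurePreserving_sub_diag (t : 𝔼) :
    MeasurePreserving (fun z : 𝔼 × 𝔼 => z - (t, t)) volume volume :=
  measurePreserving_sub_right volume (t, t)

/-- Diagonal translations act continuously on `L²(ℝ^N × ℝ^N)`. -/
theorem tendsto_lintegral_sub_translate {V : 𝔼 × 𝔼 → ℝ} (hV : MemLp V 2 volume) :
    Tendsto (fun t : 𝔼 => ∫⁻ z, ENNReal.ofReal ((V z - V (z - (t, t))) ^ 2)) (𝓝 0) (𝓝 0) := by
  let g : C(𝔼, C(𝔼 × 𝔼, 𝔼 × 𝔼)) :=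
    (ContinuousMap.mk (fun a : 𝔼 × (𝔼 × 𝔼) => a.2 - (a.1, a.1)) (by fun_prop)).curry
  have hgm : ∀ t, MeasurePreserving (g t) volume volume := measurePreserving_sub_diag
  have hcont : Continuous fun t : 𝔼 =>
      Lp.compMeasurePreserving (g t) (hgm t) hV.toLp :=
    Continuous.compMeasurePreservingLp (f := fun _ : 𝔼 => hV.toLp) (μ := volume) (ν := volume)
      (g := g) continuous_const g.continuous hgm (by norm_num)
  have h0 : Lp.compMeasurePreserving (g 0) (hgm 0) hV.toLp = hV.toLp := by
    rw [Lp.toLp_compMeasurePreserving]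
    congr 1
    funext z
    exact congrArg V (sub_zero z)
  have h1 : Tendsto (fun t : 𝔼 => ENNReal.ofReal (‖hV.toLp -
      Lp.compMeasurePreserving (g t) (hgm t) hV.toLp‖) ^ 2) (𝓝 0) (𝓝 0) := by
    have h2 : Continuous fun t : 𝔼 => ENNReal.ofReal (‖hV.toLp -
      Lp.compMeasurePreserving (g t) (hgm t) hV.toLp‖) ^ 2 :=
      (ENNReal.continuous_pow 2).comp (ENNReal.continuous_ofReal.comp
        (continuous_const.sub hcont).norm)
    have h3 := h2.tendsto 0
    rw [h0] at h3
    simpa using h3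
  refine h1.congr fun t => ?_
  have h4 : MemLp (V ∘ g t) 2 volume := hV.comp_measurePreserving (hgm t)
  rw [Lp.toLp_compMeasurePreserving, ← MemLp.toLp_sub, Lp.norm_toLp,
    ENNReal.ofReal_toReal (hV.sub h4).eLpNorm_ne_top,
    eLpNorm_eq_lintegral_rpow_enorm_toReal (by norm_num) (by norm_num)]
  simp only [ENNReal.toReal_ofNat]
  rw [← ENNReal.rpow_natCast, ← ENNReal.rpow_mul]
  norm_num
  refine lintegral_congr fun z => ?_
  rw [← ofReal_norm, ← ENNReal.ofReal_pow (norm_nonneg _), Real.norm_eq_abs, sq_abs]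
  rfl

/-- Jensen's inequality for the square and a probability density. -/
theorem ofReal_sq_integral_mul_le {ρ f : 𝔼 → ℝ} (hρ : Measurable ρ) (hρ0 : ∀ t, 0 ≤ ρ t)
    (hρ1 : ∫⁻ t, ENNReal.ofReal (ρ t) = 1) (hf : Measurable f) :
    ENNReal.ofReal ((∫ t, ρ t * f t) ^ 2) ≤
      ∫⁻ t, ENNReal.ofReal (ρ t) * ENNReal.ofReal (f t ^ 2) := by
  set ν : Measure 𝔼 := volume.withDensity (fun t => ENNReal.ofReal (ρ t)) with hν
  have hprob : IsProbabilityMeasure ν := ⟨by rw [hν, withDensity_apply _ MeasurableSet.univ,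
    Measure.restrict_univ, hρ1]⟩
  have h1 : ∫⁻ t, ‖f t‖ₑ ∂ν ≤ (∫⁻ t, ‖f t‖ₑ ^ (2 : ℝ) ∂ν) ^ (1 / (2 : ℝ)) := by
    have h := eLpNorm_le_eLpNorm_of_exponent_le (μ := ν) (p := 1) (q := 2) (by norm_num)
      hf.aestronglyMeasurable
    rw [eLpNorm_one_eq_lintegral_enorm,
      eLpNorm_eq_lintegral_rpow_enorm_toReal (by norm_num) (by norm_num)] at h
    simpa only [ENNReal.toReal_ofNat] using h
  have h2 : ∀ g : 𝔼 → ENNReal, Measurable g →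
      ∫⁻ t, g t ∂ν = ∫⁻ t, ENNReal.ofReal (ρ t) * g t := fun g hg => by
    rw [hν, lintegral_withDensity_eq_lintegral_mul _ hρ.ennreal_ofReal hg]
    rfl
  have h3 : ‖∫ t, ρ t * f t‖ₑ ≤ ∫⁻ t, ‖f t‖ₑ ∂ν := by
    rw [h2 _ hf.enorm]
    refine (enorm_integral_le_lintegral_enorm _).trans (le_of_eq ?_)
    refine lintegral_congr fun t => ?_
    rw [enorm_mul, Real.enorm_eq_ofReal (hρ0 t)]
  have h4 : ENNReal.ofReal ((∫ t, ρ t * f t) ^ 2) = ‖∫ t, ρ t * f t‖ₑ ^ (2 : ℝ) := by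
    rw [← ofReal_norm, ENNReal.ofReal_rpow_of_nonneg (norm_nonneg _) (by norm_num),
      Real.rpow_two, Real.norm_eq_abs, sq_abs]
  calc ENNReal.ofReal ((∫ t, ρ t * f t) ^ 2) = ‖∫ t, ρ t * f t‖ₑ ^ (2 : ℝ) := h4
    _ ≤ ((∫⁻ t, ‖f t‖ₑ ^ (2 : ℝ) ∂ν) ^ (1 / (2 : ℝ))) ^ (2 : ℝ) := by
        gcongr
        exact h3.trans h1
    _ = ∫⁻ t, ‖f t‖ₑ ^ (2 : ℝ) ∂ν := by
        rw [← ENNReal.rpow_mul]; norm_num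
    _ = ∫⁻ t, ENNReal.ofReal (ρ t) * ‖f t‖ₑ ^ (2 : ℝ) := h2 _ (hf.enorm.pow_const 2)
    _ = _ := by
        refine lintegral_congr fun t => ?_
        rw [← ofReal_norm, ENNReal.ofReal_rpow_of_nonneg (norm_nonneg _) (by norm_num),
          Real.rpow_two, Real.norm_eq_abs, sq_abs]

/-- Mollification commutes with difference quotients: it averages them over diagonal translations. -/
theorem gagliardoQuotient_sub_mollify {s : ℝ} {w ρ : 𝔼 → ℝ}
    (hρw : ∀ x, Integrable fun t => ρ t * w (x - t)) (hρ1 : ∫ t, ρ t = 1) (hρi : Integrable ρ)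
    (z : 𝔼 × 𝔼) :
    gagliardoQuotient s (w - fun x => ∫ t, ρ t * w (x - t)) z = ∫ t, ρ t *
      (gagliardoQuotient s w z - gagliardoQuotient s w (z - (t, t))) := by
  have h1 : ∀ t, ρ t * (gagliardoQuotient s w z - gagliardoQuotient s w (z - (t, t))) =
      (((w z.1 - w z.2) * ρ t) - (ρ t * w (z.1 - t) - ρ t * w (z.2 - t))) /
        ‖z.1 - z.2‖ ^ (((N : ℝ) + 2 * s) / 2) := fun t => by
    simp only [gagliardoQuotient, Prod.fst_sub, Prod.snd_sub, sub_sub_sub_cancel_right]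
    ring
  simp only [h1]
  have h2 : Integrable fun t => ρ t * w (z.1 - t) - ρ t * w (z.2 - t) :=
    (hρw z.1).sub (hρw z.2)
  rw [integral_div, integral_sub (hρi.const_mul _) h2,
    integral_sub (hρw _) (hρw _), integral_const_mul, hρ1]
  simp only [gagliardoQuotient, Pi.sub_apply]
  ring

/-- Mollifications of a function of bounded support and finite energy approximate it in energy. -/
theorem exists_contDiff_form_sub_le {s : ℝ} {w : 𝔼 → ℝ} (hw : Measurable w) (hwi : Integrable w)
    {R : ℝ} (hsupp : ∀ x, R < ‖x‖ → w x = 0) (hwg : MemLp (gagliardoQuotient s w) 2 volume)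
    {ε : ℝ} (hε : 0 < ε) :
    ∃ φ : 𝔼 → ℝ, ContDiff ℝ ∞ φ ∧ HasCompactSupport φ ∧
      MemLp (gagliardoQuotient s (w - φ)) 2 volume ∧ gagliardoForm s (w - φ) (w - φ) ≤ ε := by
  have hV := hwg
  set V := gagliardoQuotient s w with hVdef
  have hVm : Measurable V := by
    rw [hVdef]
    exact ((hw.comp measurable_fst).sub (hw.comp measurable_snd)).div (measurable_norm_sub_rpow _)
  have hlim := tendsto_lintegral_sub_translate hV
  have hev := (ENNReal.tendsto_nhds_zero.1 hlim) (ENNReal.ofReal ε) (by simpa using hε)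
  obtain ⟨δ, hδ, hball⟩ := Metric.eventually_nhds_iff.1 hev
  let b : ContDiffBump (0 : 𝔼) := ⟨δ / 2, δ, by positivity, by linarith⟩
  set ρ := b.normed volume with hρ
  have hρ0 : ∀ t, 0 ≤ ρ t := b.nonneg_normed
  have hρi : Integrable ρ := b.integrable_normed
  have hρ1 : ∫ t, ρ t = 1 := b.integral_normed
  have hρc : Continuous ρ := b.continuous_normed
  have hρl : ∫⁻ t, ENNReal.ofReal (ρ t) = 1 := by
    rw [← ofReal_integral_eq_lintegral_ofReal hρi (Eventually.of_forall hρ0), hρ1,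
      ENNReal.ofReal_one]
  have hρw : ∀ x, Integrable fun t => ρ t * w (x - t) := fun x =>
    b.hasCompactSupport_normed.convolutionExists_left (ContinuousLinearMap.mul ℝ ℝ) hρc
      hwi.locallyIntegrable x
  have hwc : HasCompactSupport w := HasCompactSupport.of_support_subset_isCompact
    (isCompact_closedBall (0 : 𝔼) R) fun x hx => by
      rw [mem_closedBall_zero_iff]
      by_contra h
      exact hx (hsupp x (not_le.1 h))
  set φ : 𝔼 → ℝ := fun x => ∫ t, ρ t * w (x - t) with hφ
  have hφd : ContDiff ℝ ∞ φ := b.hasCompactSupport_normed.contDiff_convolution_left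
    (ContinuousLinearMap.mul ℝ ℝ) b.contDiff_normed hwi.locallyIntegrable
  have hφc : HasCompactSupport φ :=
    b.hasCompactSupport_normed.convolution (ContinuousLinearMap.mul ℝ ℝ) hwc
  have hmeas : AEStronglyMeasurable (gagliardoQuotient s (w - φ)) volume :=
    aestronglyMeasurable_gagliardoQuotient s
      (hw.sub hφd.continuous.measurable).aestronglyMeasurable
  have hkey : ∫⁻ z, ENNReal.ofReal (gagliardoQuotient s (w - φ) z ^ 2) ≤ ENNReal.ofReal ε := by
    calc ∫⁻ z, ENNReal.ofReal (gagliardoQuotient s (w - φ) z ^ 2)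
        ≤ ∫⁻ z, ∫⁻ t, ENNReal.ofReal (ρ t) * ENNReal.ofReal ((V z - V (z - (t, t))) ^ 2) := by
          refine lintegral_mono fun z => ?_
          rw [gagliardoQuotient_sub_mollify hρw hρ1 hρi z]
          exact ofReal_sq_integral_mul_le hρc.measurable hρ0 hρl
            (measurable_const.sub (hVm.comp (by fun_prop)))
      _ = ∫⁻ t, ∫⁻ z, ENNReal.ofReal (ρ t) * ENNReal.ofReal ((V z - V (z - (t, t))) ^ 2) := by
          refine lintegral_lintegral_swap (Measurable.aemeasurable ?_)
          have : Measurable fun a : (𝔼 × 𝔼) × 𝔼 => V (a.1 - (a.2, a.2)) := hVm.comp (by fun_prop)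
          unfold Function.uncurry
          have := hρc.measurable
          fun_prop
      _ = ∫⁻ t, ENNReal.ofReal (ρ t) * ∫⁻ z, ENNReal.ofReal ((V z - V (z - (t, t))) ^ 2) := by
          refine lintegral_congr fun t => ?_
          rw [lintegral_const_mul _ (by fun_prop)]
      _ ≤ ∫⁻ t, ENNReal.ofReal (ρ t) * ENNReal.ofReal ε := by
          refine lintegral_mono fun t => ?_
          by_cases ht : ρ t = 0
          · simp [ht]
          · have : t ∈ Metric.ball (0 : 𝔼) δ := by
              have h := b.support_normed_eq (μ := volume)
              rw [← h]
              exact ht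
            gcongr
            exact hball this
      _ = ENNReal.ofReal ε := by
          rw [lintegral_mul_const _ (by fun_prop), hρl, one_mul]
  have hmem : MemLp (gagliardoQuotient s (w - φ)) 2 volume := by
    rw [memLp_two_iff_integrable_sq hmeas]
    refine ⟨hmeas.pow 2, ?_⟩
    rw [hasFiniteIntegral_iff_ofReal (Eventually.of_forall fun z => sq_nonneg _)]
    exact hkey.trans_lt ENNReal.ofReal_lt_top
  refine ⟨φ, hφd, hφc, hmem, ?_⟩
  rwa [← ofReal_gagliardoForm_self hmem, ENNReal.ofReal_le_ofReal_iff hε.le] at hkey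

/-- Bounded functions of bounded support and finite energy belong to `D^{s,2}(ℝ^N)`. -/
theorem memDs2_of_bounded {s : ℝ} {v : 𝔼 → ℝ} {Ω : Set 𝔼}
    (hΩ : Bornology.IsBounded Ω) (hv : MemX0 Ω s v) {M : ℝ} (hM : ∀ᵐ x, |v x| ≤ M) :
    MemDs2 s v := by
  rw [memX0_iff] at hv
  obtain ⟨h2, hg, hz⟩ := hv
  obtain ⟨R, hR⟩ := hΩ.subset_closedBall (0 : 𝔼)
  have hae := h2.1.ae_eq_mk
  set w : 𝔼 → ℝ := (Metric.closedBall (0 : 𝔼) R).indicator (h2.1.mk v) with hw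
  have hvw : v =ᵐ[volume] w := by
    filter_upwards [hae, hz] with x hx hxz
    by_cases h : x ∈ Metric.closedBall (0 : 𝔼) R
    · rw [hw, Set.indicator_of_mem h, ← hx]
    · rw [hw, Set.indicator_of_notMem h, hxz fun h' => h (hR h')]
  have hwm : Measurable w :=
    h2.1.stronglyMeasurable_mk.measurable.indicator measurableSet_closedBall
  have hwb : ∀ᵐ x, |w x| ≤ M := by
    filter_upwards [hM, hvw] with x hx h
    rwa [← h]
  have hws : ∀ x, R < ‖x‖ → w x = 0 := fun x hx => by
    rw [hw, Set.indicator_of_notMem]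
    simpa using hx
  have hwon : ∀ p : ENNReal, MemLp w p := fun p => by
    have h : MemLp w p (volume.restrict (Metric.closedBall (0 : 𝔼) R)) := by
      have : IsFiniteMeasure ((volume : Measure 𝔼).restrict (Metric.closedBall (0 : 𝔼) R)) :=
        ⟨by simpa using measure_closedBall_lt_top⟩
      exact MemLp.of_bound hwm.aestronglyMeasurable M (ae_restrict_of_ae hwb)
    have h' := (memLp_indicator_iff_restrict measurableSet_closedBall).2 h
    rwa [hw, Set.indicator_indicator, Set.inter_self] at h'
  have hwg := hg.ae_eq (gagliardoQuotient_congr_ae s hvw)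
  refine ⟨by rw [MemLpOn, Measure.restrict_univ]; exact (hwon _).ae_eq hvw.symm, ?_⟩
  have hex : ∀ k : ℕ, ∃ φ : 𝔼 → ℝ, ContDiff ℝ ∞ φ ∧ HasCompactSupport φ ∧
      MemLp (gagliardoQuotient s (w - φ)) 2 volume ∧
      gagliardoForm s (w - φ) (w - φ) ≤ 1 / ((k : ℝ) + 1) := fun k =>
    exists_contDiff_form_sub_le hwm (memLp_one_iff_integrable.1 (hwon 1)) hws hwg (by positivity)
  choose φ h1 h2' h3 h4 using hex
  have hsub : ∀ k, v - φ k =ᵐ[volume] w - φ k := fun k => hvw.sub (EventuallyEq.refl _ _)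
  refine ⟨φ, fun k => ⟨h1 k, h2' k⟩, fun k => ?_, ?_⟩
  · rw [hasFiniteGagliardo_iff (h2.1.sub (h1 k).continuous.aestronglyMeasurable)]
    exact (h3 k).ae_eq (gagliardoQuotient_congr_ae s (hsub k).symm)
  · refine squeeze_zero (fun k => gagliardoForm_self_nonneg s _) (fun k => ?_)
      tendsto_one_div_add_atTop_nhds_zero_nat
    rw [gagliardoForm_congr_ae s (hsub k) (hsub k)]
    exact h4 k

end Density

/-! ### Compactness of energy-bounded sequences in `L²` -/

section Compactness

variable {N : ℕ}

local notation "𝔼" => EuclideanSpace ℝ (Fin N)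

theorem two_mul_ofReal (a : ℝ) : 2 * ENNReal.ofReal a = ENNReal.ofReal (2 * a) := by
  rw [ENNReal.ofReal_mul (by norm_num), ENNReal.ofReal_ofNat]

/-- The uniform probability density of the ball of radius `r` about the origin. -/
noncomputable def ballDensity (N : ℕ) (r : ℝ) : EuclideanSpace ℝ (Fin N) → ℝ :=
  (Metric.ball 0 r).indicator fun _ => (volume.real (Metric.ball (0 : EuclideanSpace ℝ (Fin N)) r))⁻¹

/-- The average of `f` over the ball of radius `r` about `x`. -/
noncomputable def ballMean (r : ℝ) (f : 𝔼 → ℝ) (x : 𝔼) : ℝ := ∫ t, ballDensity N r t * f (x - t)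

theorem volume_real_ball_pos {r : ℝ} (hr : 0 < r) : 0 < volume.real (Metric.ball (0 : 𝔼) r) :=
  ENNReal.toReal_pos (Metric.measure_ball_pos _ _ hr).ne' measure_ball_lt_top.ne

theorem measurable_ballDensity (r : ℝ) : Measurable (ballDensity N r) :=
  measurable_const.indicator measurableSet_ball

theorem ballDensity_nonneg (r : ℝ) (t : 𝔼) : 0 ≤ ballDensity N r t :=
  Set.indicator_nonneg (fun _ _ => inv_nonneg.2 measureReal_nonneg) t

theorem memLp_ballDensity (r : ℝ) (p : ENNReal) : MemLp (ballDensity N r) p :=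
  memLp_indicator_const p measurableSet_ball _ (Or.inr measure_ball_lt_top.ne)

theorem integral_ballDensity {r : ℝ} (hr : 0 < r) : ∫ t, ballDensity N r t = 1 := by
  rw [ballDensity, integral_indicator measurableSet_ball, setIntegral_const, smul_eq_mul,
    mul_inv_cancel₀ (volume_real_ball_pos hr).ne']

theorem lintegral_ballDensity {r : ℝ} (hr : 0 < r) :
    ∫⁻ t, ENNReal.ofReal (ballDensity N r t) = 1 := by
  rw [← ofReal_integral_eq_lintegral_ofReal (memLp_one_iff_integrable.1 (memLp_ballDensity r 1))
    (Eventually.of_forall (ballDensity_nonneg r)), integral_ballDensity hr, ENNReal.ofReal_one]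

theorem memLp_comp_sub_left {f : 𝔼 → ℝ} (hf : MemLp f 2) (x : 𝔼) : MemLp (fun t => f (x - t)) 2 :=
  hf.comp_measurePreserving (Measure.measurePreserving_sub_left volume x)

theorem integrable_ballDensity_mul {f : 𝔼 → ℝ} (hf : MemLp f 2) (r : ℝ) (x : 𝔼) :
    Integrable fun t => ballDensity N r t * f (x - t) :=
  (memLp_ballDensity r 2).integrable_mul (memLp_comp_sub_left hf x)

theorem ballMean_sub {f g : 𝔼 → ℝ} (hf : MemLp f 2) (hg : MemLp g 2) (r : ℝ) (x : 𝔼) :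
    ballMean r (f - g) x = ballMean r f x - ballMean r g x := by
  rw [ballMean, ballMean, ballMean, ← integral_sub (integrable_ballDensity_mul hf r x)
    (integrable_ballDensity_mul hg r x)]
  simp only [Pi.sub_apply, mul_sub]

theorem measurable_ballMean {f : 𝔼 → ℝ} (hf : Measurable f) (r : ℝ) : Measurable (ballMean r f) := by
  have h : Measurable (Function.uncurry fun (x t : 𝔼) => ballDensity N r t * f (x - t)) := by
    unfold Function.uncurry
    have := measurable_ballDensity (N := N) r
    fun_prop
  exact h.stronglyMeasurable.integral_prod_right.measurable

theorem ballMean_eq_zero {f : 𝔼 → ℝ} {R r : ℝ} (hf : ∀ x, R < ‖x‖ → f x = 0) {x : 𝔼}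
    (hx : R + r < ‖x‖) : ballMean r f x = 0 := by
  rw [ballMean]
  refine integral_eq_zero_of_ae (Eventually.of_forall fun t => ?_)
  by_cases ht : t ∈ Metric.ball (0 : 𝔼) r
  · have h1 : ‖t‖ < r := by simpa using ht
    have h2 := norm_sub_norm_le x t
    simp only [Pi.zero_apply]
    rw [hf _ (by linarith), mul_zero]
  · simp only [Pi.zero_apply]
    rw [ballDensity, Set.indicator_of_notMem ht, zero_mul]

theorem sq_ballMean_le {f : 𝔼 → ℝ} (hf : Measurable f) (hf2 : MemLp f 2) {r : ℝ} (hr : 0 < r)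
    (x : 𝔼) : ballMean r f x ^ 2 ≤ (volume.real (Metric.ball (0 : 𝔼) r))⁻¹ * ∫ y, f y ^ 2 := by
  have hv := volume_real_ball_pos (N := N) hr
  have h0 : (0 : ℝ) ≤ ∫ y, f y ^ 2 := integral_nonneg fun y => sq_nonneg _
  have h1 := ofReal_sq_integral_mul_le (measurable_ballDensity r) (ballDensity_nonneg r)
    (lintegral_ballDensity hr) (hf.comp (measurable_const.sub measurable_id) : Measurable
      fun t => f (x - t))
  rw [← ENNReal.ofReal_le_ofReal_iff (by positivity)]
  refine h1.trans ?_
  calc ∫⁻ t, ENNReal.ofReal (ballDensity N r t) * ENNReal.ofReal (f (x - t) ^ 2)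
      ≤ ∫⁻ t, ENNReal.ofReal (volume.real (Metric.ball (0 : 𝔼) r))⁻¹ *
          ENNReal.ofReal (f (x - t) ^ 2) := by
        refine lintegral_mono fun t => ?_
        dsimp only
        gcongr
        exact Set.indicator_le_self' (fun _ _ => by positivity) t
    _ = ENNReal.ofReal (volume.real (Metric.ball (0 : 𝔼) r))⁻¹ *
          ∫⁻ t, ENNReal.ofReal (f (x - t) ^ 2) := lintegral_const_mul' _ _ ENNReal.ofReal_ne_top
    _ = _ := by
        rw [lintegral_sub_left_eq_self (fun y => ENNReal.ofReal (f y ^ 2)) x,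
          ← ofReal_integral_eq_lintegral_ofReal hf2.integrable_sq
            (Eventually.of_forall fun y => sq_nonneg _), ENNReal.ofReal_mul (by positivity)]

/-- The distance in `L²` from `f` to its means over balls of radius `r` is controlled by the
energy, with a factor that vanishes with `r`. -/
theorem integral_sq_le_energy_add_ballMean (hN : 0 < N) {s : ℝ} (hs0 : 0 < s) {f : 𝔼 → ℝ}
    (hf : Measurable f) (hf2 : MemLp f 2) (hg : MemLp (gagliardoQuotient s f) 2 volume) {r : ℝ}
    (hr : 0 < r) :
    ∫⁻ x, ENNReal.ofReal (f x ^ 2) ≤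
      2 * ENNReal.ofReal (r ^ (2 * s) / volume.real (Metric.ball (0 : 𝔼) 1) * gagliardoForm s f f) +
        2 * ∫⁻ x, ENNReal.ofReal (ballMean r f x ^ 2) := by
  have hv := volume_real_ball_pos (N := N) hr
  have hv1 := volume_real_ball_pos (N := N) one_pos
  have hball : volume.real (Metric.ball (0 : 𝔼) r) =
      r ^ (N : ℝ) * volume.real (Metric.ball (0 : 𝔼) 1) := by
    rw [Measure.real, volume_ball_eq hN 0 hr.le, ENNReal.toReal_ofReal (by positivity)]
    rfl
  have hpt : ∀ x, ENNReal.ofReal ((f x - ballMean r f x) ^ 2) ≤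
      ENNReal.ofReal (r ^ (2 * s) / volume.real (Metric.ball (0 : 𝔼) 1)) *
        ∫⁻ y, ENNReal.ofReal (gagliardoQuotient s f (x, y) ^ 2) := by
    intro x
    have h1 : f x - ballMean r f x = ∫ t, ballDensity N r t * (f x - f (x - t)) := by
      have hi : Integrable fun t => ballDensity N r t * f x :=
        (memLp_one_iff_integrable.1 (memLp_ballDensity r 1)).mul_const _
      simp only [mul_sub]
      rw [integral_sub hi (integrable_ballDensity_mul hf2 r x), integral_mul_const,
        integral_ballDensity hr, one_mul, ballMean]
    rw [h1]
    refine (ofReal_sq_integral_mul_le (f := fun t => f x - f (x - t)) (measurable_ballDensity r)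
      (ballDensity_nonneg r) (lintegral_ballDensity hr) (measurable_const.sub
        (hf.comp (measurable_const.sub measurable_id)))).trans ?_
    rw [← lintegral_sub_left_eq_self (fun y => ENNReal.ofReal (gagliardoQuotient s f (x, y) ^ 2)) x,
      ← lintegral_const_mul' _ _ ENNReal.ofReal_ne_top]
    refine lintegral_mono fun t => ?_
    rw [← ENNReal.ofReal_mul (ballDensity_nonneg r t), ← ENNReal.ofReal_mul (by positivity)]
    apply ENNReal.ofReal_le_ofReal
    by_cases ht : t ∈ Metric.ball (0 : 𝔼) r
    · have h1 : ‖t‖ < r := by simpa using ht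
      rw [ballDensity, Set.indicator_of_mem ht, sq (gagliardoQuotient _ _ _),
        ← gagliardoDensity_eq_mul, gagliardoDensity]
      dsimp only
      rw [sub_sub_cancel]
      by_cases ht0 : t = 0
      · simp [ht0]
      have hpos : 0 < ‖t‖ := norm_pos_iff.2 ht0
      have h2 : ‖t‖ ^ ((N : ℝ) + 2 * s) ≤ r ^ ((N : ℝ) + 2 * s) := by gcongr
      have h3 : r ^ (2 * s) / volume.real (Metric.ball (0 : 𝔼) 1) =
          (volume.real (Metric.ball (0 : 𝔼) r))⁻¹ * r ^ ((N : ℝ) + 2 * s) := by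
        rw [hball, Real.rpow_add hr]
        field_simp
      rw [h3, mul_assoc, ← sq]
      gcongr
      rw [mul_div_assoc', le_div_iff₀ (by positivity), mul_comm]
      gcongr
    · rw [ballDensity, Set.indicator_of_notMem ht, zero_mul]
      positivity
  have hAm := measurable_ballMean hf r
  calc ∫⁻ x, ENNReal.ofReal (f x ^ 2)
      ≤ ∫⁻ x, (2 * ENNReal.ofReal ((f x - ballMean r f x) ^ 2) +
          2 * ENNReal.ofReal (ballMean r f x ^ 2)) := by
        refine lintegral_mono fun x => ?_
        rw [← mul_add, ← ENNReal.ofReal_add (sq_nonneg _) (sq_nonneg _),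
          two_mul_ofReal]
        apply ENNReal.ofReal_le_ofReal
        nlinarith [sq_nonneg (f x - ballMean r f x - ballMean r f x)]
    _ = 2 * (∫⁻ x, ENNReal.ofReal ((f x - ballMean r f x) ^ 2)) +
          2 * ∫⁻ x, ENNReal.ofReal (ballMean r f x ^ 2) := by
        rw [lintegral_add_left (by fun_prop), lintegral_const_mul _ (by fun_prop),
          lintegral_const_mul _ (by fun_prop)]
    _ ≤ _ := by
        gcongr
        rw [ENNReal.ofReal_mul (by positivity), ofReal_gagliardoForm_self hg,
          Measure.volume_eq_prod, lintegral_prod _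
            ((aestronglyMeasurable_gagliardoQuotient s
              hf.aestronglyMeasurable).aemeasurable.pow_const 2).ennreal_ofReal,
          ← lintegral_const_mul' _ _ ENNReal.ofReal_ne_top]
        exact lintegral_mono hpt

/-- Weak sequential compactness of bounded sequences in `L²`. -/
theorem exists_subseq_tendsto_integral_mul {w : ℕ → 𝔼 → ℝ} (hw : ∀ k, MemLp (w k) 2) {M : ℝ}
    (hM : ∀ k, ∫ x, w k x ^ 2 ≤ M) : ∃ φ : ℕ → ℕ, StrictMono φ ∧ ∀ g : 𝔼 → ℝ, MemLp g 2 →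
      ∃ a, Tendsto (fun k => ∫ x, g x * w (φ k) x) atTop (𝓝 a) := by
  have hfact : Fact ((2 : ENNReal) ≠ ⊤) := ⟨by norm_num⟩
  have hM0 : 0 ≤ M := (integral_nonneg fun x => sq_nonneg (w 0 x)).trans (hM 0)
  let H := Lp ℝ 2 (volume : Measure 𝔼)
  let f : ℕ → H := fun k => (hw k).toLp
  have hinner : ∀ k (g : 𝔼 → ℝ) (hg : MemLp g 2), inner ℝ (f k) hg.toLp = ∫ x, g x * w k x := by
    intro k g hg
    rw [L2.inner_def]
    refine integral_congr_ae ?_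
    filter_upwards [(hw k).coeFn_toLp, hg.coeFn_toLp] with x h1 h2
    rw [h1, h2]
    rfl
  have hnorm : ∀ k, ‖f k‖ ≤ √M := fun k => by
    apply Real.le_sqrt_of_sq_le
    rw [← real_inner_self_eq_norm_sq, hinner k (w k) (hw k)]
    simpa only [sq] using hM k
  let F : ℕ → WeakDual ℝ H := fun k => StrongDual.toWeakDual (InnerProductSpace.toDual ℝ H (f k))
  have hF : ∀ k, F k ∈ WeakDual.toStrongDual ⁻¹' Metric.closedBall (0 : StrongDual ℝ H) √M := by
    intro k
    simp only [Set.mem_preimage, mem_closedBall_zero_iff]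
    change ‖InnerProductSpace.toDual ℝ H (f k)‖ ≤ √M
    rw [LinearIsometryEquiv.norm_map]
    exact hnorm k
  obtain ⟨Λ, -, φ, hφ, hlim⟩ := WeakDual.isSeqCompact_closedBall ℝ H 0 √M hF
  refine ⟨φ, hφ, fun g hg => ⟨Λ hg.toLp, ?_⟩⟩
  have h := ((WeakDual.eval_continuous (𝕜 := ℝ) (hg.toLp : H)).tendsto Λ).comp hlim
  refine h.congr fun k => ?_
  rw [← hinner (φ k) g hg]
  rfl

/-- Along a weakly convergent sequence the means over balls of a fixed radius converge in `L²`: they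
converge pointwise and are uniformly bounded with a common bounded support. -/
theorem tendsto_lintegral_sq_ballMean_sub {w : ℕ → 𝔼 → ℝ} (hm : ∀ k, Measurable (w k))
    (hw : ∀ k, MemLp (w k) 2) {M R r : ℝ} (hr : 0 < r) (hM : ∀ k, ∫ x, w k x ^ 2 ≤ M)
    (hsupp : ∀ k x, R < ‖x‖ → w k x = 0)
    (hweak : ∀ g : 𝔼 → ℝ, MemLp g 2 → ∃ a, Tendsto (fun k => ∫ x, g x * w k x) atTop (𝓝 a)) :
    ∃ a : 𝔼 → ℝ, Measurable a ∧
      Tendsto (fun k => ∫⁻ x, ENNReal.ofReal ((ballMean r (w k) x - a x) ^ 2)) atTop (𝓝 0) := by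
  have hM0 : 0 ≤ M := (integral_nonneg fun x => sq_nonneg (w 0 x)).trans (hM 0)
  have hv := volume_real_ball_pos (N := N) hr
  have hpt : ∀ x, ∃ a, Tendsto (fun k => ballMean r (w k) x) atTop (𝓝 a) := by
    intro x
    obtain ⟨a, ha⟩ := hweak (fun y => ballDensity N r (x - y))
      (memLp_comp_sub_left (memLp_ballDensity r 2) x)
    refine ⟨a, ha.congr fun k => ?_⟩
    rw [ballMean, ← integral_sub_left_eq_self (fun t => ballDensity N r t * w k (x - t)) volume x]
    simp only [sub_sub_cancel]
  choose a ha using hpt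
  have ham : Measurable a := measurable_of_tendsto_metrizable
    (fun k => measurable_ballMean (hm k) r) (tendsto_pi_nhds.2 ha)
  refine ⟨a, ham, ?_⟩
  set B : ℝ := (volume.real (Metric.ball (0 : 𝔼) r))⁻¹ * M with hB
  have hB0 : 0 ≤ B := by positivity
  have hk : ∀ k x, ballMean r (w k) x ^ 2 ≤ B := fun k x =>
    (sq_ballMean_le (hm k) (hw k) hr x).trans (mul_le_mul_of_nonneg_left (hM k) (by positivity))
  have haB : ∀ x, a x ^ 2 ≤ B := fun x =>
    le_of_tendsto ((ha x).pow 2) (Eventually.of_forall fun k => hk k x)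
  have ha0 : ∀ x, R + r < ‖x‖ → a x = 0 := fun x hx =>
    tendsto_nhds_unique (ha x) (tendsto_const_nhds.congr fun k =>
      (ballMean_eq_zero (hsupp k) hx).symm)
  set b : 𝔼 → ENNReal := (Metric.closedBall (0 : 𝔼) (R + r)).indicator
    fun _ => ENNReal.ofReal (4 * B) with hb
  have h0 : ∫⁻ _ : 𝔼, (0 : ENNReal) = 0 := lintegral_zero
  rw [← h0]
  refine tendsto_lintegral_of_dominated_convergence b (fun k => ?_) (fun k => ?_) ?_ ?_
  · have := measurable_ballMean (hm k) r
    fun_prop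
  · refine Eventually.of_forall fun x => ?_
    by_cases hx : x ∈ Metric.closedBall (0 : 𝔼) (R + r)
    · rw [hb, Set.indicator_of_mem hx]
      apply ENNReal.ofReal_le_ofReal
      nlinarith [hk k x, haB x, sq_nonneg (ballMean r (w k) x + a x)]
    · have hx' : R + r < ‖x‖ := by simpa using hx
      dsimp only
      rw [ballMean_eq_zero (hsupp k) hx', ha0 x hx']
      simp
  · rw [hb, lintegral_indicator measurableSet_closedBall, setLIntegral_const]
    exact ENNReal.mul_ne_top ENNReal.ofReal_ne_top measure_closedBall_lt_top.ne
  · refine Eventually.of_forall fun x => ?_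
    have h1 : Tendsto (fun k => (ballMean r (w k) x - a x) ^ 2) atTop (𝓝 0) := by
      simpa using ((ha x).sub_const (a x)).pow 2
    simpa using ENNReal.tendsto_ofReal h1

/-- Fractional Rellich theorem: a sequence of functions supported in a fixed ball and bounded in
`L²` and in energy has a subsequence that converges in `L²`. -/
theorem exists_subseq_tendsto_eLpNorm (hN : 0 < N) {s : ℝ} (hs0 : 0 < s) {w : ℕ → 𝔼 → ℝ}
    (hm : ∀ k, Measurable (w k)) (hw : ∀ k, MemLp (w k) 2)
    (hg : ∀ k, MemLp (gagliardoQuotient s (w k)) 2 volume) {M R : ℝ}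
    (hM : ∀ k, ∫ x, w k x ^ 2 ≤ M) (hE : ∀ k, gagliardoForm s (w k) (w k) ≤ M)
    (hsupp : ∀ k x, R < ‖x‖ → w k x = 0) :
    ∃ (φ : ℕ → ℕ) (v : 𝔼 → ℝ), StrictMono φ ∧ MemLp v 2 ∧
      Tendsto (fun k => eLpNorm (w (φ k) - v) 2 volume) atTop (𝓝 0) := by
  have hM0 : 0 ≤ M := (integral_nonneg fun x => sq_nonneg (w 0 x)).trans (hM 0)
  have hv1 := volume_real_ball_pos (N := N) one_pos
  obtain ⟨φ, hφ, hweak⟩ := exists_subseq_tendsto_integral_mul hw hM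
  let f : ℕ → Lp ℝ 2 (volume : Measure 𝔼) := fun k => (hw (φ k)).toLp
  have hdist : ∀ k j, dist (f k) (f j) = (eLpNorm (w (φ k) - w (φ j)) 2 volume).toReal := by
    intro k j
    rw [dist_eq_norm, ← MemLp.toLp_sub, Lp.norm_toLp]
  have hnorm : ∀ g : 𝔼 → ℝ, eLpNorm g 2 volume ^ 2 = ∫⁻ x, ENNReal.ofReal (g x ^ 2) := by
    intro g
    rw [eLpNorm_eq_lintegral_rpow_enorm_toReal (by norm_num) (by norm_num)]
    simp only [ENNReal.toReal_ofNat]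
    rw [← ENNReal.rpow_natCast, ← ENNReal.rpow_mul]
    norm_num
    refine lintegral_congr fun z => ?_
    rw [← ofReal_norm, ← ENNReal.ofReal_pow (norm_nonneg _), Real.norm_eq_abs, sq_abs]
  have hcauchy : CauchySeq f := by
    rw [Metric.cauchySeq_iff]
    intro ε hε
    set η : ℝ := ε ^ 2 / 4 with hη
    have hη0 : 0 < η := by positivity
    -- the radius makes the energy term `2 * (r^(2s)/|B_1|) * 4M` at most `ε²/4`
    obtain ⟨r, hr, hrM⟩ : ∃ r : ℝ, 0 < r ∧
        2 * (r ^ (2 * s) / volume.real (Metric.ball (0 : 𝔼) 1) * (4 * M)) ≤ η := by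
      have hc : Tendsto (fun r : ℝ => 2 * (r ^ (2 * s) /
          volume.real (Metric.ball (0 : 𝔼) 1) * (4 * M))) (𝓝[>] 0) (𝓝 0) := by
        have h1 : Tendsto (fun r : ℝ => r ^ (2 * s)) (𝓝[>] 0) (𝓝 0) := by
          have := (Real.continuousAt_rpow_const 0 (2 * s) (Or.inr (by linarith))).tendsto
          rw [Real.zero_rpow (by linarith)] at this
          exact this.mono_left nhdsWithin_le_nhds
        simpa using ((h1.div_const (volume.real (Metric.ball (0 : 𝔼) 1))).mul_const
          (4 * M)).const_mul 2
      obtain ⟨r, h1, h2⟩ := ((hc.eventually (ge_mem_nhds hη0)).and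
        self_mem_nhdsWithin).exists
      exact ⟨r, h2, h1⟩
    obtain ⟨a, ham, ha⟩ := tendsto_lintegral_sq_ballMean_sub (w := fun k => w (φ k))
      (fun k => hm _) (fun k => hw _) hr (fun k => hM _) (fun k => hsupp _) hweak
    obtain ⟨n, hn⟩ := eventually_atTop.1 ((ENNReal.tendsto_nhds_zero.1 ha)
      (ENNReal.ofReal (η / 8)) (by simpa using hη0))
    refine ⟨n, fun k hk j hj => ?_⟩
    set g := w (φ k) - w (φ j) with hgdef
    have hgm : Measurable g := (hm _).sub (hm _)
    have hg2 : MemLp g 2 := (hw _).sub (hw _)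
    have hgE := sqrt_gagliardoForm_le_add (s := s) (w := g) (hg (φ k)) (hg (φ j))
      hgm.aestronglyMeasurable (fun x y => by
        have hxy : g x - g y = (w (φ k) x - w (φ k) y) - (w (φ j) x - w (φ j) y) := by
          simp only [hgdef, Pi.sub_apply]
          ring
        rw [hxy]
        exact abs_sub _ _)
    have hgE2 : gagliardoForm s g g ≤ 4 * M := by
      have h1 : √(gagliardoForm s g g) ≤ 2 * √M := hgE.2.trans (by
        have := Real.sqrt_le_sqrt (hE (φ k))
        have := Real.sqrt_le_sqrt (hE (φ j))
        linarith)
      have h2 := Real.sq_sqrt (gagliardoForm_self_nonneg s g)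
      have h3 := Real.sq_sqrt hM0
      have h4 := Real.sqrt_nonneg (gagliardoForm s g g)
      nlinarith
    have hmean : ∫⁻ x, ENNReal.ofReal (ballMean r g x ^ 2) ≤ ENNReal.ofReal (η / 2) := by
      have mk := measurable_ballMean (hm (φ k)) r
      have mj := measurable_ballMean (hm (φ j)) r
      calc ∫⁻ x, ENNReal.ofReal (ballMean r g x ^ 2)
          ≤ ∫⁻ x, (2 * ENNReal.ofReal ((ballMean r (w (φ k)) x - a x) ^ 2) +
              2 * ENNReal.ofReal ((ballMean r (w (φ j)) x - a x) ^ 2)) := by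
            refine lintegral_mono fun x => ?_
            rw [← mul_add, ← ENNReal.ofReal_add (sq_nonneg _) (sq_nonneg _),
              two_mul_ofReal]
            apply ENNReal.ofReal_le_ofReal
            rw [hgdef, ballMean_sub (hw _) (hw _)]
            nlinarith [sq_nonneg ((ballMean r (w (φ k)) x - a x) +
              (ballMean r (w (φ j)) x - a x))]
        _ = 2 * (∫⁻ x, ENNReal.ofReal ((ballMean r (w (φ k)) x - a x) ^ 2)) +
              2 * ∫⁻ x, ENNReal.ofReal ((ballMean r (w (φ j)) x - a x) ^ 2) := by
            rw [lintegral_add_left (by fun_prop), lintegral_const_mul _ (by fun_prop),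
              lintegral_const_mul _ (by fun_prop)]
        _ ≤ 2 * ENNReal.ofReal (η / 8) + 2 * ENNReal.ofReal (η / 8) := by
            gcongr
            · exact hn k hk
            · exact hn j hj
        _ = ENNReal.ofReal (η / 2) := by
            rw [two_mul_ofReal, ← ENNReal.ofReal_add (by positivity) (by positivity)]
            congr 1
            ring
    have hfin : eLpNorm g 2 volume ^ 2 ≤ ENNReal.ofReal (2 * η) := by
      rw [hnorm]
      refine (integral_sq_le_energy_add_ballMean hN hs0 hgm hg2 hgE.1 hr).trans ?_
      calc 2 * ENNReal.ofReal (r ^ (2 * s) / volume.real (Metric.ball (0 : 𝔼) 1) *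
              gagliardoForm s g g) + 2 * ∫⁻ x, ENNReal.ofReal (ballMean r g x ^ 2)
          ≤ 2 * ENNReal.ofReal (r ^ (2 * s) / volume.real (Metric.ball (0 : 𝔼) 1) * (4 * M)) +
              2 * ENNReal.ofReal (η / 2) := by gcongr
        _ = ENNReal.ofReal (2 * (r ^ (2 * s) / volume.real (Metric.ball (0 : 𝔼) 1) * (4 * M)) +
              η) := by
            rw [two_mul_ofReal, two_mul_ofReal, ← ENNReal.ofReal_add (by positivity)
                (by positivity)]
            congr 1
            ring
        _ ≤ _ := ENNReal.ofReal_le_ofReal (by linarith)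
    rw [hdist]
    have h5 : (eLpNorm g 2 volume).toReal ^ 2 ≤ 2 * η := by
      rw [← ENNReal.toReal_pow]
      exact ENNReal.toReal_le_of_le_ofReal (by positivity) hfin
    nlinarith [ENNReal.toReal_nonneg (a := eLpNorm g 2 volume)]
  obtain ⟨v, hv⟩ := cauchySeq_tendsto_of_complete hcauchy
  refine ⟨φ, v, hφ, Lp.memLp v, ?_⟩
  have h := (Lp.tendsto_Lp_iff_tendsto_eLpNorm' f v).1 hv
  refine h.congr fun k => eLpNorm_congr_ae ?_
  exact (hw (φ k)).coeFn_toLp.sub (EventuallyEq.refl _ _)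

end Compactness

/-! ### Constrained minimizers on bounded sets -/

section Minimizer

variable {N : ℕ}

local notation "𝔼" => EuclideanSpace ℝ (Fin N)

/-- Fatou's lemma for nonnegative real functions whose integrals converge. -/
theorem integral_le_of_ae_tendsto {α : Type*} [MeasurableSpace α] {μ : Measure α}
    {f : ℕ → α → ℝ} {g : α → ℝ} {A : ℝ} (hi : ∀ k, Integrable (f k) μ)
    (h0 : ∀ k, ∀ᵐ x ∂μ, 0 ≤ f k x) (hlim : ∀ᵐ x ∂μ, Tendsto (fun k => f k x) atTop (𝓝 (g x)))
    (hA : Tendsto (fun k => ∫ x, f k x ∂μ) atTop (𝓝 A)) : Integrable g μ ∧ ∫ x, g x ∂μ ≤ A := by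
  have hg : AEStronglyMeasurable g μ := aestronglyMeasurable_of_tendsto_ae atTop
    (fun k => (hi k).1) hlim
  have hg0 : ∀ᵐ x ∂μ, 0 ≤ g x := by
    filter_upwards [ae_all_iff.2 h0, hlim] with x h1 h2
    exact ge_of_tendsto' h2 h1
  have hF : ∫⁻ x, ENNReal.ofReal (g x) ∂μ ≤ ENNReal.ofReal A := by
    have h1 : ∫⁻ x, ENNReal.ofReal (g x) ∂μ =
        ∫⁻ x, liminf (fun k => ENNReal.ofReal (f k x)) atTop ∂μ := by
      refine lintegral_congr_ae ?_
      filter_upwards [hlim] with x hx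
      exact (ENNReal.tendsto_ofReal hx).liminf_eq.symm
    rw [h1]
    refine (lintegral_liminf_le' fun k => (hi k).1.aemeasurable.ennreal_ofReal).trans
      (le_of_eq ?_)
    refine Tendsto.liminf_eq ?_
    refine (ENNReal.tendsto_ofReal hA).congr fun k => ?_
    rw [ofReal_integral_eq_lintegral_ofReal (hi k) (h0 k)]
  have hgi : Integrable g μ := ⟨hg, by
    rw [hasFiniteIntegral_iff_ofReal hg0]
    exact hF.trans_lt ENNReal.ofReal_lt_top⟩
  refine ⟨hgi, ?_⟩
  have hA0 : 0 ≤ A := ge_of_tendsto' hA fun k => integral_nonneg_of_ae (h0 k)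
  rwa [← ofReal_integral_eq_lintegral_ofReal hgi hg0, ENNReal.ofReal_le_ofReal_iff hA0] at hF

/-- The functional `½ [w]² + δ/(q+1) ∫ |w|^{q+1}`. -/
noncomputable def energyJ (s q δ : ℝ) (w : 𝔼 → ℝ) : ℝ :=
  1 / 2 * gagliardoForm s w w + δ / (q + 1) * ∫ x, |w x| ^ (q + 1)

/-- Membership in `X_0(Ω) ∩ L^{q+1}` with the normalization `∫ |w|^{p+1} = 1`. -/
def Admissible (Ω : Set 𝔼) (s p q : ℝ) (w : 𝔼 → ℝ) : Prop :=
  MemX0 Ω s w ∧ MemLp w (ENNReal.ofReal (q + 1)) ∧ ∫ x, |w x| ^ (p + 1) = 1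

theorem energyJ_nonneg {s q δ : ℝ} (hq : 0 ≤ q) (hδ : 0 ≤ δ) (w : 𝔼 → ℝ) : 0 ≤ energyJ s q δ w := by
  have h1 := gagliardoForm_self_nonneg s w
  rw [energyJ]
  positivity

theorem memX0_congr_ae {Ω : Set 𝔼} {s : ℝ} {v w : 𝔼 → ℝ} (h : v =ᵐ[volume] w)
    (hv : MemX0 Ω s v) : MemX0 Ω s w := by
  rw [memX0_iff] at hv ⊢
  refine ⟨hv.1.ae_eq h, hv.2.1.ae_eq (gagliardoQuotient_congr_ae s h), ?_⟩
  filter_upwards [hv.2.2, h] with x h1 h2 hx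
  rw [← h2, h1 hx]

theorem integral_abs_rpow_congr_ae {v w : 𝔼 → ℝ} (h : v =ᵐ[volume] w) (r : ℝ) :
    ∫ x, |v x| ^ r = ∫ x, |w x| ^ r :=
  integral_congr_ae (h.mono fun x hx => by dsimp only; rw [hx])

theorem energyJ_congr_ae {s q δ : ℝ} {v w : 𝔼 → ℝ} (h : v =ᵐ[volume] w) :
    energyJ s q δ v = energyJ s q δ w := by
  rw [energyJ, energyJ, gagliardoForm_congr_ae s h h, integral_abs_rpow_congr_ae h]

theorem admissible_congr_ae {Ω : Set 𝔼} {s p q : ℝ} {v w : 𝔼 → ℝ} (h : v =ᵐ[volume] w)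
    (hv : Admissible Ω s p q v) : Admissible Ω s p q w :=
  ⟨memX0_congr_ae h hv.1, hv.2.1.ae_eq h, by rw [← integral_abs_rpow_congr_ae h]; exact hv.2.2⟩

/-- Members of `X_0(Ω)` have measurable representatives that vanish at every point outside `Ω`. -/
theorem exists_measurable_rep {Ω : Set 𝔼} (hΩ : MeasurableSet Ω) {s : ℝ} {v : 𝔼 → ℝ}
    (hv : MemX0 Ω s v) : ∃ w : 𝔼 → ℝ, Measurable w ∧ v =ᵐ[volume] w ∧ ∀ x, x ∉ Ω → w x = 0 := by
  have hae := hv.1.1.1.ae_eq_mk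
  refine ⟨Ω.indicator (hv.1.1.1.mk v), hv.1.1.1.stronglyMeasurable_mk.measurable.indicator hΩ, ?_,
    fun x hx => Set.indicator_of_notMem hx _⟩
  filter_upwards [hae, hv.2] with x h1 h2
  by_cases hx : x ∈ Ω
  · rw [Set.indicator_of_mem hx, ← h1]
  · rw [Set.indicator_of_notMem hx, h2 hx]

/-- Splitting at the level `T` bounds the intermediate power by the two outer ones. -/
theorem rpow_le_mul_rpow_add_mul_sq {p q T t : ℝ} (hp : 1 < p) (hq : p < q) (hT : 0 < T)
    (ht : 0 ≤ t) : t ^ (p + 1) ≤ T ^ (p - q) * t ^ (q + 1) + T ^ (p - 1) * t ^ 2 := by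
  rcases ht.eq_or_lt with rfl | ht
  · rw [Real.zero_rpow (by linarith), Real.zero_rpow (by linarith)]
    simp
  rcases le_total T t with h | h
  · have h1 : t ^ (p - q) ≤ T ^ (p - q) := Real.rpow_le_rpow_of_nonpos hT h (by linarith)
    calc t ^ (p + 1) = t ^ (p - q) * t ^ (q + 1) := by
          rw [← Real.rpow_add ht]; congr 1; ring
      _ ≤ T ^ (p - q) * t ^ (q + 1) := by gcongr
      _ ≤ _ := le_add_of_nonneg_right (by positivity)
  · have h1 : t ^ (p - 1) ≤ T ^ (p - 1) := Real.rpow_le_rpow ht.le h (by linarith)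
    calc t ^ (p + 1) = t ^ (p - 1) * t ^ 2 := by
          rw [← Real.rpow_two, ← Real.rpow_add ht]; congr 1; ring
      _ ≤ T ^ (p - 1) * t ^ 2 := by gcongr
      _ ≤ _ := le_add_of_nonneg_left (by positivity)

theorem tendsto_integral_sq_of_tendsto_eLpNorm {α : Type*} [MeasurableSpace α] {μ : Measure α}
    {f : ℕ → α → ℝ} {g : α → ℝ} (hf : ∀ k, MemLp (f k) 2 μ) (hg : MemLp g 2 μ)
    (h : Tendsto (fun k => eLpNorm (f k - g) 2 μ) atTop (𝓝 0)) :
    Tendsto (fun k => ∫ x, f k x ^ 2 ∂μ) atTop (𝓝 (∫ x, g x ^ 2 ∂μ)) := by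
  have h1 : Tendsto (fun k => (hf k).toLp) atTop (𝓝 hg.toLp) :=
    (Lp.tendsto_Lp_iff_tendsto_eLpNorm'' f hf g hg).2 h
  have h2 : ∀ (v : α → ℝ) (hv : MemLp v 2 μ), ‖hv.toLp‖ ^ 2 = ∫ x, v x ^ 2 ∂μ := by
    intro v hv
    rw [← real_inner_self_eq_norm_sq, L2.inner_def]
    refine integral_congr_ae (hv.coeFn_toLp.mono fun x hx => ?_)
    simp only [hx, sq]
    rfl
  have h3 := h1.norm.pow 2
  simpa only [h2] using h3

theorem integral_mul_add_mul_sub {α : Type*} [MeasurableSpace α] {μ : Measure α} {f g h : α → ℝ}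
    (hf : Integrable f μ) (hg : Integrable g μ) (hh : Integrable h μ) (a b : ℝ) :
    ∫ x, a * f x + b * g x - h x ∂μ = a * (∫ x, f x ∂μ) + b * (∫ x, g x ∂μ) - ∫ x, h x ∂μ := by
  have h1 : Integrable (fun x => a * f x + b * g x) μ := (hf.const_mul a).add (hg.const_mul b)
  rw [integral_sub h1 hh, integral_add (hf.const_mul a) (hg.const_mul b), integral_const_mul,
    integral_const_mul]

/-- If a sequence converges in `L²` and almost everywhere, and its `L^{q+1}` norms are bounded, then
no mass of the intermediate power `p + 1` is lost. -/
theorem integral_rpow_eq_of_tendsto {p q : ℝ} (hp : 1 < p) (hq : p < q) {f : ℕ → 𝔼 → ℝ}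
    {v : 𝔼 → ℝ} {B : ℝ} (hf : ∀ k, MemLp (f k) 2) (hv : MemLp v 2)
    (h2 : Tendsto (fun k => eLpNorm (f k - v) 2 volume) atTop (𝓝 0))
    (hae : ∀ᵐ x, Tendsto (fun k => f k x) atTop (𝓝 (v x)))
    (hfq : ∀ k, Integrable fun x => |f k x| ^ (q + 1))
    (hB : Tendsto (fun k => ∫ x, |f k x| ^ (q + 1)) atTop (𝓝 B))
    (hfp : ∀ k, ∫ x, |f k x| ^ (p + 1) = 1) :
    ∫ x, |v x| ^ (p + 1) = 1 := by
  have hfpi : ∀ k, Integrable fun x => |f k x| ^ (p + 1) := fun k => by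
    by_contra h
    have := hfp k
    rw [integral_undef h] at this
    norm_num at this
  have habs : ∀ r : ℝ, 0 < r → ∀ᵐ x, Tendsto (fun k => |f k x| ^ r) atTop (𝓝 (|v x| ^ r)) :=
    fun r hr => hae.mono fun x hx => (hx.abs).rpow_const (Or.inr hr.le)
  have hvp := integral_le_of_ae_tendsto hfpi
    (fun k => Eventually.of_forall fun x => by positivity) (habs (p + 1) (by linarith))
    (tendsto_const_nhds.congr fun k => (hfp k).symm)
  have hvq := integral_le_of_ae_tendsto hfq
    (fun k => Eventually.of_forall fun x => by positivity) (habs (q + 1) (by linarith)) hB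
  have hsq := tendsto_integral_sq_of_tendsto_eLpNorm hf hv h2
  refine le_antisymm hvp.2 ?_
  -- Fatou's lemma for the nonnegative difference of the two sides of the splitting at level `T`
  have hT : ∀ T : ℝ, 0 < T → 1 - T ^ (p - q) * B ≤ ∫ x, |v x| ^ (p + 1) := by
    intro T hT
    have h := integral_le_of_ae_tendsto (μ := (volume : Measure 𝔼))
      (f := fun k x => (T ^ (p - q) * |f k x| ^ (q + 1) + T ^ (p - 1) * f k x ^ 2) -
        |f k x| ^ (p + 1))
      (g := fun x => (T ^ (p - q) * |v x| ^ (q + 1) + T ^ (p - 1) * v x ^ 2) - |v x| ^ (p + 1))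
      (A := (T ^ (p - q) * B + T ^ (p - 1) * ∫ x, v x ^ 2) - 1)
      (fun k => (((hfq k).const_mul _).add ((hf k).integrable_sq.const_mul _)).sub (hfpi k))
      (fun k => Eventually.of_forall fun x => by
        have := rpow_le_mul_rpow_add_mul_sq hp hq hT (abs_nonneg (f k x))
        rw [sq_abs] at this
        linarith) ?_ ?_
    · have h' := h.2
      rw [integral_mul_add_mul_sub hvq.1 hv.integrable_sq hvp.1] at h'
      have h0 : 0 ≤ T ^ (p - q) * ∫ x, |v x| ^ (q + 1) := by positivity
      linarith
    · filter_upwards [hae, habs (q + 1) (by linarith), habs (p + 1) (by linarith)] with x h1 h2 h3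
      exact ((h2.const_mul _).add ((h1.pow 2).const_mul _)).sub h3
    · refine (((hB.const_mul _).add (hsq.const_mul _)).sub_const 1).congr fun k => ?_
      rw [integral_mul_add_mul_sub (hfq k) (hf k).integrable_sq (hfpi k), hfp k]
  have hlim : Tendsto (fun T : ℝ => 1 - T ^ (p - q) * B) atTop (𝓝 1) := by
    have h := tendsto_rpow_neg_atTop (y := q - p) (by linarith)
    simp only [neg_sub] at h
    simpa using (h.mul_const B).const_sub 1
  exact le_of_tendsto hlim ((eventually_gt_atTop 0).mono hT)

theorem integral_sq_le_of_bounded_support {Ω : Set 𝔼} (hΩm : MeasurableSet Ω)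
    (hΩb : Bornology.IsBounded Ω) {q : ℝ} (hq : 1 ≤ q) {w : 𝔼 → ℝ}
    (hwq : Integrable fun x => |w x| ^ (q + 1)) (h0 : ∀ x, x ∉ Ω → w x = 0) :
    ∫ x, w x ^ 2 ≤ volume.real Ω + ∫ x, |w x| ^ (q + 1) := by
  have hχ : Integrable (Ω.indicator fun _ => (1 : ℝ)) := by
    rw [integrable_indicator_iff hΩm]
    exact integrableOn_const hΩb.measure_lt_top.ne
  have h1 : ∫ x, Ω.indicator (fun _ => (1 : ℝ)) x = volume.real Ω := by
    rw [integral_indicator hΩm, setIntegral_const, smul_eq_mul, mul_one]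
  rw [← h1, ← integral_add hχ hwq]
  refine integral_mono_of_nonneg (Eventually.of_forall fun x => sq_nonneg _) (hχ.add hwq)
    (Eventually.of_forall fun x => ?_)
  dsimp only
  by_cases hx : x ∈ Ω
  · rw [Set.indicator_of_mem hx, ← sq_abs]
    rcases le_total |w x| 1 with h | h
    · have : 0 ≤ |w x| ^ (q + 1) := by positivity
      nlinarith [abs_nonneg (w x)]
    · have : |w x| ^ (2 : ℝ) ≤ |w x| ^ (q + 1) :=
        Real.rpow_le_rpow_of_exponent_le h (by linarith)
      rw [Real.rpow_two] at this
      linarith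
  · rw [h0 x hx, Set.indicator_of_notMem hx]
    simp only [ne_eq, OfNat.ofNat_ne_zero, not_false_eq_true, zero_pow, abs_zero, zero_add]
    positivity

theorem exists_minimizer (hN : 0 < N) {s : ℝ} (hs0 : 0 < s) {p q δ : ℝ} (hp : 1 < p) (hq : p < q)
    (hδ : 0 < δ) {Ω : Set 𝔼} (hΩm : MeasurableSet Ω) (hΩb : Bornology.IsBounded Ω)
    (hne : ∃ w, Admissible Ω s p q w) :
    ∃ w, Admissible Ω s p q w ∧ ∀ v, Admissible Ω s p q v → energyJ s q δ w ≤ energyJ s q δ v := by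
  have hq0 : 0 ≤ q := by linarith
  set S : Set ℝ := energyJ s q δ '' {w | Admissible Ω s p q w} with hS
  have hSne : S.Nonempty := by
    obtain ⟨w, hw⟩ := hne
    exact ⟨_, w, hw, rfl⟩
  have hSb : BddBelow S := ⟨0, by
    rintro _ ⟨w, -, rfl⟩
    exact energyJ_nonneg hq0 hδ.le w⟩
  set m := sInf S with hm
  obtain ⟨c, -, hc, hcS⟩ := exists_seq_tendsto_sInf hSne hSb
  choose v0 hv0 hv0c using hcS
  choose v hvm hve hvz using fun k => exists_measurable_rep hΩm (hv0 k).1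
  have hv : ∀ k, Admissible Ω s p q (v k) := fun k => admissible_congr_ae (hve k) (hv0 k)
  have hvc : ∀ k, energyJ s q δ (v k) = c k := fun k => by
    rw [← hv0c k, energyJ_congr_ae (hve k)]
  have hvX := fun k => memX0_iff.1 (hv k).1
  have hvq : ∀ k, Integrable fun x => |v k x| ^ (q + 1) := fun k =>
    integrable_rpow_abs_of_memLp (by linarith) (hv k).2.1
  obtain ⟨K, hK⟩ := hc.bddAbove_range
  have hcK : ∀ k, c k ≤ K := fun k => hK ⟨k, rfl⟩
  set A : ℕ → ℝ := fun k => gagliardoForm s (v k) (v k) with hA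
  set B : ℕ → ℝ := fun k => ∫ x, |v k x| ^ (q + 1) with hB
  have hA0 : ∀ k, 0 ≤ A k := fun k => gagliardoForm_self_nonneg s _
  have hB0 : ∀ k, 0 ≤ B k := fun k => by simp only [hB]; positivity
  have hJ : ∀ k, 1 / 2 * A k + δ / (q + 1) * B k = c k := hvc
  have hd : 0 < δ / (q + 1) := by positivity
  have hAK : ∀ k, A k ≤ 2 * K := fun k => by
    nlinarith [hJ k, hcK k, mul_nonneg hd.le (hB0 k)]
  have hBK : ∀ k, B k ≤ K / (δ / (q + 1)) := fun k => by
    rw [le_div_iff₀ hd]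
    nlinarith [hJ k, hcK k, hA0 k]
  obtain ⟨⟨A', B'⟩, -, φ, hφ, hAB⟩ :=
    (isCompact_Icc (a := ((0 : ℝ), (0 : ℝ))) (b := (2 * K, K / (δ / (q + 1))))).tendsto_subseq
      (x := fun k => (A k, B k)) (fun k => ⟨⟨hA0 k, hB0 k⟩, ⟨hAK k, hBK k⟩⟩)
  have hA' : Tendsto (fun k => A (φ k)) atTop (𝓝 A') := (continuous_fst.tendsto _).comp hAB
  have hB' : Tendsto (fun k => B (φ k)) atTop (𝓝 B') := (continuous_snd.tendsto _).comp hAB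
  obtain ⟨R, hR⟩ := hΩb.subset_closedBall (0 : 𝔼)
  obtain ⟨ψ, w, hψ, hw2, hlim⟩ := exists_subseq_tendsto_eLpNorm (w := fun k => v (φ k)) hN hs0
    (M := max (2 * K) (volume.real Ω + K / (δ / (q + 1)))) (R := R)
    (fun k => hvm _) (fun k => (hvX _).1) (fun k => (hvX _).2.1)
    (fun k => (integral_sq_le_of_bounded_support hΩm hΩb (by linarith) (hvq _) (hvz _)).trans
      (le_max_of_le_right (by have := hBK (φ k); simp only [hB] at this; linarith)))
    (fun k => (hAK _).trans (le_max_left _ _))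
    (fun k x hx => hvz _ x fun h => by
      have := hR h
      rw [mem_closedBall_zero_iff] at this
      linarith)
  obtain ⟨χ, hχ, hae⟩ := (tendstoInMeasure_of_tendsto_eLpNorm (by norm_num)
    (fun k => (hvX _).1.1) hw2.1 hlim).exists_seq_tendsto_ae
  set f : ℕ → 𝔼 → ℝ := fun k => v (φ (ψ (χ k))) with hf
  have hA'' : Tendsto (fun k => gagliardoForm s (f k) (f k)) atTop (𝓝 A') :=
    hA'.comp (hψ.tendsto_atTop.comp hχ.tendsto_atTop)
  have hB'' : Tendsto (fun k => ∫ x, |f k x| ^ (q + 1)) atTop (𝓝 B') :=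
    hB'.comp (hψ.tendsto_atTop.comp hχ.tendsto_atTop)
  have hwp : ∫ x, |w x| ^ (p + 1) = 1 := integral_rpow_eq_of_tendsto hp hq (f := f)
    (fun k => (hvX _).1) hw2 (hlim.comp hχ.tendsto_atTop) hae (fun k => hvq _) hB''
    (fun k => (hv _).2.2)
  have hwq := integral_le_of_ae_tendsto (f := fun k x => |f k x| ^ (q + 1)) (fun k => hvq _)
    (fun k => Eventually.of_forall fun x => by positivity)
    (hae.mono fun x hx => (hx.abs).rpow_const (Or.inr (by linarith : 0 ≤ q + 1))) hB''
  have hwg := integral_le_of_ae_tendsto (f := fun k z => gagliardoQuotient s (f k) z ^ 2)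
    (g := fun z => gagliardoQuotient s w z ^ 2) (A := A')
    (fun k => (hvX _).2.1.integrable_sq) (fun k => Eventually.of_forall fun z => sq_nonneg _)
    ((ae_prod_of_ae hae).mono fun z hz => ((hz.1.sub hz.2).div_const _).pow 2)
    (by simpa only [gagliardoForm_self] using hA'')
  refine ⟨w, ⟨memX0_iff.2 ⟨hw2, ?_, ?_⟩, ?_, hwp⟩, fun u hu => ?_⟩
  · exact (memLp_two_iff_integrable_sq (aestronglyMeasurable_gagliardoQuotient s hw2.1)).2 hwg.1
  · filter_upwards [hae] with x hx hxΩ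
    exact tendsto_nhds_unique hx (tendsto_const_nhds.congr fun k => (hvz _ x hxΩ).symm)
  · exact memLp_of_integrable_rpow_abs (by linarith) hw2.1 hwq.1
  · have h1 : m ≤ energyJ s q δ u := csInf_le hSb ⟨u, hu, rfl⟩
    refine le_trans ?_ h1
    have h2 : 1 / 2 * A' + δ / (q + 1) * B' = m := by
      refine tendsto_nhds_unique ((hA'.const_mul _).add (hB'.const_mul _)) ?_
      exact (hc.comp hφ.tendsto_atTop).congr fun k => (hJ (φ k)).symm
    rw [← h2, energyJ, gagliardoForm_self]
    have := hwg.2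
    have := hwq.2
    gcongr

/-- Taking absolute values does not increase the energy, so there is a nonnegative minimizer,
which may also be taken measurable and zero outside `Ω`. -/
theorem exists_nonneg_minimizer (hN : 0 < N) {s : ℝ} (hs0 : 0 < s) {p q δ : ℝ} (hp : 1 < p)
    (hq : p < q) (hδ : 0 < δ) {Ω : Set 𝔼} (hΩm : MeasurableSet Ω) (hΩb : Bornology.IsBounded Ω)
    (hne : ∃ w, Admissible Ω s p q w) :
    ∃ w, Measurable w ∧ (∀ x, 0 ≤ w x) ∧ (∀ x, x ∉ Ω → w x = 0) ∧ Admissible Ω s p q w ∧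
      ∀ v, Admissible Ω s p q v → energyJ s q δ w ≤ energyJ s q δ v := by
  obtain ⟨w0, hw0, hmin⟩ := exists_minimizer hN hs0 hp hq hδ hΩm hΩb hne
  obtain ⟨w, hwm, hwe, hwz⟩ := exists_measurable_rep hΩm hw0.1
  have hw := admissible_congr_ae hwe hw0
  have hX := memX0_iff.1 hw.1
  have hcontr : ∀ x y, |(|w x| - |w y|)| ≤ |w x - w y| := fun x y => abs_abs_sub_abs_le _ _
  refine ⟨fun x => |w x|, hwm.abs, fun x => abs_nonneg _, fun x hx => by simp [hwz x hx],
    ⟨memX0_iff.2 ⟨hX.1.abs, ?_, ?_⟩, hw.2.1.abs, ?_⟩, fun v hv => ?_⟩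
  · exact memLp_gagliardoQuotient_of_le hwm.abs.aestronglyMeasurable hX.2.1 hcontr
  · exact Eventually.of_forall fun x hx => by simp [hwz x hx]
  · simpa only [abs_abs] using hw.2.2
  · refine le_trans ?_ ((energyJ_congr_ae hwe).symm.le.trans (hmin v hv))
    rw [energyJ, energyJ]
    simp only [abs_abs]
    gcongr
    exact gagliardoForm_self_le_of_le hX.2.1 hcontr

end Minimizer

/-! ### The Euler–Lagrange equation -/

section EulerLagrange

variable {N : ℕ}

local notation "𝔼" => EuclideanSpace ℝ (Fin N)

theorem abs_rpow_sub_two_mul_self {r x : ℝ} (hr : 1 < r) :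
    |(|x| ^ (r - 2) * x)| = |x| ^ (r - 1) := by
  rcases eq_or_ne x 0 with rfl | hx
  · rw [mul_zero, abs_zero, Real.zero_rpow (by linarith)]
  · rw [abs_mul, abs_of_nonneg (Real.rpow_nonneg (abs_nonneg x) _), ← Real.rpow_add_one
      (abs_pos.2 hx).ne']
    congr 1
    ring

theorem rpow_sub_two_mul_self {r x : ℝ} (hr : 1 < r) (hx : 0 ≤ x) :
    |x| ^ (r - 2) * x = x ^ (r - 1) := by
  have h0 : 0 ≤ |x| ^ (r - 2) * x := by positivity
  rw [← abs_of_nonneg h0, abs_rpow_sub_two_mul_self hr, abs_of_nonneg hx]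

theorem integrableOn_rpow_add_const {r : ℝ} (hr : 0 < r) {w : 𝔼 → ℝ} {Ω : Set 𝔼}
    (hΩ : volume Ω ≠ ⊤) (hw : MemLp w (ENNReal.ofReal (r + 1))) (hw0 : ∀ x, 0 ≤ w x) {C : ℝ}
    (hC : 0 ≤ C) : IntegrableOn (fun x => (w x + C) ^ r) Ω := by
  have : IsFiniteMeasure ((volume : Measure 𝔼).restrict Ω) := ⟨by simpa using hΩ.lt_top⟩
  have h1 : MemLp (fun x => w x + C) (ENNReal.ofReal (r + 1)) (volume.restrict Ω) :=
    (hw.restrict Ω).add (memLp_const C)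
  have h2 : MemLp (fun x => w x + C) (ENNReal.ofReal r) (volume.restrict Ω) :=
    h1.mono_exponent (ENNReal.ofReal_le_ofReal (by linarith))
  refine (integrable_rpow_abs_of_memLp hr h2).congr (Eventually.of_forall fun x => ?_)
  dsimp only
  rw [abs_of_nonneg (add_nonneg (hw0 x) hC)]

/-- Differentiation of `∫ |w + tφ|^{r+1}` in a bounded direction `φ` supported in `Ω`. -/
theorem hasDerivAt_integral_rpow_add_mul {r : ℝ} (hr : 0 < r) {w φ : 𝔼 → ℝ} {Ω : Set 𝔼}
    (hΩm : MeasurableSet Ω) (hΩ : volume Ω ≠ ⊤) (hw : MemLp w (ENNReal.ofReal (r + 1)))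
    (hw0 : ∀ x, 0 ≤ w x) {C : ℝ} (hφm : AEStronglyMeasurable φ volume) (hφ : ∀ x, |φ x| ≤ C)
    (hφ0 : ∀ x, x ∉ Ω → φ x = 0) :
    HasDerivAt (fun t : ℝ => ∫ x, |w x + t * φ x| ^ (r + 1)) ((r + 1) * ∫ x, w x ^ r * φ x) 0 := by
  have hC : 0 ≤ C := (abs_nonneg _).trans (hφ 0)
  have hbint := integrableOn_rpow_add_const hr hΩ hw hw0 hC
  set bound : 𝔼 → ℝ := Ω.indicator fun x => (r + 1) * C * (w x + C) ^ r with hbound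
  have hbi : Integrable bound := by
    rw [hbound, integrable_indicator_iff hΩm]
    exact hbint.const_mul _
  have hmeas : ∀ t : ℝ, AEStronglyMeasurable (fun x => |w x + t * φ x| ^ (r + 1)) volume := fun t =>
    ((hw.1.aemeasurable.add (hφm.aemeasurable.const_mul t)).abs.pow_const _).aestronglyMeasurable
  have key := hasDerivAt_integral_of_dominated_loc_of_deriv_le (μ := (volume : Measure 𝔼))
    (F := fun (t : ℝ) x => |w x + t * φ x| ^ (r + 1))
    (F' := fun (t : ℝ) x => (r + 1) * (|w x + t * φ x| ^ (r + 1 - 2) * (w x + t * φ x)) * φ x)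
    (x₀ := 0) (s := Metric.ball 0 1) (bound := bound) (Metric.ball_mem_nhds _ one_pos)
    (Eventually.of_forall hmeas) (by simpa using integrable_rpow_abs_of_memLp (by linarith) hw)
    ?_ (Eventually.of_forall fun x t ht => ?_) hbi (Eventually.of_forall fun x t _ => ?_)
  · refine key.2.congr_deriv ?_
    rw [← integral_const_mul]
    congr 1
    funext x
    rw [zero_mul, add_zero, rpow_sub_two_mul_self (by linarith) (hw0 x), add_sub_cancel_right]
    ring
  · have hm : AEMeasurable (fun x => w x + 0 * φ x) volume :=
      hw.1.aemeasurable.add (hφm.aemeasurable.const_mul 0)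
    exact ((((hm.abs.pow_const _).mul hm).const_mul _).mul hφm.aemeasurable).aestronglyMeasurable
  · have ht1 : |t| ≤ 1 := by
      have := mem_ball_zero_iff.1 ht
      rw [Real.norm_eq_abs] at this
      exact this.le
    by_cases hx : x ∈ Ω
    · rw [hbound, Set.indicator_of_mem hx, Real.norm_eq_abs, abs_mul, abs_mul,
        abs_rpow_sub_two_mul_self (by linarith), abs_of_nonneg (by linarith : 0 ≤ r + 1),
        add_sub_cancel_right]
      have h1 : |w x + t * φ x| ≤ w x + C := by
        refine (abs_add_le _ _).trans ?_
        rw [abs_of_nonneg (hw0 x), abs_mul]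
        have := hφ x
        nlinarith [abs_nonneg t, abs_nonneg (φ x)]
      calc (r + 1) * |w x + t * φ x| ^ r * |φ x| ≤ (r + 1) * (w x + C) ^ r * C := by
            have := hφ x
            have := hw0 x
            gcongr
        _ = _ := by ring
    · rw [hφ0 x hx, hbound, Set.indicator_of_notMem hx]
      simp
  · have h1 : HasDerivAt (fun t : ℝ => w x + t * φ x) (φ x) t := by
      simpa using ((hasDerivAt_id t).mul_const (φ x)).const_add (w x)
    have h2 := (hasDerivAt_abs_rpow (w x + t * φ x) (p := r + 1) (by linarith)).comp t h1
    refine h2.congr_deriv ?_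
    ring

theorem gagliardoForm_add_smul {s : ℝ} {w φ : 𝔼 → ℝ}
    (hw : MemLp (gagliardoQuotient s w) 2 volume) (hφ : MemLp (gagliardoQuotient s φ) 2 volume)
    (t : ℝ) : gagliardoForm s (w + t • φ) (w + t • φ) =
      gagliardoForm s w w + 2 * gagliardoForm s w φ * t + gagliardoForm s φ φ * t ^ 2 := by
  have h1 : Integrable fun z => gagliardoQuotient s w z * gagliardoQuotient s φ z :=
    hw.integrable_mul hφ
  have h2 : ∀ z, gagliardoQuotient s (w + t • φ) z ^ 2 = gagliardoQuotient s w z ^ 2 +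
      (2 * t * (gagliardoQuotient s w z * gagliardoQuotient s φ z) +
        t ^ 2 * gagliardoQuotient s φ z ^ 2) := fun z => by
    rw [gagliardoQuotient_add, gagliardoQuotient_smul]
    simp only [Pi.add_apply, Pi.smul_apply, smul_eq_mul]
    ring
  have h3 : Integrable fun z => 2 * t * (gagliardoQuotient s w z * gagliardoQuotient s φ z) +
        t ^ 2 * gagliardoQuotient s φ z ^ 2 :=
    (h1.const_mul _).add (hφ.integrable_sq.const_mul _)
  rw [gagliardoForm_self]
  simp only [h2]
  rw [integral_add hw.integrable_sq h3, integral_add (h1.const_mul _)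
    (hφ.integrable_sq.const_mul _), integral_const_mul, integral_const_mul, gagliardoForm_self,
    gagliardoForm_self, gagliardoForm_eq_integral_mul]
  ring

theorem memX0_add {Ω : Set 𝔼} {s : ℝ} {v w : 𝔼 → ℝ} (hv : MemX0 Ω s v) (hw : MemX0 Ω s w) :
    MemX0 Ω s (v + w) := by
  rw [memX0_iff] at *
  refine ⟨hv.1.add hw.1, by rw [gagliardoQuotient_add]; exact hv.2.1.add hw.2.1, ?_⟩
  filter_upwards [hv.2.2, hw.2.2] with x h1 h2 hx
  rw [Pi.add_apply, h1 hx, h2 hx, add_zero]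

theorem memX0_smul {Ω : Set 𝔼} {s : ℝ} {v : 𝔼 → ℝ} (c : ℝ) (hv : MemX0 Ω s v) :
    MemX0 Ω s (c • v) := by
  rw [memX0_iff] at *
  refine ⟨hv.1.const_smul c, by rw [gagliardoQuotient_smul]; exact hv.2.1.const_smul c, ?_⟩
  filter_upwards [hv.2.2] with x h1 hx
  rw [Pi.smul_apply, h1 hx, smul_zero]

theorem integral_abs_smul_rpow (c : ℝ) (v : 𝔼 → ℝ) (r : ℝ) :
    ∫ x, |(c • v) x| ^ r = |c| ^ r * ∫ x, |v x| ^ r := by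
  rw [← integral_const_mul]
  congr 1
  funext x
  rw [Pi.smul_apply, smul_eq_mul, abs_mul, Real.mul_rpow (abs_nonneg _) (abs_nonneg _)]

theorem memLp_ofReal_of_bounded {Ω : Set 𝔼} (hΩm : MeasurableSet Ω) (hΩ : volume Ω ≠ ⊤)
    {φ : 𝔼 → ℝ} (hφm : AEStronglyMeasurable φ volume) {C : ℝ} (hφ : ∀ x, |φ x| ≤ C)
    (hφ0 : ∀ x, x ∉ Ω → φ x = 0) (r : ENNReal) : MemLp φ r := by
  have : IsFiniteMeasure ((volume : Measure 𝔼).restrict Ω) := ⟨by simpa using hΩ.lt_top⟩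
  have h1 : MemLp φ r (volume.restrict Ω) :=
    MemLp.of_bound hφm.restrict C (Eventually.of_forall hφ)
  have h2 := (memLp_indicator_iff_restrict hΩm).2 h1
  have h3 : Ω.indicator φ = φ := Set.indicator_eq_self.2 fun x hx => by
    by_contra h
    exact hx (hφ0 x h)
  rwa [h3] at h2

/-- The first variation of `energyJ` under the constraint, in bounded directions, as the derivative
of the energy along the curve `w + t φ` normalized to the constraint set. -/
theorem eulerLagrange_of_bounded {s p q δ : ℝ} (hp : 1 < p) (hq : p < q)
    {Ω : Set 𝔼} (hΩm : MeasurableSet Ω) (hΩ : volume Ω ≠ ⊤) {w φ : 𝔼 → ℝ}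
    (hw0 : ∀ x, 0 ≤ w x) (hw : Admissible Ω s p q w)
    (hmin : ∀ v, Admissible Ω s p q v → energyJ s q δ w ≤ energyJ s q δ v)
    (hφX : MemX0 Ω s φ) {C : ℝ} (hφ : ∀ x, |φ x| ≤ C) (hφ0 : ∀ x, x ∉ Ω → φ x = 0) :
    gagliardoForm s w φ + δ * ∫ x, w x ^ q * φ x =
      (gagliardoForm s w w + δ * ∫ x, |w x| ^ (q + 1)) * ∫ x, w x ^ p * φ x := by
  have hwX := memX0_iff.1 hw.1
  have hφX' := memX0_iff.1 hφX
  have hwp : MemLp w (ENNReal.ofReal (p + 1)) := by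
    refine memLp_of_integrable_rpow_abs (by linarith) hwX.1.1 ?_
    by_contra h
    have := hw.2.2
    rw [integral_undef h] at this
    norm_num at this
  set G : ℝ → ℝ := fun t => ∫ x, |w x + t * φ x| ^ (p + 1) with hG
  set H : ℝ → ℝ := fun t => ∫ x, |w x + t * φ x| ^ (q + 1) with hH
  have hGd : HasDerivAt G ((p + 1) * ∫ x, w x ^ p * φ x) 0 :=
    hasDerivAt_integral_rpow_add_mul (by linarith) hΩm hΩ hwp hw0 hφX'.1.1 hφ hφ0
  have hHd : HasDerivAt H ((q + 1) * ∫ x, w x ^ q * φ x) 0 :=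
    hasDerivAt_integral_rpow_add_mul (by linarith) hΩm hΩ hw.2.1 hw0 hφX'.1.1 hφ hφ0
  have hG0 : G 0 = 1 := by simpa [hG] using hw.2.2
  have hH0 : H 0 = ∫ x, |w x| ^ (q + 1) := by simp [hH]
  set a := gagliardoForm s w w with ha
  set b := gagliardoForm s w φ with hb
  set c := gagliardoForm s φ φ with hc
  have hQd : HasDerivAt (fun t : ℝ => a + 2 * b * t + c * t ^ 2) (2 * b) 0 := by
    have h1 := ((hasDerivAt_id (0 : ℝ)).const_mul (2 * b)).const_add a
    have h2 := ((hasDerivAt_id (0 : ℝ)).pow 2).const_mul c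
    exact (h1.add h2).congr_deriv (by simp)
  -- the energy of `w + t φ` after normalization to the constraint set
  set h : ℝ → ℝ := fun t => 1 / 2 * ((a + 2 * b * t + c * t ^ 2) * G t ^ (-(2 / (p + 1)))) +
    δ / (q + 1) * (H t * G t ^ (-((q + 1) / (p + 1)))) with hh
  have hGr : ∀ e : ℝ, HasDerivAt (fun t => G t ^ e) (((p + 1) * ∫ x, w x ^ p * φ x) * e) 0 := by
    intro e
    have := hGd.rpow_const (p := e) (Or.inl (by rw [hG0]; exact one_ne_zero))
    rwa [hG0, Real.one_rpow, mul_one] at this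
  have hhd := ((hQd.mul (hGr (-(2 / (p + 1))))).const_mul (1 / 2)).add
    ((hHd.mul (hGr (-((q + 1) / (p + 1))))).const_mul (δ / (q + 1)))
  have hloc : IsLocalMin h 0 := by
    have hpos : ∀ᶠ t in 𝓝 (0 : ℝ), 0 < G t :=
      hGd.continuousAt.eventually (lt_mem_nhds (by rw [hG0]; exact one_pos))
    filter_upwards [hpos] with t ht
    set k : ℝ := G t ^ (-(1 / (p + 1))) with hk
    have hk0 : 0 < k := by positivity
    have hkr : ∀ r : ℝ, |k| ^ r = G t ^ (-(r / (p + 1))) := fun r => by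
      rw [abs_of_pos hk0, hk, ← Real.rpow_mul ht.le]
      congr 1
      ring
    have hadm : Admissible Ω s p q (k • (w + t • φ)) := by
      refine ⟨memX0_smul _ (memX0_add hw.1 (memX0_smul _ hφX)), ?_, ?_⟩
      · exact (hw.2.1.add
          ((memLp_ofReal_of_bounded hΩm hΩ hφX'.1.1 hφ hφ0 _).const_smul t)).const_smul k
      · rw [integral_abs_smul_rpow, hkr, div_self (by linarith), Real.rpow_neg_one]
        exact inv_mul_cancel₀ ht.ne'
    have hval : energyJ s q δ (k • (w + t • φ)) = h t := by
      rw [energyJ, gagliardoForm_smul_smul, gagliardoForm_add_smul hwX.2.1 hφX'.2.1,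
        integral_abs_smul_rpow, hkr, hh]
      have : k * k = G t ^ (-(2 / (p + 1))) := by
        rw [← hkr 2, abs_of_pos hk0, Real.rpow_two, sq]
      rw [this]
      simp only [Pi.add_apply, Pi.smul_apply, smul_eq_mul, hH]
      ring
    have hval0 : h 0 = energyJ s q δ w := by
      simp only [hh, hG0, hH0, energyJ, Real.one_rpow]
      ring
    rw [hval0, ← hval]
    exact hmin _ hadm
  have hzero := hloc.hasDerivAt_eq_zero hhd
  simp only [hG0, hH0, Real.one_rpow] at hzero
  have hp1 : p + 1 ≠ 0 := by linarith
  have hq1 : q + 1 ≠ 0 := by linarith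
  field_simp at hzero
  linarith

end EulerLagrange

/-! ### Boundedness of minimizers and the equation tested against all of `X_0(Ω)` -/

section Bounded

variable {N : ℕ}

local notation "𝔼" => EuclideanSpace ℝ (Fin N)

theorem integrable_rpow_mul_of_bounded {r : ℝ} (hr : 0 < r) {w φ : 𝔼 → ℝ} {Ω : Set 𝔼}
    (hΩ : volume Ω ≠ ⊤) (hw : MemLp w (ENNReal.ofReal (r + 1)))
    (hw0 : ∀ x, 0 ≤ w x) {C : ℝ} (hφm : AEStronglyMeasurable φ volume) (hφ : ∀ x, |φ x| ≤ C)
    (hφ0 : ∀ x, x ∉ Ω → φ x = 0) : Integrable fun x => w x ^ r * φ x := by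
  have h1 : IntegrableOn (fun x => w x ^ r) Ω := by
    simpa using integrableOn_rpow_add_const hr hΩ hw hw0 le_rfl
  have h2 : IntegrableOn (fun x => w x ^ r * φ x) Ω :=
    Integrable.mul_bdd (c := C) h1 hφm.restrict (Eventually.of_forall hφ)
  refine (integrableOn_iff_integrable_of_support_subset fun x hx => ?_).1 h2
  by_contra h
  exact hx (by simp [hφ0 x h])

/-- The Sobolev inequality excludes nonzero functions of zero energy. -/
theorem eq_zero_of_gagliardoForm_nonpos {s : ℝ} (hs0 : 0 < s) (hN : 2 * s < (N : ℝ)) {v : 𝔼 → ℝ}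
    (hv : MemLp v (ENNReal.ofReal (critExp N s))) (hg : MemLp (gagliardoQuotient s v) 2 volume)
    (h : gagliardoForm s v v ≤ 0) : v =ᵐ[volume] 0 := by
  have hm : 0 < critExp N s := by linarith [two_lt_critExp hs0 hN]
  obtain ⟨c, hc, hS⟩ := sobolev_inequality (N := N) hs0 hN
  have hi := integrable_rpow_abs_of_memLp hm hv
  have h0 : 0 ≤ ∫ x, |v x| ^ critExp N s := by positivity
  have h1 : ∫ x, |v x| ^ critExp N s = 0 := by
    by_contra hne
    have hpos : 0 < ∫ x, |v x| ^ critExp N s := lt_of_le_of_ne h0 (Ne.symm hne)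
    have := hS v hv hg
    have : 0 < c * (∫ x, |v x| ^ critExp N s) ^ (2 / critExp N s) := by positivity
    linarith
  have h2 := (integral_eq_zero_iff_of_nonneg (fun x => by positivity) hi).1 h1
  filter_upwards [h2] with x hx
  have h3 : |v x| ^ critExp N s = 0 := hx
  rw [Real.rpow_eq_zero (abs_nonneg _) hm.ne'] at h3
  exact abs_eq_zero.1 h3

/-- The right-hand side `μ w^p - δ w^q` is nonpositive where `w` exceeds `(μ/δ)^{1/(q-p)}`, so
testing with a truncation of the excess shows that the excess vanishes. -/
theorem ae_le_of_minimizer {s p q δ : ℝ} (hs0 : 0 < s) (hN : 2 * s < (N : ℝ)) (hp : 1 < p)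
    (hq : p < q) (hδ : 0 < δ) {Ω : Set 𝔼} (hΩm : MeasurableSet Ω) (hΩ : volume Ω ≠ ⊤) {w : 𝔼 → ℝ}
    (hwm : Measurable w) (hw0 : ∀ x, 0 ≤ w x) (hwΩ : ∀ x, x ∉ Ω → w x = 0)
    (hw : Admissible Ω s p q w)
    (hmin : ∀ v, Admissible Ω s p q v → energyJ s q δ w ≤ energyJ s q δ v) :
    ∃ M : ℝ, 0 ≤ M ∧ ∀ᵐ x, w x ≤ M := by
  have hwX := memX0_iff.1 hw.1
  have hwp : MemLp w (ENNReal.ofReal (p + 1)) := by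
    refine memLp_of_integrable_rpow_abs (by linarith) hwX.1.1 ?_
    by_contra h
    have := hw.2.2
    rw [integral_undef h] at this
    norm_num at this
  set μ := gagliardoForm s w w + δ * ∫ x, |w x| ^ (q + 1) with hμ
  have hμ0 : 0 ≤ μ := by
    have := gagliardoForm_self_nonneg s w
    positivity
  set M := (μ / δ) ^ (1 / (q - p)) with hM
  have hM0 : 0 ≤ M := by positivity
  have hMq : M ^ (q - p) = μ / δ := by
    rw [hM, ← Real.rpow_mul (by positivity), one_div_mul_cancel (by linarith), Real.rpow_one]
  set T : 𝔼 → ℝ := fun x => min (max (w x - M) 0) 1 with hT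
  have hTm : Measurable T := ((hwm.sub_const M).max measurable_const).min measurable_const
  have hT0 : ∀ x, 0 ≤ T x := fun x => le_min (le_max_right _ _) zero_le_one
  have hT1 : ∀ x, |T x| ≤ 1 := fun x => by
    rw [abs_of_nonneg (hT0 x)]
    exact min_le_right _ _
  have hTΩ : ∀ x, x ∉ Ω → T x = 0 := fun x hx => by
    simp only [hT, hwΩ x hx, zero_sub]
    rw [max_eq_right (by linarith), min_eq_left zero_le_one]
  have hTc : ∀ x y, |T x - T y| ≤ |w x - w y| := fun x y => by
    refine (abs_min_sub_min_le_max _ _ _ _).trans ?_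
    rw [sub_self, abs_zero, max_eq_left (abs_nonneg _)]
    refine (abs_max_sub_max_le_max _ _ _ _).trans ?_
    rw [sub_self, abs_zero, max_eq_left (abs_nonneg _), sub_sub_sub_cancel_right]
  have hTmono : ∀ x y, w x ≤ w y → T x ≤ T y := fun x y h =>
    min_le_min_right _ (max_le_max_right _ (by linarith))
  have hTg : MemLp (gagliardoQuotient s T) 2 volume :=
    memLp_gagliardoQuotient_of_le hTm.aestronglyMeasurable hwX.2.1 hTc
  have hTp := memLp_ofReal_of_bounded hΩm hΩ hTm.aestronglyMeasurable hT1 hTΩ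
  have hTX : MemX0 Ω s T := memX0_iff.2 ⟨hTp 2, hTg, Eventually.of_forall hTΩ⟩
  have hEL := eulerLagrange_of_bounded hp hq hΩm hΩ hw0 hw hmin hTX hT1 hTΩ
  have hip := integrable_rpow_mul_of_bounded (by linarith : 0 < p) hΩ hwp hw0
    hTm.aestronglyMeasurable hT1 hTΩ
  have hiq := integrable_rpow_mul_of_bounded (by linarith : 0 < q) hΩ hw.2.1 hw0
    hTm.aestronglyMeasurable hT1 hTΩ
  have hrhs : μ * ∫ x, w x ^ p * T x ≤ δ * ∫ x, w x ^ q * T x := by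
    rw [← integral_const_mul, ← integral_const_mul]
    refine integral_mono (hip.const_mul _) (hiq.const_mul _) fun x => ?_
    dsimp only
    rcases le_or_gt (w x) M with h | h
    · have : T x = 0 := by
        simp only [hT]
        rw [max_eq_right (by linarith), min_eq_left zero_le_one]
      rw [this]
      simp
    · have hwx : 0 < w x := hM0.trans_lt h
      have h1 : μ / δ ≤ w x ^ (q - p) := by
        rw [← hMq]
        exact Real.rpow_le_rpow hM0 h.le (by linarith)
      rw [div_le_iff₀ hδ] at h1
      have h2 : w x ^ q = w x ^ (q - p) * w x ^ p := by
        rw [← Real.rpow_add hwx]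
        congr 1
        ring
      rw [h2]
      have h3 : 0 ≤ w x ^ p * T x := mul_nonneg (by positivity) (hT0 x)
      calc μ * (w x ^ p * T x) ≤ (w x ^ (q - p) * δ) * (w x ^ p * T x) := by gcongr
        _ = _ := by ring
  -- `T` is a nondecreasing contraction of `w`
  have hform : gagliardoForm s T T ≤ gagliardoForm s w T := by
    rw [gagliardoForm_eq_integral_mul, gagliardoForm_eq_integral_mul]
    refine integral_mono (hTg.integrable_mul hTg) (hwX.2.1.integrable_mul hTg) fun z => ?_
    dsimp only
    rw [← gagliardoDensity_eq_mul, ← gagliardoDensity_eq_mul, gagliardoDensity, gagliardoDensity]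
    refine div_le_div_of_nonneg_right ?_ (by positivity)
    have h := hTc z.1 z.2
    rcases le_total (w z.1) (w z.2) with h1 | h1
    · have h2 := hTmono _ _ h1
      rw [abs_of_nonpos (by linarith), abs_of_nonpos (by linarith)] at h
      nlinarith
    · have h2 := hTmono _ _ h1
      rw [abs_of_nonneg (by linarith), abs_of_nonneg (by linarith)] at h
      nlinarith
  have hTz := eq_zero_of_gagliardoForm_nonpos hs0 hN (hTp _) hTg (by linarith)
  refine ⟨M, hM0, ?_⟩
  filter_upwards [hTz] with x hx
  by_contra h
  have h1 : 0 < T x := lt_min (lt_max_of_lt_left (by linarith [not_le.1 h])) one_pos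
  exact h1.ne' hx

/-- For bounded `w`, the equation extends from bounded test functions to all of `X_0(Ω)` by
truncation. -/
theorem weak_equation_of_bounded_tests {s p q δ μ M : ℝ} (hp : 0 < p) (hq : 0 < q) {Ω : Set 𝔼}
    (hΩm : MeasurableSet Ω) (hΩ : volume Ω ≠ ⊤) {w : 𝔼 → ℝ} (hwm : Measurable w)
    (hw0 : ∀ x, 0 ≤ w x) (hwM : ∀ x, w x ≤ M) (hwX : MemX0 Ω s w)
    (hEL : ∀ φ : 𝔼 → ℝ, MemX0 Ω s φ → ∀ C : ℝ, (∀ x, |φ x| ≤ C) → (∀ x, x ∉ Ω → φ x = 0) →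
      gagliardoForm s w φ + δ * ∫ x, w x ^ q * φ x = μ * ∫ x, w x ^ p * φ x)
    {φ : 𝔼 → ℝ} (hφ : MemX0 Ω s φ) :
    (Integrable fun x => w x ^ p * φ x) ∧ (Integrable fun x => w x ^ q * φ x) ∧
      gagliardoForm s w φ + δ * ∫ x, w x ^ q * φ x = μ * ∫ x, w x ^ p * φ x := by
  obtain ⟨v, hvm, hve, hvΩ⟩ := exists_measurable_rep hΩm hφ
  have hvX := memX0_congr_ae hve hφ
  have hvX' := memX0_iff.1 hvX
  have hwX' := memX0_iff.1 hwX
  have hvi : Integrable v := by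
    have : IsFiniteMeasure ((volume : Measure 𝔼).restrict Ω) := ⟨by simpa using hΩ.lt_top⟩
    have h1 : IntegrableOn v Ω := (hvX'.1.restrict Ω).integrable (by norm_num)
    refine (integrableOn_iff_integrable_of_support_subset fun x hx => ?_).1 h1
    by_contra h
    exact hx (hvΩ x h)
  have hmul : ∀ r : ℝ, 0 < r → ∀ f : 𝔼 → ℝ, Integrable f → Integrable fun x => w x ^ r * f x :=
    fun r hr f hf => hf.bdd_mul (c := M ^ r) (hwm.pow_const r).aestronglyMeasurable
      (Eventually.of_forall fun x => by
        rw [Real.norm_of_nonneg (Real.rpow_nonneg (hw0 x) r)]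
        exact Real.rpow_le_rpow (hw0 x) (hwM x) hr.le)
  have hcongr : ∀ r : ℝ, (fun x => w x ^ r * v x) =ᵐ[volume] fun x => w x ^ r * φ x := fun r =>
    hve.mono fun x hx => by dsimp only; rw [hx]
  refine ⟨(hmul p hp v hvi).congr (hcongr p), (hmul q hq v hvi).congr (hcongr q), ?_⟩
  rw [gagliardoForm_congr_ae s (EventuallyEq.refl _ w) hve, ← integral_congr_ae (hcongr p),
    ← integral_congr_ae (hcongr q)]
  set T : ℕ → 𝔼 → ℝ := fun k x => max (-(k : ℝ)) (min (v x) k) with hT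
  have hTm : ∀ k, Measurable (T k) := fun k => measurable_const.max (hvm.min measurable_const)
  have hTb : ∀ k x, |T k x| ≤ k := fun k x => by
    have hk : (0 : ℝ) ≤ k := Nat.cast_nonneg k
    exact abs_le.2 ⟨le_max_left _ _, max_le (by linarith) (min_le_right _ _)⟩
  have hTv : ∀ k x, |T k x| ≤ |v x| := fun k x => by
    have hk : (0 : ℝ) ≤ k := Nat.cast_nonneg k
    refine abs_le.2 ⟨le_max_of_le_right (le_min (neg_abs_le _) ?_), max_le ?_ ?_⟩
    · linarith [abs_nonneg (v x)]
    · linarith [abs_nonneg (v x)]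
    · exact (min_le_left _ _).trans (le_abs_self _)
  have hTΩ : ∀ k x, x ∉ Ω → T k x = 0 := fun k x hx => by
    have := hTv k x
    rw [hvΩ x hx, abs_zero] at this
    exact abs_nonpos_iff.1 this
  have hTc : ∀ k x y, |T k x - T k y| ≤ |v x - v y| := fun k x y => by
    refine (abs_max_sub_max_le_max _ _ _ _).trans ?_
    rw [sub_self, abs_zero, max_eq_right (abs_nonneg _)]
    refine (abs_min_sub_min_le_max _ _ _ _).trans ?_
    rw [sub_self, abs_zero, max_eq_left (abs_nonneg _)]
  have hTlim : ∀ x, Tendsto (fun k => T k x) atTop (𝓝 (v x)) := fun x => by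
    obtain ⟨n, hn⟩ := exists_nat_ge |v x|
    refine tendsto_const_nhds.congr' ?_
    filter_upwards [eventually_ge_atTop n] with k hk
    have hkn : |v x| ≤ k := hn.trans (by exact_mod_cast hk)
    have := abs_le.1 hkn
    simp only [hT]
    rw [min_eq_left this.2, max_eq_right this.1]
  have hTX : ∀ k, MemX0 Ω s (T k) := fun k => memX0_iff.2
    ⟨hvX'.1.mono (hTm k).aestronglyMeasurable (Eventually.of_forall (hTv k)),
      memLp_gagliardoQuotient_of_le (hTm k).aestronglyMeasurable hvX'.2.1 (hTc k),
      Eventually.of_forall (hTΩ k)⟩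
  have hlimI : ∀ r : ℝ, 0 < r →
      Tendsto (fun k => ∫ x, w x ^ r * T k x) atTop (𝓝 (∫ x, w x ^ r * v x)) := fun r hr =>
    tendsto_integral_of_dominated_convergence (fun x => ‖w x ^ r * v x‖)
      (fun k => ((hwm.pow_const r).mul (hTm k)).aestronglyMeasurable) (hmul r hr v hvi).norm
      (fun k => Eventually.of_forall fun x => by
        rw [norm_mul, norm_mul]
        exact mul_le_mul_of_nonneg_left (hTv k x) (norm_nonneg _))
      (Eventually.of_forall fun x => (hTlim x).const_mul _)
  have hlimF : Tendsto (fun k => gagliardoForm s w (T k)) atTop (𝓝 (gagliardoForm s w v)) := by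
    simp only [gagliardoForm_eq_integral_mul]
    refine tendsto_integral_of_dominated_convergence
      (fun z => ‖gagliardoQuotient s w z * gagliardoQuotient s v z‖)
      (fun k => (hwX'.2.1.1.mul (memX0_iff.1 (hTX k)).2.1.1))
      (hwX'.2.1.integrable_mul hvX'.2.1).norm
      (fun k => Eventually.of_forall fun z => ?_) (Eventually.of_forall fun z => ?_)
    · rw [norm_mul, norm_mul]
      exact mul_le_mul_of_nonneg_left (abs_gagliardoQuotient_le s (hTc k _ _)) (norm_nonneg _)
    · exact (((hTlim z.1).sub (hTlim z.2)).div_const _).const_mul _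
  have h1 := hlimF.add ((hlimI q hq).const_mul δ)
  have h2 := (hlimI p hp).const_mul μ
  refine tendsto_nhds_unique h1 (h2.congr fun k => ?_)
  exact (hEL (T k) (hTX k) k (hTb k) (hTΩ k)).symm

end Bounded

/-! ### The strong maximum principle -/

section Positivity

variable {N : ℕ}

local notation "𝔼" => EuclideanSpace ℝ (Fin N)

/-- A Lipschitz function with values in `[0, 1]` that is positive exactly on `Ω`. -/
theorem exists_lipschitz_cutoff (hN0 : 0 < N) {s : ℝ} (hs0 : 0 < s) (hs1 : s < 1)
    {Ω : Set 𝔼} (hΩo : IsOpen Ω) (hΩb : Bornology.IsBounded Ω) :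
    ∃ η : 𝔼 → ℝ, Measurable η ∧ (∀ x, 0 ≤ η x ∧ η x ≤ 1) ∧ (∀ x, x ∉ Ω → η x = 0) ∧
      (∀ x, x ∈ Ω → 0 < η x) ∧ MemLp (gagliardoQuotient s η) 2 volume := by
  have : Nonempty (Fin N) := ⟨⟨0, hN0⟩⟩
  have : Nontrivial 𝔼 := inferInstance
  obtain ⟨R, hR⟩ := hΩb.subset_closedBall (0 : 𝔼)
  have hne : (Ωᶜ).Nonempty := by
    by_contra h
    rw [Set.not_nonempty_iff_eq_empty, Set.compl_empty_iff] at h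
    exact NormedSpace.unbounded_univ ℝ 𝔼 (h ▸ hΩb)
  refine ⟨fun x => min (Metric.infDist x Ωᶜ) 1, ?_, fun x => ⟨le_min Metric.infDist_nonneg
    zero_le_one, min_le_right _ _⟩, fun x hx => ?_, fun x hx => ?_, ?_⟩
  · exact ((Metric.continuous_infDist_pt _).measurable).min measurable_const
  · have hx' : x ∈ Ωᶜ := hx
    dsimp only
    rw [Metric.infDist_zero_of_mem hx', min_eq_left zero_le_one]
  · refine lt_min ?_ one_pos
    exact (hΩo.isClosed_compl.notMem_iff_infDist_pos hne).1 (fun h => h hx)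
  · refine memLp_gagliardoQuotient_of_lipschitz (C := 1) (R := R) hN0 hs0 hs1 (fun x y => ?_)
      (fun x => ?_) (fun x hx => ?_)
    · refine (abs_min_sub_min_le_max _ _ _ _).trans ?_
      rw [sub_self, abs_zero, max_eq_left (abs_nonneg _)]
      have := (Metric.lipschitz_infDist_pt Ωᶜ).dist_le_mul x y
      rwa [Real.dist_eq, dist_eq_norm] at this
    · rw [abs_of_nonneg (le_min Metric.infDist_nonneg zero_le_one)]
      exact min_le_right _ _
    · have hxΩ : x ∈ Ωᶜ := fun h => by
        have := hR h
        rw [mem_closedBall_zero_iff] at this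
        linarith
      rw [Metric.infDist_zero_of_mem hxΩ, min_eq_left zero_le_one]

/-- A bounded nonnegative solution that is not identically zero is positive almost everywhere in
`Ω`. With `Z = {w = 0}`, the test functions `η (1 - k w)₊ → η 1_Z` give
`∬ (w x - w y) (η 1_Z x - η 1_Z y) / |x - y|^{N+2s} ≥ 0`, while the integrand is nonpositive; hence
it vanishes, which forces `Z ∩ Ω` or `{w > 0}` to be null. -/
theorem ae_pos_of_weak_equation (hN0 : 0 < N) {s p q δ μ M : ℝ} (hs0 : 0 < s) (hs1 : s < 1)
    (hp : 0 < p) (hq : 0 < q) {Ω : Set 𝔼} (hΩo : IsOpen Ω) (hΩb : Bornology.IsBounded Ω)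
    {w : 𝔼 → ℝ} (hwm : Measurable w) (hw0 : ∀ x, 0 ≤ w x) (hwM : ∀ x, w x ≤ M)
    (hwX : MemX0 Ω s w) (hne : ¬ w =ᵐ[volume] 0)
    (hEL : ∀ φ : 𝔼 → ℝ, MemX0 Ω s φ → ∀ C : ℝ, (∀ x, |φ x| ≤ C) → (∀ x, x ∉ Ω → φ x = 0) →
      gagliardoForm s w φ + δ * ∫ x, w x ^ q * φ x = μ * ∫ x, w x ^ p * φ x) :
    ∀ᵐ x, x ∈ Ω → 0 < w x := by
  have hΩm := hΩo.measurableSet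
  have hΩ : volume Ω ≠ ⊤ := hΩb.measure_lt_top.ne
  have hwX' := memX0_iff.1 hwX
  obtain ⟨η, hηm, hη01, hη0, hηpos, hηg⟩ := exists_lipschitz_cutoff hN0 hs0 hs1 hΩo hΩb
  have hηi : Integrable η := memLp_one_iff_integrable.1
    (memLp_ofReal_of_bounded hΩm hΩ hηm.aestronglyMeasurable (C := 1)
      (fun x => by rw [abs_of_nonneg (hη01 x).1]; exact (hη01 x).2) hη0 1)
  set g : ℕ → 𝔼 → ℝ := fun n x => max 0 (1 - ((n : ℝ) + 1) * w x) with hg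
  set Z : 𝔼 → ℝ := fun x => if w x = 0 then 1 else 0 with hZ
  have hgm : ∀ n, Measurable (g n) := fun n =>
    measurable_const.max (measurable_const.sub (hwm.const_mul _))
  have hg0 : ∀ n x, 0 ≤ g n x := fun n x => le_max_left _ _
  have hg1 : ∀ n x, g n x ≤ 1 := fun n x => max_le zero_le_one (by
    have := hw0 x
    have : 0 ≤ ((n : ℝ) + 1) * w x := by positivity
    linarith)
  have hglim : ∀ x, Tendsto (fun n => g n x) atTop (𝓝 (Z x)) := fun x => by
    rcases (hw0 x).eq_or_lt with h | h
    · simp [hg, hZ, ← h]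
    · simp only [hZ, if_neg h.ne']
      obtain ⟨n0, hn0⟩ := exists_nat_ge (1 / w x)
      refine tendsto_const_nhds.congr' ?_
      filter_upwards [eventually_ge_atTop n0] with n hn
      have h1 : 1 / w x ≤ (n : ℝ) + 1 := by
        have : (n0 : ℝ) ≤ n := by exact_mod_cast hn
        linarith
      rw [div_le_iff₀ h] at h1
      exact (max_eq_left (by linarith)).symm
  have hganti : ∀ n x y, w x ≤ w y → g n y ≤ g n x := fun n x y h =>
    max_le_max_left _ (by
      have : ((n : ℝ) + 1) * w x ≤ ((n : ℝ) + 1) * w y := by gcongr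
      linarith)
  have hgc : ∀ n x y, |g n x - g n y| ≤ ((n : ℝ) + 1) * |w x - w y| := fun n x y => by
    refine (abs_max_sub_max_le_max _ _ _ _).trans ?_
    rw [sub_self, abs_zero, max_eq_right (abs_nonneg _), sub_sub_sub_cancel_left, ← mul_sub,
      abs_mul, abs_of_nonneg (by positivity : (0 : ℝ) ≤ (n : ℝ) + 1), abs_sub_comm]
  set φ : ℕ → 𝔼 → ℝ := fun n x => η x * g n x with hφ
  have hφm : ∀ n, Measurable (φ n) := fun n => hηm.mul (hgm n)
  have hφ1 : ∀ n x, |φ n x| ≤ 1 := fun n x => by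
    rw [abs_of_nonneg (mul_nonneg (hη01 x).1 (hg0 n x))]
    exact mul_le_one₀ (hη01 x).2 (hg0 n x) (hg1 n x)
  have hφΩ : ∀ n x, x ∉ Ω → φ n x = 0 := fun n x hx => by simp only [hφ, hη0 x hx, zero_mul]
  have hφg : ∀ n, MemLp (gagliardoQuotient s (φ n)) 2 volume := fun n => by
    have hwn : MemLp (gagliardoQuotient s (((n : ℝ) + 1) • w)) 2 volume := by
      rw [gagliardoQuotient_smul]
      exact hwX'.2.1.const_smul _
    refine (sqrt_gagliardoForm_le_add hηg hwn (hφm n).aestronglyMeasurable fun x y => ?_).1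
    have h1 : φ n x - φ n y = (η x - η y) * g n x + η y * (g n x - g n y) := by
      simp only [hφ]; ring
    rw [h1]
    refine (abs_add_le _ _).trans ?_
    rw [abs_mul, abs_mul, abs_of_nonneg (hg0 n x), abs_of_nonneg (hη01 y).1]
    simp only [Pi.smul_apply, smul_eq_mul]
    rw [← mul_sub, abs_mul, abs_of_nonneg (by positivity : (0 : ℝ) ≤ (n : ℝ) + 1)]
    have h2 := hgc n x y
    have h3 := hg1 n x
    have h4 := (hη01 y).2
    have h5 := abs_nonneg (g n x - g n y)
    have h6 := abs_nonneg (η x - η y)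
    nlinarith
  have hφX : ∀ n, MemX0 Ω s (φ n) := fun n => memX0_iff.2
    ⟨memLp_ofReal_of_bounded hΩm hΩ (hφm n).aestronglyMeasurable (hφ1 n) (hφΩ n) 2, hφg n,
      Eventually.of_forall (hφΩ n)⟩
  -- the right-hand side of the tested equation tends to zero
  have hlimI : ∀ r : ℝ, 0 < r → Tendsto (fun n => ∫ x, w x ^ r * φ n x) atTop (𝓝 0) := by
    intro r hr
    have h0 : ∫ x, w x ^ r * (η x * Z x) = 0 := by
      refine integral_eq_zero_of_ae (Eventually.of_forall fun x => ?_)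
      by_cases h : w x = 0
      · simp [h, Real.zero_rpow hr.ne']
      · simp [hZ, h]
    rw [← h0]
    refine tendsto_integral_of_dominated_convergence (fun x => M ^ r * η x)
      (fun n => ((hwm.pow_const r).mul (hφm n)).aestronglyMeasurable) (hηi.const_mul _)
      (fun n => Eventually.of_forall fun x => ?_)
      (Eventually.of_forall fun x => ((hglim x).const_mul _).const_mul _)
    have h1 : w x ^ r ≤ M ^ r := Real.rpow_le_rpow (hw0 x) (hwM x) hr.le
    have h2 : 0 ≤ w x ^ r := Real.rpow_nonneg (hw0 x) r
    have h3 : 0 ≤ φ n x := mul_nonneg (hη01 x).1 (hg0 n x)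
    have h4 : φ n x ≤ η x := mul_le_of_le_one_right (hη01 x).1 (hg1 n x)
    rw [Real.norm_of_nonneg (mul_nonneg h2 h3)]
    exact mul_le_mul h1 h4 h3 (h2.trans h1)
  have hlimF : Tendsto (fun n => gagliardoForm s w (φ n)) atTop (𝓝 0) := by
    have h1 := ((hlimI p hp).const_mul μ).sub ((hlimI q hq).const_mul δ)
    simp only [mul_zero, sub_zero] at h1
    refine h1.congr fun n => ?_
    have := hEL (φ n) (hφX n) 1 (hφ1 n) (hφΩ n)
    linarith
  -- split `(w x - w y) (φ x - φ y)` into `(w x - w y) (η x - η y) g y`, dominated by a fixed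
  -- integrable function, and `(w x - w y) (g x - g y) η x`, of constant sign as `g` decreases in `w`
  set Q := gagliardoQuotient s w with hQ
  set P := gagliardoQuotient s η with hP
  have hQP : Integrable fun z => Q z * P z := hwX'.2.1.integrable_mul hηg
  have hEi : ∀ f : 𝔼 → ℝ, Measurable f → (∀ x, 0 ≤ f x) → (∀ x, f x ≤ 1) →
      Integrable fun z : 𝔼 × 𝔼 => Q z * P z * f z.2 := fun f hf h0 h1 =>
    hQP.mul_bdd (c := 1) (hf.comp measurable_snd).aestronglyMeasurable
      (Eventually.of_forall fun z => by
        rw [Real.norm_of_nonneg (h0 _)]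
        exact h1 _)
  have hZm : Measurable Z := Measurable.ite (measurableSet_eq_fun hwm measurable_const)
    measurable_const measurable_const
  have hZ0 : ∀ x, 0 ≤ Z x := fun x => ge_of_tendsto' (hglim x) fun n => hg0 n x
  have hZ1 : ∀ x, Z x ≤ 1 := fun x => le_of_tendsto' (hglim x) fun n => hg1 n x
  have hlimE : Tendsto (fun n => ∫ z, Q z * P z * g n z.2) atTop
      (𝓝 (∫ z, Q z * P z * Z z.2)) := by
    refine tendsto_integral_of_dominated_convergence (fun z => ‖Q z * P z‖)
      (fun n => (hEi _ (hgm n) (hg0 n) (hg1 n)).1) hQP.norm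
      (fun n => Eventually.of_forall fun z => ?_)
      (Eventually.of_forall fun z => (hglim z.2).const_mul _)
    rw [norm_mul, Real.norm_of_nonneg (hg0 n _)]
    exact mul_le_of_le_one_right (norm_nonneg _) (hg1 n _)
  have hW : ∀ n, Integrable fun z => Q z * gagliardoQuotient s (φ n) z := fun n =>
    hwX'.2.1.integrable_mul (hφg n)
  set D : 𝔼 × 𝔼 → ℝ := fun z => ‖z.1 - z.2‖ ^ ((N : ℝ) + 2 * s) with hD
  have hD0 : ∀ z, 0 ≤ D z := fun z => Real.rpow_nonneg (norm_nonneg _) _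
  have hQPz : ∀ z, Q z * P z = (w z.1 - w z.2) * (η z.1 - η z.2) / D z := fun z => by
    rw [hQ, hP, ← gagliardoDensity_eq_mul]
    rfl
  have hWz : ∀ n z, Q z * gagliardoQuotient s (φ n) z =
      (w z.1 - w z.2) * (φ n z.1 - φ n z.2) / D z := fun n z => by
    rw [hQ, ← gagliardoDensity_eq_mul]
    rfl
  have hMz : ∀ n z, Q z * P z * g n z.2 - Q z * gagliardoQuotient s (φ n) z =
      (w z.1 - w z.2) * (g n z.2 - g n z.1) * η z.1 / D z := fun n z => by
    rw [hQPz, hWz]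
    simp only [hφ]
    ring
  have hFatou := integral_le_of_ae_tendsto
    (f := fun n z => Q z * P z * g n z.2 - Q z * gagliardoQuotient s (φ n) z)
    (g := fun z => (w z.1 - w z.2) * (Z z.2 - Z z.1) * η z.1 / D z)
    (A := ∫ z, Q z * P z * Z z.2) (μ := (volume : Measure (𝔼 × 𝔼)))
    (fun n => (hEi _ (hgm n) (hg0 n) (hg1 n)).sub (hW n))
    (fun n => Eventually.of_forall fun z => ?_) (Eventually.of_forall fun z => ?_) ?_
  rotate_left
  · rw [hMz]
    refine div_nonneg (mul_nonneg ?_ (hη01 _).1) (hD0 z)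
    rcases le_total (w z.1) (w z.2) with h | h
    · exact mul_nonneg_of_nonpos_of_nonpos (by linarith) (by linarith [hganti n _ _ h])
    · exact mul_nonneg (by linarith) (by linarith [hganti n _ _ h])
  · simp only [hMz]
    exact ((((hglim z.2).sub (hglim z.1)).const_mul _).mul_const _).div_const _
  · have h1 := hlimE.sub hlimF
    rw [sub_zero] at h1
    refine h1.congr fun n => ?_
    rw [integral_sub (hEi _ (hgm n) (hg0 n) (hg1 n)) (hW n), gagliardoForm_eq_integral_mul]
  -- the limit integrand is `-(w x - w y) (η 1_Z x - η 1_Z y) / |x - y|^{N+2s} ≥ 0`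
  set L : 𝔼 × 𝔼 → ℝ := fun z => (w z.1 - w z.2) * (Z z.2 - Z z.1) * η z.1 / D z -
    Q z * P z * Z z.2 with hL
  have hLz : ∀ z, L z = (w z.1 - w z.2) * (η z.2 * Z z.2 - η z.1 * Z z.1) / D z := fun z => by
    simp only [hL]
    rw [hQPz]
    ring
  have hwZ : ∀ x, w x * Z x = 0 := fun x => by
    by_cases h : w x = 0
    · rw [h, zero_mul]
    · simp [hZ, h]
  have hLnum : ∀ z : 𝔼 × 𝔼, (w z.1 - w z.2) * (η z.2 * Z z.2 - η z.1 * Z z.1) =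
      w z.1 * (η z.2 * Z z.2) + w z.2 * (η z.1 * Z z.1) := fun z => by
    linear_combination (-(η z.1)) * hwZ z.1 - η z.2 * hwZ z.2
  have hL0 : ∀ z, 0 ≤ L z := fun z => by
    rw [hLz, hLnum]
    refine div_nonneg (add_nonneg ?_ ?_) (hD0 z)
    · exact mul_nonneg (hw0 _) (mul_nonneg (hη01 _).1 (hZ0 _))
    · exact mul_nonneg (hw0 _) (mul_nonneg (hη01 _).1 (hZ0 _))
  have hLi : Integrable L := hFatou.1.sub (hEi Z hZm hZ0 hZ1)
  have hLint : ∫ z, L z = 0 := by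
    refine le_antisymm ?_ (integral_nonneg hL0)
    rw [hL, integral_sub hFatou.1 (hEi Z hZm hZ0 hZ1)]
    linarith [hFatou.2]
  have hLae := (integral_eq_zero_iff_of_nonneg hL0 hLi).1 hLint
  set A : Set 𝔼 := {x | x ∈ Ω ∧ w x = 0} with hA
  set B : Set 𝔼 := {y | w y ≠ 0} with hB
  have hAB : (volume : Measure (𝔼 × 𝔼)) (A ×ˢ B) = 0 := by
    refine measure_mono_null (fun z hz => ?_) (ae_iff.1 hLae)
    obtain ⟨⟨hzΩ, hz1⟩, hz2⟩ := hz
    have hz2' : w z.2 ≠ 0 := hz2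
    have hne' : z.1 ≠ z.2 := fun h => hz2' (by rw [← h, hz1])
    have hDpos : 0 < D z := Real.rpow_pos_of_pos (norm_pos_iff.2 (sub_ne_zero.2 hne')) _
    have hw2 : 0 < w z.2 := lt_of_le_of_ne (hw0 _) (Ne.symm hz2')
    have hpos : 0 < L z := by
      rw [hLz, hLnum, hz1]
      simp only [hZ, hz1, if_true, if_neg hz2', zero_mul, mul_one, zero_add]
      exact div_pos (mul_pos hw2 (hηpos _ hzΩ)) hDpos
    exact hpos.ne'
  rw [Measure.volume_eq_prod, Measure.prod_prod, mul_eq_zero] at hAB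
  rcases hAB with h | h
  · refine measure_mono_null (fun x hx => ?_) h
    simp only [Set.mem_compl_iff, Set.mem_ofPred_eq, not_forall, not_lt] at hx
    obtain ⟨hxΩ, hx⟩ := hx
    exact ⟨hxΩ, le_antisymm hx (hw0 x)⟩
  · exact absurd (ae_iff.2 h) hne

end Positivity

/-! ### Compactly supported trial functions -/

section Trial

variable {N : ℕ}

local notation "𝔼" => EuclideanSpace ℝ (Fin N)

/-- Bounded measurable functions of bounded support and finite energy. -/
def IsTrial (s : ℝ) (ψ : 𝔼 → ℝ) : Prop :=
  Measurable ψ ∧ (∃ C, ∀ x, |ψ x| ≤ C) ∧ (∃ R, ∀ x, R < ‖x‖ → ψ x = 0) ∧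
    MemLp (gagliardoQuotient s ψ) 2 volume

theorem IsTrial.memLp {s : ℝ} {ψ : 𝔼 → ℝ} (h : IsTrial s ψ) (r : ENNReal) : MemLp ψ r := by
  obtain ⟨hm, ⟨C, hC⟩, ⟨R, hR⟩, -⟩ := h
  refine memLp_ofReal_of_bounded (measurableSet_closedBall (x := (0 : 𝔼)) (ε := R))
    measure_closedBall_lt_top.ne hm.aestronglyMeasurable hC (fun x hx => hR x ?_) r
  simpa using hx

theorem IsTrial.memX0 {s : ℝ} {ψ : 𝔼 → ℝ} (h : IsTrial s ψ) {Ω : Set 𝔼}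
    (hΩ : ∀ x, x ∉ Ω → ψ x = 0) : MemX0 Ω s ψ :=
  memX0_iff.2 ⟨h.memLp 2, h.2.2.2, Eventually.of_forall hΩ⟩

theorem IsTrial.memDs2 {s : ℝ} {ψ : 𝔼 → ℝ} (h : IsTrial s ψ) : MemDs2 s ψ := by
  obtain ⟨C, hC⟩ := h.2.1
  obtain ⟨R, hR⟩ := h.2.2.1
  exact memDs2_of_bounded (Metric.isBounded_closedBall (x := (0 : 𝔼)) (r := R))
    (h.memX0 fun x hx => hR x (by simpa using hx)) (Eventually.of_forall hC)

theorem IsTrial.smul {s : ℝ} {ψ : 𝔼 → ℝ} (h : IsTrial s ψ) (k : ℝ) : IsTrial s (k • ψ) := by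
  obtain ⟨hm, ⟨C, hC⟩, ⟨ρ, hρ⟩, hg⟩ := h
  refine ⟨hm.const_smul k, ⟨|k| * C, fun x => ?_⟩, ⟨ρ, fun x hx => ?_⟩, ?_⟩
  · rw [Pi.smul_apply, smul_eq_mul, abs_mul]
    exact mul_le_mul_of_nonneg_left (hC x) (abs_nonneg _)
  · rw [Pi.smul_apply, hρ x hx, smul_zero]
  · rw [gagliardoQuotient_smul]
    exact hg.const_smul k

theorem MemDs2.memLp {s : ℝ} {u : 𝔼 → ℝ} (hu : MemDs2 s u) :
    MemLp u (ENNReal.ofReal (critExp N s)) := by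
  have := hu.1
  rwa [MemLpOn, Measure.restrict_univ] at this

theorem MemDs2.memLp_gagliardoQuotient (hN0 : 0 < N) {s : ℝ} (hs0 : 0 < s) (hs1 : s < 1)
    {u : 𝔼 → ℝ} (hu : MemDs2 s u) : MemLp (gagliardoQuotient s u) 2 volume := by
  obtain ⟨φ, hφ, hfin, -⟩ := hu.2
  have h1 := (hasFiniteGagliardo_iff
    (hu.memLp.1.sub (hφ 0).1.continuous.aestronglyMeasurable)).1 (hfin 0)
  have h2 := memLp_gagliardoQuotient_of_contDiff hN0 hs0 hs1 (hφ 0).1 (hφ 0).2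
  have h3 := h1.add h2
  rwa [← gagliardoQuotient_add, sub_add_cancel] at h3

/-- The median of `0`, `u` and `φ`: the point of the segment between `0` and `u` closest to `φ`. -/
theorem abs_median_le (u φ : ℝ) : |max (min 0 u) (min (max 0 u) φ)| ≤ |u| ∧
    |max (min 0 u) (min (max 0 u) φ)| ≤ |φ| := by
  rcases le_total 0 u with hu | hu
  · rw [min_eq_left hu, max_eq_right hu, abs_of_nonneg (le_max_left _ _), abs_of_nonneg hu]
    exact ⟨max_le hu (min_le_left _ _), max_le (abs_nonneg _) ((min_le_right _ _).trans
      (le_abs_self _))⟩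
  · rw [min_eq_right hu, max_eq_left hu, abs_of_nonpos (max_le hu (min_le_left _ _)),
      abs_of_nonpos hu]
    refine ⟨neg_le_neg (le_max_left _ _), ?_⟩
    rw [neg_le]
    exact le_max_of_le_right (le_min (by simp) (neg_abs_le _))

/-- Functions of `D^{s,2}` are approximated by bounded functions of bounded support that they
dominate pointwise, with no increase of energy in the limit: take the median of `0`, `u` and the
approximating test functions. -/
theorem exists_trial_approx {s : ℝ} (hs0 : 0 < s) (hs1 : s < 1) (hN : 2 * s < (N : ℝ))
    {u : 𝔼 → ℝ} (hu : MemDs2 s u) : ∃ (ψ : ℕ → 𝔼 → ℝ) (e : ℕ → ℝ), (∀ k, IsTrial s (ψ k)) ∧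
      (∀ k, ∀ᵐ x, |ψ k x| ≤ |u x|) ∧ (∀ᵐ x, Tendsto (fun k => ψ k x) atTop (𝓝 (u x))) ∧
      Tendsto e atTop (𝓝 0) ∧
      ∀ k, √(gagliardoForm s (ψ k) (ψ k)) ≤ √(gagliardoForm s u u) + e k := by
  have hNr : (0 : ℝ) < N := by linarith
  have hN0 : 0 < N := by exact_mod_cast hNr
  have hm2 := two_lt_critExp hs0 hN
  set m := critExp N s with hm
  have hug := hu.memLp_gagliardoQuotient hN0 hs0 hs1
  obtain ⟨φ, hφ, hfin, hlim⟩ := hu.2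
  obtain ⟨c, hc, hS⟩ := sobolev_inequality (N := N) hs0 hN
  have hdL : ∀ k, MemLp (u - φ k) (ENNReal.ofReal m) := fun k =>
    hu.memLp.sub ((hφ k).1.continuous.memLp_of_hasCompactSupport (hφ k).2)
  have hdg : ∀ k, MemLp (gagliardoQuotient s (u - φ k)) 2 volume := fun k =>
    (hasFiniteGagliardo_iff (hdL k).1).1 (hfin k)
  have hI : Tendsto (fun k => (∫ x, |(u - φ k) x| ^ m) ^ (2 / m)) atTop (𝓝 0) := by
    refine squeeze_zero (fun k => by positivity) (fun k => ?_) (by simpa using hlim.div_const c)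
    rw [le_div_iff₀ hc, mul_comm]
    exact hS _ (hdL k) (hdg k)
  have heL : Tendsto (fun k => eLpNorm (u - φ k) (ENNReal.ofReal m) volume) atTop (𝓝 0) := by
    have h1 : Tendsto (fun k => ENNReal.ofReal (((∫ x, |(u - φ k) x| ^ m) ^ (2 / m)) ^
        (1 / (2 : ℝ)))) atTop (𝓝 0) := by
      have := hI.rpow_const (p := 1 / (2 : ℝ)) (Or.inr (by norm_num))
      rw [Real.zero_rpow (by norm_num)] at this
      simpa using ENNReal.tendsto_ofReal this
    refine h1.congr fun k => ?_
    rw [(hdL k).eLpNorm_eq_integral_rpow_norm (by simp; linarith) ENNReal.ofReal_ne_top,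
      ENNReal.toReal_ofReal (by linarith), ← Real.rpow_mul (by positivity)]
    congr 2
    field_simp
  have heL' : Tendsto (fun k => eLpNorm (φ k - u) (ENNReal.ofReal m) volume) atTop (𝓝 0) := by
    simpa only [eLpNorm_sub_comm] using heL
  obtain ⟨ns, hns, hae⟩ := (tendstoInMeasure_of_tendsto_eLpNorm (by simp; linarith)
    (fun k => (hφ k).1.continuous.aestronglyMeasurable) hu.memLp.1 heL').exists_seq_tendsto_ae
  set u' := hu.memLp.1.mk u with hu'
  have hu'm : Measurable u' := hu.memLp.1.stronglyMeasurable_mk.measurable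
  have huu' : u =ᵐ[volume] u' := hu.memLp.1.ae_eq_mk
  set ψ : ℕ → 𝔼 → ℝ := fun k x => max (min 0 (u' x)) (min (max 0 (u' x)) (φ (ns k) x)) with hψ
  have hψm : ∀ k, Measurable (ψ k) := fun k =>
    (measurable_const.min hu'm).max ((measurable_const.max hu'm).min
      (hφ (ns k)).1.continuous.measurable)
  have hu'g := hug.ae_eq (gagliardoQuotient_congr_ae s huu')
  have hdu : ∀ k, u - φ (ns k) =ᵐ[volume] u' - φ (ns k) := fun k => huu'.sub (EventuallyEq.refl _ _)
  have hen : ∀ k, MemLp (gagliardoQuotient s (ψ k)) 2 volume ∧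
      √(gagliardoForm s (ψ k) (ψ k)) ≤ √(gagliardoForm s u' u') +
        √(gagliardoForm s (u' - φ (ns k)) (u' - φ (ns k))) := fun k => by
    refine sqrt_gagliardoForm_le_add hu'g
      ((hdg (ns k)).ae_eq (gagliardoQuotient_congr_ae s (hdu k)))
      (hψm k).aestronglyMeasurable fun x y => ?_
    have h0 : 0 ≤ |(u' - φ (ns k)) x - (u' - φ (ns k)) y| := abs_nonneg _
    have h1 : |φ (ns k) x - φ (ns k) y| ≤ |u' x - u' y| +
        |(u' - φ (ns k)) x - (u' - φ (ns k)) y| := by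
      have h2 : φ (ns k) x - φ (ns k) y =
          (u' x - u' y) - ((u' - φ (ns k)) x - (u' - φ (ns k)) y) := by
        simp only [Pi.sub_apply]; ring
      rw [h2]
      exact abs_sub _ _
    refine (abs_max_sub_max_le_max _ _ _ _).trans (max_le ?_ ?_)
    · refine (abs_min_sub_min_le_max _ _ _ _).trans (max_le (by simp; positivity) (by linarith))
    · refine (abs_min_sub_min_le_max _ _ _ _).trans (max_le ?_ h1)
      refine (abs_max_sub_max_le_max _ _ _ _).trans (max_le (by simp; positivity) (by linarith))
  refine ⟨ψ, fun k => √(gagliardoForm s (u - φ (ns k)) (u - φ (ns k))), fun k => ?_, fun k => ?_,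
    ?_, ?_, fun k => ?_⟩
  · obtain ⟨M, hM⟩ := (hφ (ns k)).2.exists_bound_of_continuous (hφ (ns k)).1.continuous
    obtain ⟨R, hR⟩ := (hφ (ns k)).2.isCompact.isBounded.subset_closedBall (0 : 𝔼)
    refine ⟨hψm k, ⟨M, fun x => (abs_median_le _ _).2.trans (hM x)⟩, ⟨R, fun x hx => ?_⟩, (hen k).1⟩
    have h0 : φ (ns k) x = 0 := by
      by_contra h
      have := hR (subset_tsupport _ h)
      rw [mem_closedBall_zero_iff] at this
      linarith
    have := (abs_median_le (u' x) (φ (ns k) x)).2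
    rw [h0, abs_zero] at this
    have h2 := abs_nonpos_iff.1 this
    simp only [hψ, h0]
    exact h2
  · filter_upwards [huu'] with x hx
    rw [hx]
    exact (abs_median_le _ _).1
  · filter_upwards [hae, huu'] with x hx hxu
    have h1 : max (min 0 (u' x)) (min (max 0 (u' x)) (u x)) = u x := by
      rw [hxu, min_eq_right (le_max_right _ _), max_eq_right (min_le_right _ _)]
    have h2 : Tendsto (fun k => ψ k x) atTop
        (𝓝 (max (min 0 (u' x)) (min (max 0 (u' x)) (u x)))) :=
      tendsto_const_nhds.max (tendsto_const_nhds.min hx)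
    rwa [h1] at h2
  · have := (Real.continuous_sqrt.tendsto 0).comp (hlim.comp hns.tendsto_atTop)
    rwa [Real.sqrt_zero] at this
  · have := (hen k).2
    rwa [← gagliardoForm_congr_ae s huu' huu', ← gagliardoForm_congr_ae s (hdu k) (hdu k)] at this

theorem tendsto_integral_rpow_of_dominated {r : ℝ} (hr : 0 < r) {ψ : ℕ → 𝔼 → ℝ} {u : 𝔼 → ℝ}
    (hψ : ∀ k, Measurable (ψ k)) (hle : ∀ k, ∀ᵐ x, |ψ k x| ≤ |u x|)
    (hlim : ∀ᵐ x, Tendsto (fun k => ψ k x) atTop (𝓝 (u x)))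
    (hu : Integrable fun x => |u x| ^ r) :
    Tendsto (fun k => ∫ x, |ψ k x| ^ r) atTop (𝓝 (∫ x, |u x| ^ r)) := by
  refine tendsto_integral_of_dominated_convergence (fun x => |u x| ^ r)
    (fun k => ((hψ k).abs.pow_const r).aestronglyMeasurable) hu (fun k => ?_) ?_
  · filter_upwards [hle k] with x hx
    rw [Real.norm_of_nonneg (by positivity)]
    gcongr
  · exact hlim.mono fun x hx => hx.abs.rpow_const (Or.inr hr.le)

/-! ### Scaling -/

/-- The function `x ↦ a ψ(R (x - y))`. -/
def rescale (a R : ℝ) (y : 𝔼) (ψ : 𝔼 → ℝ) (x : 𝔼) : ℝ := a * ψ (R • (x - y))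

theorem integral_abs_rescale_rpow {a R : ℝ} (ha : 0 ≤ a) (hR : 0 < R) (y : 𝔼) (ψ : 𝔼 → ℝ) (r : ℝ) :
    ∫ x, |rescale a R y ψ x| ^ r = a ^ r * R ^ (-(N : ℝ)) * ∫ x, |ψ x| ^ r := by
  have h1 : ∀ x, |rescale a R y ψ x| ^ r = a ^ r * |ψ (R • (x - y))| ^ r := fun x => by
    rw [rescale, abs_mul, Real.mul_rpow (abs_nonneg _) (abs_nonneg _), abs_of_nonneg ha]
  simp only [h1]
  rw [integral_const_mul, integral_sub_right_eq_self (fun x => |ψ (R • x)| ^ r) y,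
    Measure.integral_comp_smul volume (fun x => |ψ x| ^ r) R, finrank_euclideanSpace_fin,
    smul_eq_mul, abs_of_nonneg (by positivity), Real.rpow_neg hR.le, Real.rpow_natCast, mul_assoc]

theorem gagliardoDensity_rescale {s a R : ℝ} (hR : 0 < R) (y : 𝔼) (ψ : 𝔼 → ℝ) (z : 𝔼 × 𝔼) :
    gagliardoDensity s (rescale a R y ψ) (rescale a R y ψ) z =
      a ^ 2 * R ^ ((N : ℝ) + 2 * s) * gagliardoDensity s ψ ψ (R • (z - (y, y))) := by
  simp only [gagliardoDensity, rescale, Prod.smul_fst, Prod.smul_snd, Prod.fst_sub, Prod.snd_sub]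
  have h1 : R • (z.1 - y) - R • (z.2 - y) = R • (z.1 - z.2) := by
    rw [← smul_sub, sub_sub_sub_cancel_right]
  rw [h1, norm_smul, Real.norm_of_nonneg hR.le, Real.mul_rpow hR.le (norm_nonneg _)]
  have : R ^ ((N : ℝ) + 2 * s) ≠ 0 := by positivity
  rw [mul_div_assoc', mul_comm (a ^ 2), mul_assoc, mul_div_mul_left _ _ this]
  ring

theorem gagliardoForm_rescale {s a R : ℝ} (hR : 0 < R) (y : 𝔼) (ψ : 𝔼 → ℝ) :
    gagliardoForm s (rescale a R y ψ) (rescale a R y ψ) =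
      a ^ 2 * R ^ (2 * s - (N : ℝ)) * gagliardoForm s ψ ψ := by
  rw [gagliardoForm]
  simp only [gagliardoDensity_rescale hR]
  rw [integral_const_mul,
    integral_sub_right_eq_self (fun z => gagliardoDensity s ψ ψ (R • z)) ((y, y) : 𝔼 × 𝔼),
    Measure.integral_comp_smul volume (gagliardoDensity s ψ ψ) R, Module.finrank_prod,
    finrank_euclideanSpace_fin, smul_eq_mul, abs_of_nonneg (by positivity), gagliardoForm]
  have hpow : R ^ ((N : ℝ) + 2 * s) * (R ^ (N + N))⁻¹ = R ^ (2 * s - (N : ℝ)) := by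
    rw [← Real.rpow_natCast, ← Real.rpow_neg hR.le, ← Real.rpow_add hR]
    congr 1
    push_cast
    ring
  rw [← mul_assoc, mul_assoc (a ^ 2), hpow]

theorem IsTrial.rescale {s : ℝ} {ψ : 𝔼 → ℝ} (h : IsTrial s ψ) (a : ℝ) {R : ℝ} (hR : 0 < R)
    (y : 𝔼) : IsTrial s (rescale a R y ψ) := by
  obtain ⟨hm, ⟨C, hC⟩, ⟨ρ, hρ⟩, hg⟩ := h
  have hm' : Measurable (_root_.rescale a R y ψ) := by
    unfold _root_.rescale
    exact (hm.comp ((measurable_id.sub_const y).const_smul R)).const_mul a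
  refine ⟨hm', ⟨|a| * C, fun x => ?_⟩, ⟨ρ / R + ‖y‖, fun x hx => ?_⟩, ?_⟩
  · rw [_root_.rescale, abs_mul]
    exact mul_le_mul_of_nonneg_left (hC _) (abs_nonneg _)
  · rw [_root_.rescale, hρ, mul_zero]
    rw [norm_smul, Real.norm_of_nonneg hR.le]
    have h1 : ρ / R < ‖x - y‖ := by linarith [norm_sub_norm_le x y]
    rwa [div_lt_iff₀ hR, mul_comm] at h1
  · rw [← hasFiniteGagliardo_iff hm'.aestronglyMeasurable]
    rw [← hasFiniteGagliardo_iff hm.aestronglyMeasurable] at hg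
    have h1 : Integrable fun z : 𝔼 × 𝔼 => gagliardoDensity s ψ ψ (R • (z - (y, y))) :=
      (hg.comp_smul hR.ne').comp_sub_right ((y, y) : 𝔼 × 𝔼)
    refine (h1.const_mul (a ^ 2 * R ^ ((N : ℝ) + 2 * s))).congr
      (Eventually.of_forall fun z => (gagliardoDensity_rescale hR y ψ z).symm)

/-- A trial function concentrates inside `Ω` under strong rescaling about an interior point. -/
theorem exists_rescale_support {Ω : Set 𝔼} (hΩo : IsOpen Ω) {y : 𝔼} (hy : y ∈ Ω) {s : ℝ}
    {ψ : 𝔼 → ℝ} (h : IsTrial s ψ) : ∃ R₀ : ℝ, 0 < R₀ ∧ ∀ R, R₀ ≤ R → ∀ a : ℝ, ∀ x, x ∉ Ω →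
      rescale a R y ψ x = 0 := by
  obtain ⟨-, -, ⟨ρ, hρ⟩, -⟩ := h
  obtain ⟨r, hr, hball⟩ := Metric.isOpen_iff.1 hΩo y hy
  refine ⟨(|ρ| + 1) / r, by positivity, fun R hR a x hx => ?_⟩
  have h1 : r ≤ ‖x - y‖ := by
    by_contra h
    exact hx (hball (by rw [Metric.mem_ball, dist_eq_norm]; exact not_le.1 h))
  have hR0 : 0 < R := lt_of_lt_of_le (by positivity) hR
  rw [rescale, hρ, mul_zero]
  rw [norm_smul, Real.norm_of_nonneg hR0.le]
  rw [div_le_iff₀ hr] at hR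
  calc ρ < |ρ| + 1 := by linarith [le_abs_self ρ]
    _ ≤ R * r := hR
    _ ≤ R * ‖x - y‖ := by gcongr

end Trial

/-! ### Positive minimizers and the solutions they generate -/

section Solutions

variable {N : ℕ}

local notation "𝔼" => EuclideanSpace ℝ (Fin N)

theorem exists_admissible_trial (hN0 : 0 < N) {s : ℝ} (hs0 : 0 < s) (hs1 : s < 1) {p : ℝ} (q : ℝ)
    (hp : 1 < p) {Ω : Set 𝔼} (hΩo : IsOpen Ω) (hΩb : Bornology.IsBounded Ω) (hne : Ω.Nonempty) :
    ∃ ψ, IsTrial s ψ ∧ Admissible Ω s p q ψ := by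
  obtain ⟨η, hηm, hη01, hη0, hηpos, hηg⟩ := exists_lipschitz_cutoff hN0 hs0 hs1 hΩo hΩb
  obtain ⟨R, hR⟩ := hΩb.subset_closedBall (0 : 𝔼)
  have hηt : IsTrial s η := ⟨hηm, ⟨1, fun x => by
    rw [abs_of_nonneg (hη01 x).1]; exact (hη01 x).2⟩, ⟨R, fun x hx => hη0 x fun h => by
      have := hR h
      rw [mem_closedBall_zero_iff] at this
      linarith⟩, hηg⟩
  have hI : 0 < ∫ x, |η x| ^ (p + 1) := by
    rw [integral_pos_iff_support_of_nonneg (fun x => by positivity)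
      (integrable_rpow_abs_of_memLp (by linarith) (hηt.memLp _))]
    refine (hΩo.measure_pos volume hne).trans_le (measure_mono fun x hx => ?_)
    have := hηpos x hx
    exact (Real.rpow_pos_of_pos (abs_pos.2 this.ne') _).ne'
  set I := ∫ x, |η x| ^ (p + 1) with hIdef
  set k := I ^ (-(1 / (p + 1))) with hk
  have hk0 : 0 < k := by positivity
  have ht : IsTrial s (k • η) := hηt.smul k
  refine ⟨k • η, ht, memX0_smul k (hηt.memX0 hη0), ht.memLp _, ?_⟩
  rw [integral_abs_smul_rpow, abs_of_pos hk0, hk, ← Real.rpow_mul hI.le, neg_mul,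
    one_div_mul_cancel (by linarith), Real.rpow_neg_one]
  exact inv_mul_cancel₀ hI.ne'

/-- A constrained minimizer that is a trial function, positive in `Ω`, and satisfies its
Euler–Lagrange equation against all of `X_0(Ω)`. The multiplier is the value obtained by testing with
the minimizer itself. -/
theorem exists_positive_minimizer {s : ℝ} (hs0 : 0 < s) (hs1 : s < 1) (hN : 2 * s < (N : ℝ))
    {p q δ : ℝ} (hp : 1 < p) (hq : p < q) (hδ : 0 < δ) {Ω : Set 𝔼} (hΩo : IsOpen Ω)
    (hΩb : Bornology.IsBounded Ω) (hne : Ω.Nonempty) :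
    ∃ w : 𝔼 → ℝ, IsTrial s w ∧ (∀ x, 0 ≤ w x) ∧ (∀ x, x ∉ Ω → w x = 0) ∧ Admissible Ω s p q w ∧
      (∀ v, Admissible Ω s p q v → energyJ s q δ w ≤ energyJ s q δ v) ∧
      (∀ᵐ x, x ∈ Ω → 0 < w x) ∧
      ∀ φ, MemX0 Ω s φ → (Integrable fun x => w x ^ p * φ x) ∧
        (Integrable fun x => w x ^ q * φ x) ∧
        gagliardoForm s w φ + δ * ∫ x, w x ^ q * φ x =
          (gagliardoForm s w w + δ * ∫ x, |w x| ^ (q + 1)) * ∫ x, w x ^ p * φ x := by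
  have hNr : (0 : ℝ) < N := by linarith
  have hN0 : 0 < N := by exact_mod_cast hNr
  have hΩm := hΩo.measurableSet
  have hΩ : volume Ω ≠ ⊤ := hΩb.measure_lt_top.ne
  obtain ⟨ψ, -, hψ⟩ := exists_admissible_trial hN0 hs0 hs1 q hp hΩo hΩb hne
  obtain ⟨w₀, hw₀m, hw₀0, hw₀Ω, hw₀, hmin₀⟩ :=
    exists_nonneg_minimizer hN0 hs0 hp hq hδ hΩm hΩb ⟨ψ, hψ⟩
  obtain ⟨M, hM0, hM⟩ := ae_le_of_minimizer hs0 hN hp hq hδ hΩm hΩ hw₀m hw₀0 hw₀Ω hw₀ hmin₀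
  set w : 𝔼 → ℝ := fun x => min (w₀ x) M with hwdef
  have hww : w₀ =ᵐ[volume] w := hM.mono fun x hx => (min_eq_left hx).symm
  have hwm : Measurable w := hw₀m.min measurable_const
  have hw0 : ∀ x, 0 ≤ w x := fun x => le_min (hw₀0 x) hM0
  have hwM : ∀ x, w x ≤ M := fun x => min_le_right _ _
  have hwΩ : ∀ x, x ∉ Ω → w x = 0 := fun x hx => by
    simp only [hwdef, hw₀Ω x hx, min_eq_left hM0]
  have hw := admissible_congr_ae hww hw₀
  have hmin : ∀ v, Admissible Ω s p q v → energyJ s q δ w ≤ energyJ s q δ v := fun v hv =>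
    (energyJ_congr_ae hww).symm.le.trans (hmin₀ v hv)
  have hEL : ∀ φ : 𝔼 → ℝ, MemX0 Ω s φ → ∀ C : ℝ, (∀ x, |φ x| ≤ C) → (∀ x, x ∉ Ω → φ x = 0) →
      gagliardoForm s w φ + δ * ∫ x, w x ^ q * φ x =
        (gagliardoForm s w w + δ * ∫ x, |w x| ^ (q + 1)) * ∫ x, w x ^ p * φ x :=
    fun φ hφ C hC h0 => eulerLagrange_of_bounded hp hq hΩm hΩ hw0 hw hmin hφ hC h0
  have hnz : ¬ w =ᵐ[volume] 0 := fun h => by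
    have h1 := hw.2.2
    rw [integral_abs_rpow_congr_ae h] at h1
    simp [Real.zero_rpow (by linarith : p + 1 ≠ 0)] at h1
  obtain ⟨R, hR⟩ := hΩb.subset_closedBall (0 : 𝔼)
  refine ⟨w, ⟨hwm, ⟨M, fun x => by rw [abs_of_nonneg (hw0 x)]; exact hwM x⟩,
    ⟨R, fun x hx => hwΩ x fun h => ?_⟩, (memX0_iff.1 hw.1).2.1⟩, hw0, hwΩ, hw, hmin, ?_,
    fun φ hφ => ?_⟩
  · have := hR h
    rw [mem_closedBall_zero_iff] at this
    linarith
  · exact ae_pos_of_weak_equation hN0 hs0 hs1 (by linarith) (by linarith) hΩo hΩb hwm hw0 hwM hw.1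
      hnz hEL
  · exact weak_equation_of_bounded_tests (by linarith) (by linarith) hΩm hΩ hwm hw0 hwM hw.1 hEL hφ

/-- The multiple `κ w`, with its values on an exceptional null subset of `Ω` replaced by `1` so that
positivity holds at every point of `Ω`. -/
noncomputable def positiveMultiple (Ω : Set 𝔼) (κ : ℝ) (w : 𝔼 → ℝ) : 𝔼 → ℝ :=
  open scoped Classical in
  fun x => if x ∈ Ω then (if 0 < w x then κ * w x else 1) else 0

theorem positiveMultiple_ae_eq {Ω : Set 𝔼} (κ : ℝ) {w : 𝔼 → ℝ} (hwΩ : ∀ x, x ∉ Ω → w x = 0)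
    (hpos : ∀ᵐ x, x ∈ Ω → 0 < w x) : positiveMultiple Ω κ w =ᵐ[volume] κ • w := by
  filter_upwards [hpos] with x hx
  rw [positiveMultiple, Pi.smul_apply, smul_eq_mul]
  by_cases h : x ∈ Ω
  · rw [if_pos h, if_pos (hx h)]
  · rw [if_neg h, hwΩ x h, mul_zero]

theorem setIntegral_congr_of_ae_eq {Ω : Set 𝔼} {f g : 𝔼 → ℝ} (h : f =ᵐ[volume] g)
    (hg : ∀ x, x ∉ Ω → g x = 0) : ∫ x in Ω, f x = ∫ x, g x := by
  rw [integral_congr_ae (ae_restrict_of_ae h),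
    setIntegral_eq_integral_of_forall_compl_eq_zero hg]

theorem integral_positiveMultiple_rpow {s p q κ : ℝ} (hp : 1 < p) {Ω : Set 𝔼} {w : 𝔼 → ℝ}
    (hκ : 0 < κ) (hw0 : ∀ x, 0 ≤ w x) (hwΩ : ∀ x, x ∉ Ω → w x = 0) (hw : Admissible Ω s p q w)
    (hpos : ∀ᵐ x, x ∈ Ω → 0 < w x) :
    ∫ x in Ω, positiveMultiple Ω κ w x ^ (p + 1) = κ ^ (p + 1) := by
  rw [setIntegral_congr_of_ae_eq (g := fun x => |(κ • w) x| ^ (p + 1)) ?_ fun x hx => ?_,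
    integral_abs_smul_rpow, hw.2.2, mul_one, abs_of_pos hκ]
  · filter_upwards [positiveMultiple_ae_eq κ hwΩ hpos] with x hx
    rw [hx, abs_of_nonneg (show 0 ≤ (κ • w) x from mul_nonneg hκ.le (hw0 x))]
  · rw [Pi.smul_apply, hwΩ x hx, smul_zero, abs_zero, Real.zero_rpow (by linarith)]

theorem isWeakSolution_positiveMultiple {s p q δ μ κ : ℝ} (hp : 1 < p) (hq : p < q)
    {Ω : Set 𝔼} {w : 𝔼 → ℝ} (hκ : 0 < κ) (hκμ : κ ^ (p - 1) = μ)
    (hw0 : ∀ x, 0 ≤ w x) (hwΩ : ∀ x, x ∉ Ω → w x = 0) (hw : Admissible Ω s p q w)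
    (hpos : ∀ᵐ x, x ∈ Ω → 0 < w x)
    (hEL : ∀ φ, MemX0 Ω s φ → (Integrable fun x => w x ^ p * φ x) ∧
        (Integrable fun x => w x ^ q * φ x) ∧
        gagliardoForm s w φ + δ * ∫ x, w x ^ q * φ x = μ * ∫ x, w x ^ p * φ x) :
    IsWeakSolution Ω s p q (δ * κ ^ (1 - q)) (positiveMultiple Ω κ w) := by
  have hae := positiveMultiple_ae_eq κ hwΩ hpos
  refine ⟨memX0_congr_ae hae.symm (memX0_smul κ hw.1),
    ((hw.2.1.const_smul κ).ae_eq hae.symm).restrict Ω, fun x hx => ?_, fun φ hφ => ?_⟩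
  · rw [positiveMultiple, if_pos hx]
    split_ifs with h
    · positivity
    · exact one_pos
  · obtain ⟨h1, h2, h3⟩ := hEL φ hφ
    have hr : ∀ r : ℝ, (fun x => positiveMultiple Ω κ w x ^ r * φ x) =ᵐ[volume]
        fun x => κ ^ r * (w x ^ r * φ x) := fun r => by
      filter_upwards [hae] with x hx
      rw [hx, Pi.smul_apply, smul_eq_mul, Real.mul_rpow hκ.le (hw0 x), mul_assoc]
    have hz : ∀ r : ℝ, 0 < r → ∀ x, x ∉ Ω → κ ^ r * (w x ^ r * φ x) = 0 := fun r hr x hx => by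
      rw [hwΩ x hx, Real.zero_rpow hr.ne', zero_mul, mul_zero]
    refine ⟨((h1.const_mul (κ ^ p)).congr (hr p).symm).integrableOn,
      ((h2.const_mul (κ ^ q)).congr (hr q).symm).integrableOn, ?_⟩
    rw [setIntegral_congr_of_ae_eq (hr p) (hz p (by linarith)),
      setIntegral_congr_of_ae_eq (hr q) (hz q (by linarith)), integral_const_mul,
      integral_const_mul, gagliardoForm_congr_ae s hae (EventuallyEq.refl _ φ)]
    have h4 := gagliardoForm_smul_smul s κ 1 w φ
    rw [one_smul, mul_one] at h4
    rw [h4]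
    have h5 : κ ^ p = κ * μ := by
      rw [← hκμ, ← Real.rpow_one_add' hκ.le (by linarith)]
      congr 1
      ring
    have h6 : κ ^ (1 - q) * κ ^ q = κ := by
      rw [← Real.rpow_add hκ, sub_add_cancel, Real.rpow_one]
    rw [h5]
    linear_combination κ * h3 + (δ * ∫ x, w x ^ q * φ x) * h6

/-- The exponent `l` in `functionalF`. -/
noncomputable def expL (N : ℕ) (s p q : ℝ) : ℝ :=
  (2 * s * (q + 1) - N * (p - 1)) / (2 * s * (p + 1) - N * (p - 1))

theorem functionalF_univ (s p q : ℝ) (u : 𝔼 → ℝ) : functionalF s p q Set.univ u =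
    1 / 2 * (gagliardoForm s u u / ∫ x, |u x| ^ (p + 1)) +
      1 / (q + 1) * ((∫ x, |u x| ^ (q + 1)) / (∫ x, |u x| ^ (p + 1)) ^ expL N s p q) := by
  simp only [functionalF, expL, Measure.restrict_univ]

theorem functionalF_eq_univ {s p q : ℝ} (hp : 1 < p) (hq : p < q) {Ω : Set 𝔼} {u v : 𝔼 → ℝ}
    (h : u =ᵐ[volume] v) (hv : ∀ x, x ∉ Ω → v x = 0) :
    functionalF s p q Ω u = functionalF s p q Set.univ v := by
  have hr : ∀ r : ℝ, 0 < r → ∫ x in Ω, |u x| ^ r = ∫ x, |v x| ^ r := fun r hr =>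
    setIntegral_congr_of_ae_eq (h.mono fun x hx => by dsimp only; rw [hx]) fun x hx => by
      rw [hv x hx, abs_zero, Real.zero_rpow hr.ne']
  rw [functionalF_univ, expL, functionalF, hr (p + 1) (by linarith), hr (q + 1) (by linarith),
    gagliardoForm_congr_ae s h h]

end Solutions

/-! ### The supercritical case -/

section Supercritical

variable {N : ℕ}

local notation "𝔼" => EuclideanSpace ℝ (Fin N)

/-- The condition `p > 2* - 1`, cleared of denominators. -/
theorem supercritical_gap {s p : ℝ} (hN : 2 * s < (N : ℝ))
    (hp : critExp N s - 1 < p) : 0 < N * (p - 1) - 2 * s * (p + 1) := by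
  have h : 0 < (N : ℝ) - 2 * s := by linarith
  rw [critExp, sub_lt_iff_lt_add, div_lt_iff₀ h] at hp
  nlinarith

theorem expL_lt_one {s p q : ℝ} (hs0 : 0 < s) (hN : 2 * s < (N : ℝ))
    (hp : critExp N s - 1 < p) (hq : p < q) : expL N s p q < 1 := by
  have h := supercritical_gap hN hp
  rw [expL, div_lt_one_of_neg (by linarith)]
  nlinarith

/-- The rescaling `R^{2s/(p-1)} u(R (x - y))` leaves the functional invariant. -/
theorem functionalF_rescale {s p q : ℝ} (hN : 2 * s < (N : ℝ))
    (hp1 : 1 < p) (hp : critExp N s - 1 < p) (y : 𝔼) (ψ : 𝔼 → ℝ) {R : ℝ} (hR : 0 < R) :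
    functionalF s p q Set.univ (rescale (R ^ (2 * s / (p - 1))) R y ψ) =
      functionalF s p q Set.univ ψ := by
  have hgap := supercritical_gap hN hp
  have hp1' : p - 1 ≠ 0 := by linarith
  have ha : 0 ≤ R ^ (2 * s / (p - 1)) := by positivity
  rw [functionalF_univ, functionalF_univ, gagliardoForm_rescale hR,
    integral_abs_rescale_rpow ha hR, integral_abs_rescale_rpow ha hR]
  set I := ∫ x, |ψ x| ^ (p + 1) with hI
  have hI0 : 0 ≤ I := by positivity
  have e1 : (R ^ (2 * s / (p - 1))) ^ 2 * R ^ (2 * s - (N : ℝ)) =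
      R ^ (2 * s / (p - 1) * (p + 1) - N) := by
    rw [← Real.rpow_two, ← Real.rpow_mul hR.le, ← Real.rpow_add hR]
    congr 1
    field_simp
    ring
  have e2 : ∀ r : ℝ, (R ^ (2 * s / (p - 1))) ^ r * R ^ (-(N : ℝ)) =
      R ^ (2 * s / (p - 1) * r - N) := fun r => by
    rw [← Real.rpow_mul hR.le, ← Real.rpow_add hR]
    congr 1
  rw [e1, e2, e2, Real.mul_rpow (by positivity) hI0, ← Real.rpow_mul hR.le]
  have e3 : (2 * s / (p - 1) * (p + 1) - N) * expL N s p q = 2 * s / (p - 1) * (q + 1) - N := by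
    have h0 : 2 * s * (p + 1) - N * (p - 1) ≠ 0 := by linarith
    have h1 : 2 * s / (p - 1) * (p + 1) - N = (2 * s * (p + 1) - N * (p - 1)) / (p - 1) := by
      field_simp
    have h2 : 2 * s / (p - 1) * (q + 1) - N = (2 * s * (q + 1) - N * (p - 1)) / (p - 1) := by
      field_simp
    rw [expL, h1, h2, div_mul_div_comm, mul_comm (p - 1), mul_div_mul_left _ _ h0]
  rw [e3, mul_div_mul_left _ _ (by positivity), mul_div_mul_left _ _ (by positivity)]

/-- On the constraint set, `functionalF` at `c w` is a multiple of `energyJ` at `w`, with a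
coefficient that is a positive power of `c`. -/
theorem functionalF_smul {s p q : ℝ} {c : ℝ} (hc : 0 < c) {w : 𝔼 → ℝ}
    (hw : ∫ x, |w x| ^ (p + 1) = 1) : functionalF s p q Set.univ (c • w) =
      c ^ (1 - p) * energyJ s q (c ^ (q + p - expL N s p q * (p + 1))) w := by
  rw [functionalF_univ, gagliardoForm_smul_smul, integral_abs_smul_rpow,
    integral_abs_smul_rpow, hw, mul_one, abs_of_pos hc, energyJ]
  have e1 : c * c / c ^ (p + 1) = c ^ (1 - p) := by
    rw [← sq, ← Real.rpow_two, ← Real.rpow_sub hc]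
    congr 1
    ring
  have e2 : c ^ (q + 1) / (c ^ (p + 1)) ^ expL N s p q =
      c ^ (1 - p) * c ^ (q + p - expL N s p q * (p + 1)) := by
    rw [← Real.rpow_mul hc.le, ← Real.rpow_sub hc, ← Real.rpow_add hc]
    congr 1
    ring
  rw [mul_div_right_comm, e1, mul_div_right_comm, e2]
  ring

theorem constK_bddBelow (N : ℕ) {s p q : ℝ} (hq : 0 < q) : BddBelow {r : ℝ |
    ∃ u : EuclideanSpace ℝ (Fin N) → ℝ, MemDs2 s u ∧ MemLpOn Set.univ (q + 1) u ∧
      ∫ x, |u x| ^ (p + 1) = 1 ∧ r = functionalF s p q Set.univ u} := by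
  refine ⟨0, ?_⟩
  rintro _ ⟨u, -, -, h1, rfl⟩
  rw [functionalF_univ, h1]
  have := gagliardoForm_self_nonneg s u
  positivity

/-- The scale at which a function of mass `I` acquires mass `J` under the invariant rescaling. -/
theorem integral_rescale_eq {s p : ℝ} (hN : 2 * s < (N : ℝ))
    (hp1 : 1 < p) (hp : critExp N s - 1 < p) (y : 𝔼) (ψ : 𝔼 → ℝ) {I J : ℝ} (hI : 0 < I) (hJ : 0 < J)
    (hψ : ∫ x, |ψ x| ^ (p + 1) = I) {R : ℝ}
    (hR : R = (I / J) ^ (1 / (N - 2 * s / (p - 1) * (p + 1)))) :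
    ∫ x, |rescale (R ^ (2 * s / (p - 1))) R y ψ x| ^ (p + 1) = J := by
  have hgap := supercritical_gap hN hp
  have hp1' : 0 < p - 1 := by linarith
  have hθ : 0 < N - 2 * s / (p - 1) * (p + 1) := by
    rw [div_mul_eq_mul_div, sub_pos, div_lt_iff₀ hp1']
    linarith
  have hR0 : 0 < R := by rw [hR]; positivity
  rw [integral_abs_rescale_rpow (by positivity) hR0, hψ, ← Real.rpow_mul hR0.le,
    ← Real.rpow_add hR0, hR, ← Real.rpow_mul (by positivity)]
  have : 1 / (N - 2 * s / (p - 1) * (p + 1)) * (2 * s / (p - 1) * (p + 1) + -(N : ℝ)) = -1 := by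
    rw [one_div, inv_mul_eq_div, div_eq_iff hθ.ne']
    ring
  rw [this, Real.rpow_neg_one, inv_div, div_mul_cancel₀ _ hI.ne']

theorem constK_le_of_trial {s p q : ℝ} (hN : 2 * s < (N : ℝ))
    (hp1 : 1 < p) (hp : critExp N s - 1 < p) (hq : p < q) {ψ : 𝔼 → ℝ} (h : IsTrial s ψ)
    (hI : 0 < ∫ x, |ψ x| ^ (p + 1)) : constK N s p q ≤ functionalF s p q Set.univ ψ := by
  have hp1' : 0 < p - 1 := by linarith
  set R := ((∫ x, |ψ x| ^ (p + 1)) / 1) ^ (1 / (N - 2 * s / (p - 1) * (p + 1))) with hR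
  have hR0 : 0 < R := by rw [hR]; positivity
  rw [← functionalF_rescale hN hp1 hp 0 ψ hR0]
  have ht := h.rescale (R ^ (2 * s / (p - 1))) hR0 0
  refine csInf_le (constK_bddBelow N (by linarith)) ⟨_, ht.memDs2, ?_,
    integral_rescale_eq hN hp1 hp 0 ψ hI one_pos rfl hR, rfl⟩
  rw [MemLpOn, Measure.restrict_univ]
  exact ht.memLp _

/-- Compactly supported trial functions come arbitrarily close to the infimum. -/
theorem exists_trial_functionalF_lt {s p q : ℝ} (hs0 : 0 < s) (hs1 : s < 1) (hN : 2 * s < (N : ℝ))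
    (hp1 : 1 < p) (hq : p < q) {u : 𝔼 → ℝ} (hu : MemDs2 s u)
    (huq : MemLpOn Set.univ (q + 1) u) (hup : ∫ x, |u x| ^ (p + 1) = 1) {ε : ℝ} (hε : 0 < ε) :
    ∃ ψ : 𝔼 → ℝ, IsTrial s ψ ∧ 0 < ∫ x, |ψ x| ^ (p + 1) ∧
      functionalF s p q Set.univ ψ < functionalF s p q Set.univ u + ε := by
  obtain ⟨ψ, e, ht, hle, hae, he, hE⟩ := exists_trial_approx hs0 hs1 hN hu
  have hup' : Integrable fun x => |u x| ^ (p + 1) := by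
    by_contra h
    rw [integral_undef h] at hup
    norm_num at hup
  have huq' : Integrable fun x => |u x| ^ (q + 1) := by
    rw [MemLpOn, Measure.restrict_univ] at huq
    exact integrable_rpow_abs_of_memLp (by linarith) huq
  have hI := tendsto_integral_rpow_of_dominated (by linarith) (fun k => (ht k).1) hle hae hup'
  have hH := tendsto_integral_rpow_of_dominated (by linarith) (fun k => (ht k).1) hle hae huq'
  rw [hup] at hI
  have hG : Tendsto (fun k => (√(gagliardoForm s u u) + e k) ^ 2) atTop
      (𝓝 (gagliardoForm s u u)) := by
    have := (he.const_add √(gagliardoForm s u u)).pow 2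
    rwa [add_zero, Real.sq_sqrt (gagliardoForm_self_nonneg s u)] at this
  have hlim := ((hG.div hI one_ne_zero).const_mul (1 / 2)).add
    ((hH.div (hI.rpow_const (p := expL N s p q) (Or.inl one_ne_zero))
      (by rw [Real.one_rpow]; exact one_ne_zero)).const_mul (1 / (q + 1)))
  have hval : functionalF s p q Set.univ u =
      1 / 2 * (gagliardoForm s u u / 1) +
        1 / (q + 1) * ((∫ x, |u x| ^ (q + 1)) / 1 ^ expL N s p q) := by
    rw [functionalF_univ, hup]
  rw [← hval] at hlim
  obtain ⟨k, hk1, hk2⟩ := ((hlim.eventually (gt_mem_nhds (lt_add_of_pos_right _ hε))).and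
    (hI.eventually (lt_mem_nhds one_pos))).exists
  refine ⟨ψ k, ht k, hk2, lt_of_le_of_lt ?_ hk1⟩
  rw [functionalF_univ]
  have h1 : gagliardoForm s (ψ k) (ψ k) ≤ (√(gagliardoForm s u u) + e k) ^ 2 := by
    rw [← Real.sq_sqrt (gagliardoForm_self_nonneg s (ψ k))]
    exact pow_le_pow_left₀ (Real.sqrt_nonneg _) (hE k) 2
  simp only [Pi.div_apply]
  gcongr

/-- Positivity of `𝒦`: the unit mass of `|u|^{p+1}` is controlled by `|u|^{2*}` and `|u|^{q+1}`. -/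
theorem exists_pos_le_functionalF {s p q : ℝ} (hs0 : 0 < s) (hs1 : s < 1) (hN : 2 * s < (N : ℝ))
    (hp : critExp N s - 1 < p) (hq : p < q) : ∃ k₀ : ℝ, 0 < k₀ ∧ ∀ u : 𝔼 → ℝ, MemDs2 s u →
      MemLpOn Set.univ (q + 1) u → ∫ x, |u x| ^ (p + 1) = 1 →
        k₀ ≤ functionalF s p q Set.univ u := by
  have hNr : (0 : ℝ) < N := by linarith
  have hN0 : 0 < N := by exact_mod_cast hNr
  have hm2 := two_lt_critExp hs0 hN
  obtain ⟨c, hc, hS⟩ := sobolev_inequality (N := N) hs0 hN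
  set m := critExp N s with hm
  have hq0 : 0 < q + 1 := by linarith
  refine ⟨min (1 / 2 * (c * (1 / 2) ^ (2 / m))) (1 / (q + 1) * (1 / 2)),
    lt_min (by positivity) (by positivity), fun u hu huq hup => ?_⟩
  have hup' : Integrable fun x => |u x| ^ (p + 1) := by
    by_contra h
    rw [integral_undef h] at hup
    norm_num at hup
  have huq' : Integrable fun x => |u x| ^ (q + 1) := by
    rw [MemLpOn, Measure.restrict_univ] at huq
    exact integrable_rpow_abs_of_memLp (by linarith) huq
  have hum : Integrable fun x => |u x| ^ m := integrable_rpow_abs_of_memLp (by linarith) hu.memLp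
  have hsum : 1 ≤ (∫ x, |u x| ^ m) + ∫ x, |u x| ^ (q + 1) := by
    rw [← integral_add hum huq']
    refine hup.symm.le.trans ?_
    refine integral_mono hup' (hum.add huq') fun x => ?_
    dsimp only
    have ha := abs_nonneg (u x)
    have h1 : 0 ≤ |u x| ^ m := by positivity
    have h2 : 0 ≤ |u x| ^ (q + 1) := by positivity
    rcases le_total |u x| 1 with h | h
    · rcases ha.eq_or_lt with h0 | h0
      · rw [← h0, Real.zero_rpow (by linarith : p + 1 ≠ 0), Real.zero_rpow (by linarith : m ≠ 0),
          Real.zero_rpow hq0.ne']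
        norm_num
      · have := Real.rpow_le_rpow_of_exponent_ge h0 h (by linarith : m ≤ p + 1)
        linarith
    · have := Real.rpow_le_rpow_of_exponent_le h (by linarith : p + 1 ≤ q + 1)
      linarith
  rw [functionalF_univ, hup, Real.one_rpow, div_one, div_one]
  have hG := gagliardoForm_self_nonneg s u
  have hQ : 0 ≤ ∫ x, |u x| ^ (q + 1) := by positivity
  rcases le_total (1 / 2) (∫ x, |u x| ^ (q + 1)) with h | h
  · refine (min_le_right _ _).trans ?_
    have : 1 / (q + 1) * (1 / 2) ≤ 1 / (q + 1) * ∫ x, |u x| ^ (q + 1) := by gcongr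
    linarith
  · refine (min_le_left _ _).trans ?_
    have h1 : (1 / 2 : ℝ) ≤ ∫ x, |u x| ^ m := by linarith
    have h2 := hS u hu.memLp (hu.memLp_gagliardoQuotient hN0 hs0 hs1)
    have h3 : c * (1 / 2) ^ (2 / m) ≤ c * (∫ x, |u x| ^ m) ^ (2 / m) := by gcongr
    have h4 : 0 ≤ 1 / (q + 1) * ∫ x, |u x| ^ (q + 1) := by positivity
    linarith

/-- The solutions come from the minimizers of `F` among functions supported in `Ω` with
`∫ |u|^{p+1} = c_n^{p+1}`, where `c_n = 1 / (n + 1)`. -/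
theorem supercritical_solutions {s p q : ℝ} (hs0 : 0 < s) (hs1 : s < 1) (hN : 2 * s < (N : ℝ))
    (hp : critExp N s - 1 < p) (hq : p < q) {Ω : Set 𝔼} (hΩo : IsOpen Ω)
    (hΩb : Bornology.IsBounded Ω) (hne : Ω.Nonempty) :
    ∃ (ε lam : ℕ → ℝ) (u : ℕ → 𝔼 → ℝ), (∀ n, 0 < ε n) ∧ Tendsto ε atTop (𝓝 0) ∧
      (∃ a b : ℝ, 0 < a ∧ ∀ n, a ≤ lam n ∧ lam n ≤ b) ∧
      (∀ n, IsWeakSolution Ω s p q (ε n) (u n)) ∧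
      Tendsto (fun n => functionalF s p q Ω (fun x => lam n * u n x)) atTop
        (𝓝 (constK N s p q)) ∧
      Tendsto (fun n => ∫ x in Ω, u n x ^ (p + 1)) atTop (𝓝 0) := by
  have hNr : (0 : ℝ) < N := by linarith
  have hN0 : 0 < N := by exact_mod_cast hNr
  have hm2 := two_lt_critExp hs0 hN
  have hp1 : 1 < p := by linarith
  have hp1' : 0 < p - 1 := by linarith
  have hq1 : 0 < q + 1 := by linarith
  obtain ⟨y, hy⟩ := hne
  have hl := expL_lt_one hs0 hN hp hq
  set l := expL N s p q with hldef
  set c : ℕ → ℝ := fun n => 1 / ((n : ℝ) + 1) with hcdef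
  have hc0 : ∀ n, 0 < c n := fun n => by positivity
  have hclim : Tendsto c atTop (𝓝 0) := tendsto_one_div_add_atTop_nhds_zero_nat
  have hcpow : ∀ e : ℝ, 0 < e → Tendsto (fun n => c n ^ e) atTop (𝓝 0) := fun e he => by
    have := hclim.rpow_const (p := e) (Or.inr he.le)
    rwa [Real.zero_rpow he.ne'] at this
  -- with this `δ n`, `functionalF` at `c n • w` is `c n ^ (1 - p)` times `energyJ` at `w`
  set δ : ℕ → ℝ := fun n => c n ^ (q + p - l * (p + 1)) with hδdef
  have hδ0 : ∀ n, 0 < δ n := fun n => Real.rpow_pos_of_pos (hc0 n) _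
  choose w hwt hw0 hwΩ hw hmin hpos hEL using fun n =>
    exists_positive_minimizer hs0 hs1 hN hp1 hq (hδ0 n) hΩo hΩb ⟨y, hy⟩
  set F : ℕ → ℝ := fun n => functionalF s p q Set.univ (c n • w n) with hFdef
  have hFJ : ∀ n, F n = c n ^ (1 - p) * energyJ s q (δ n) (w n) := fun n =>
    functionalF_smul (hc0 n) (hw n).2.2
  obtain ⟨k₀, hk₀, hk₀F⟩ := exists_pos_le_functionalF (N := N) hs0 hs1 hN hp hq
  set S := {r : ℝ | ∃ u : 𝔼 → ℝ, MemDs2 s u ∧ MemLpOn Set.univ (q + 1) u ∧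
    ∫ x, |u x| ^ (p + 1) = 1 ∧ r = functionalF s p q Set.univ u} with hSdef
  have hSne : S.Nonempty := by
    refine ⟨_, w 0, (hwt 0).memDs2, ?_, (hw 0).2.2, rfl⟩
    rw [MemLpOn, Measure.restrict_univ]
    exact (hw 0).2.1
  have hK0 : k₀ ≤ constK N s p q := by
    refine le_csInf hSne ?_
    rintro _ ⟨u, h1, h2, h3, rfl⟩
    exact hk₀F u h1 h2 h3
  have hIc : ∀ n, ∫ x, |(c n • w n) x| ^ (p + 1) = c n ^ (p + 1) := fun n => by
    rw [integral_abs_smul_rpow, (hw n).2.2, mul_one, abs_of_pos (hc0 n)]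
  have hKF : ∀ n, constK N s p q ≤ F n := fun n => by
    refine constK_le_of_trial hN hp1 hp hq ((hwt n).smul (c n)) ?_
    rw [hIc]
    exact Real.rpow_pos_of_pos (hc0 n) _
  -- a trial function, rescaled into `Ω` with the mass of `c n • w n`, bounds `F n` from above
  have hup : ∀ ψ : 𝔼 → ℝ, IsTrial s ψ → 0 < ∫ x, |ψ x| ^ (p + 1) →
      ∀ᶠ n in atTop, F n ≤ functionalF s p q Set.univ ψ := by
    intro ψ hψ hI
    set I := ∫ x, |ψ x| ^ (p + 1) with hIdef
    obtain ⟨R₀, hR₀, hsupp⟩ := exists_rescale_support hΩo hy hψ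
    set θ : ℝ := N - 2 * s / (p - 1) * (p + 1) with hθdef
    have hθ : 0 < θ := by
      rw [hθdef, div_mul_eq_mul_div, sub_pos, div_lt_iff₀ hp1']
      linarith [supercritical_gap hN hp]
    have hsmall : ∀ᶠ n in atTop, c n ^ (p + 1) < I / R₀ ^ θ :=
      (hcpow (p + 1) (by linarith)).eventually (gt_mem_nhds (by positivity))
    filter_upwards [hsmall] with n hn
    have hcp : 0 < c n ^ (p + 1) := Real.rpow_pos_of_pos (hc0 n) _
    set R := (I / c n ^ (p + 1)) ^ (1 / θ) with hR
    have hRθ : R₀ ≤ R := by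
      have h1 : R₀ ^ θ ≤ I / c n ^ (p + 1) := by
        rw [le_div_iff₀ hcp, mul_comm, ← le_div_iff₀ (by positivity)]
        exact hn.le
      calc R₀ = (R₀ ^ θ) ^ (1 / θ) := by
            rw [← Real.rpow_mul hR₀.le, mul_one_div_cancel hθ.ne', Real.rpow_one]
        _ ≤ R := by
            rw [hR]
            exact Real.rpow_le_rpow (by positivity) h1 (by positivity)
    have hR0 : 0 < R := hR₀.trans_le hRθ
    set v := rescale (R ^ (2 * s / (p - 1))) R y ψ with hv
    have hvt : IsTrial s v := hψ.rescale _ hR0 y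
    have hvI : ∫ x, |v x| ^ (p + 1) = c n ^ (p + 1) :=
      integral_rescale_eq hN hp1 hp y ψ hI hcp rfl hR
    have hvadm : Admissible Ω s p q ((c n)⁻¹ • v) := by
      refine ⟨memX0_smul _ (hvt.memX0 (hsupp R hRθ _)), (hvt.smul _).memLp _, ?_⟩
      rw [integral_abs_smul_rpow, hvI, abs_of_pos (inv_pos.2 (hc0 n)), Real.inv_rpow (hc0 n).le]
      exact inv_mul_cancel₀ hcp.ne'
    rw [hFJ, ← functionalF_rescale hN hp1 hp y ψ hR0, ← hv]
    have hv' : v = c n • ((c n)⁻¹ • v) := by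
      rw [smul_smul, mul_inv_cancel₀ (hc0 n).ne', one_smul]
    rw [hv', functionalF_smul (hc0 n) hvadm.2.2]
    exact mul_le_mul_of_nonneg_left (hmin n _ hvadm) (Real.rpow_nonneg (hc0 n).le _)
  have hFlim : Tendsto F atTop (𝓝 (constK N s p q)) := by
    rw [Metric.tendsto_nhds]
    intro ε hε
    obtain ⟨_, ⟨u, h1, h2, h3, rfl⟩, hlt⟩ := exists_lt_of_csInf_lt hSne
      (show sInf S < constK N s p q + ε / 2 by
        have : constK N s p q = sInf S := rfl
        linarith)
    obtain ⟨ψ, hψ, hψI, hψF⟩ :=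
      exists_trial_functionalF_lt hs0 hs1 hN hp1 hq h1 h2 h3 (half_pos hε)
    filter_upwards [hup ψ hψ hψI] with n hn
    rw [Real.dist_eq, abs_of_nonneg (by linarith [hKF n])]
    linarith
  obtain ⟨C, hC⟩ := hFlim.bddAbove_range
  have hFC : ∀ n, F n ≤ C := fun n => hC ⟨n, rfl⟩
  set μ : ℕ → ℝ := fun n =>
    gagliardoForm s (w n) (w n) + δ n * ∫ x, |w n x| ^ (q + 1) with hμdef
  -- `ν n = (lam n) ^ (1 - p)` is comparable with `F n`
  set ν : ℕ → ℝ := fun n => c n ^ (1 - p) * μ n with hνdef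
  have hν : ∀ n, 2 * k₀ ≤ ν n ∧ ν n ≤ (q + 1) * C := fun n => by
    have hF0 := hK0.trans (hKF n)
    have hF1 := hFC n
    have hG := gagliardoForm_self_nonneg s (w n)
    have hH : 0 ≤ δ n * ∫ x, |w n x| ^ (q + 1) := by
      have := (hδ0 n).le
      positivity
    have hcp : 0 ≤ c n ^ (1 - p) := Real.rpow_nonneg (hc0 n).le _
    set G := gagliardoForm s (w n) (w n) with hGdef
    set H := δ n * ∫ x, |w n x| ^ (q + 1) with hHdef
    have hFe : F n = c n ^ (1 - p) * (1 / 2 * G + H / (q + 1)) := by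
      rw [hFJ, energyJ, hHdef, mul_div_right_comm (δ n)]
    have hνe : ν n = c n ^ (1 - p) * (G + H) := rfl
    have h1 : H / (q + 1) ≤ H / 2 := div_le_div_of_nonneg_left hH (by norm_num) (by linarith)
    have h2 : G + H ≤ (q + 1) * (1 / 2 * G + H / (q + 1)) := by
      have : (q + 1) * (H / (q + 1)) = H := mul_div_cancel₀ H hq1.ne'
      nlinarith
    constructor
    · have : F n ≤ c n ^ (1 - p) * ((G + H) / 2) := by
        rw [hFe]
        exact mul_le_mul_of_nonneg_left (by linarith) hcp
      rw [hνe]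
      linarith
    · calc ν n ≤ c n ^ (1 - p) * ((q + 1) * (1 / 2 * G + H / (q + 1))) := by
            rw [hνe]
            exact mul_le_mul_of_nonneg_left h2 hcp
        _ = (q + 1) * F n := by rw [hFe]; ring
        _ ≤ _ := by gcongr
  have hμ0 : ∀ n, 0 < μ n := fun n => by
    have h1 : 0 < ν n := lt_of_lt_of_le (by positivity) (hν n).1
    exact pos_of_mul_pos_right h1 (Real.rpow_nonneg (hc0 n).le _)
  set κ : ℕ → ℝ := fun n => μ n ^ (1 / (p - 1)) with hκdef
  have hκ0 : ∀ n, 0 < κ n := fun n => Real.rpow_pos_of_pos (hμ0 n) _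
  have hκμ : ∀ n, κ n ^ (p - 1) = μ n := fun n => by
    simp only [hκdef]
    rw [← Real.rpow_mul (hμ0 n).le, one_div_mul_cancel hp1'.ne', Real.rpow_one]
  set lam : ℕ → ℝ := fun n => c n / κ n with hlamdef
  have hlam0 : ∀ n, 0 < lam n := fun n => div_pos (hc0 n) (hκ0 n)
  have hlamν : ∀ n, lam n = ν n ^ (-(1 / (p - 1))) := fun n => by
    simp only [hlamdef, hκdef, hνdef]
    rw [Real.mul_rpow (Real.rpow_nonneg (hc0 n).le _) (hμ0 n).le, ← Real.rpow_mul (hc0 n).le,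
      Real.rpow_neg (hμ0 n).le]
    have : (1 - p) * -(1 / (p - 1)) = 1 := by
      field_simp
      ring
    rw [this, Real.rpow_one]
    rfl
  have hCpos : 0 < (q + 1) * C := lt_of_lt_of_le (by positivity) ((hν 0).1.trans (hν 0).2)
  set a := ((q + 1) * C) ^ (-(1 / (p - 1))) with hadef
  set b := (2 * k₀) ^ (-(1 / (p - 1))) with hbdef
  have ha0 : 0 < a := Real.rpow_pos_of_pos hCpos _
  have hneg : -(1 / (p - 1)) ≤ 0 := by
    have : 0 < 1 / (p - 1) := by positivity
    linarith
  have hab : ∀ n, a ≤ lam n ∧ lam n ≤ b := fun n => by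
    rw [hlamν]
    exact ⟨Real.rpow_le_rpow_of_nonpos (lt_of_lt_of_le (by positivity) (hν n).1) (hν n).2 hneg,
      Real.rpow_le_rpow_of_nonpos (by positivity) (hν n).1 hneg⟩
  have hκc : ∀ n, κ n = c n / lam n := fun n => by
    simp only [hlamdef]
    rw [div_div_cancel₀ (hc0 n).ne']
  have hae : ∀ n, positiveMultiple Ω (κ n) (w n) =ᵐ[volume] κ n • w n := fun n =>
    positiveMultiple_ae_eq (κ n) (hwΩ n) (hpos n)
  refine ⟨fun n => δ n * κ n ^ (1 - q), lam, fun n => positiveMultiple Ω (κ n) (w n),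
    fun n => mul_pos (hδ0 n) (Real.rpow_pos_of_pos (hκ0 n) _), ?_, ⟨a, b, ha0, hab⟩,
    fun n => isWeakSolution_positiveMultiple hp1 hq (hκ0 n) (hκμ n) (hw0 n) (hwΩ n) (hw n)
      (hpos n) (hEL n), ?_, ?_⟩
  · have heps : ∀ n, δ n * κ n ^ (1 - q) = c n ^ ((p + 1) * (1 - l)) * lam n ^ (q - 1) := fun n => by
      rw [hκc, Real.div_rpow (hc0 n).le (hlam0 n).le, mul_div_assoc', ← Real.rpow_add (hc0 n),
        div_eq_mul_inv, ← Real.rpow_neg (hlam0 n).le]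
      congr 2 <;> ring
    simp only [heps]
    have h1 := (hcpow ((p + 1) * (1 - l)) (mul_pos (by linarith) (by linarith))).mul_const
      (b ^ (q - 1))
    rw [zero_mul] at h1
    refine squeeze_zero (fun n => ?_) (fun n => ?_) h1
    · exact mul_nonneg (Real.rpow_nonneg (hc0 n).le _) (Real.rpow_nonneg (hlam0 n).le _)
    · exact mul_le_mul_of_nonneg_left (Real.rpow_le_rpow (hlam0 n).le (hab n).2 (by linarith))
        (Real.rpow_nonneg (hc0 n).le _)
  · refine hFlim.congr fun n => ?_
    refine (functionalF_eq_univ hp1 hq ?_ fun x hx => ?_).symm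
    · filter_upwards [hae n] with x hx
      rw [hx]
      simp only [Pi.smul_apply, smul_eq_mul]
      rw [← mul_assoc, hlamdef]
      dsimp only
      rw [div_mul_cancel₀ _ (hκ0 n).ne']
    · rw [Pi.smul_apply, hwΩ n x hx, smul_zero]
  · have hint : ∀ n, ∫ x in Ω, positiveMultiple Ω (κ n) (w n) x ^ (p + 1) = κ n ^ (p + 1) :=
      fun n => integral_positiveMultiple_rpow hp1 (hκ0 n) (hw0 n) (hwΩ n) (hw n) (hpos n)
    simp only [hint]
    have h1 := (hcpow (p + 1) (by linarith)).div_const (a ^ (p + 1))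
    rw [zero_div] at h1
    refine squeeze_zero (fun n => Real.rpow_nonneg (hκ0 n).le _) (fun n => ?_) h1
    rw [hκc, Real.div_rpow (hc0 n).le (hlam0 n).le]
    have h2 : a ^ (p + 1) ≤ lam n ^ (p + 1) := Real.rpow_le_rpow ha0.le (hab n).1 (by linarith)
    exact div_le_div_of_nonneg_left (Real.rpow_nonneg (hc0 n).le _) (by positivity) h2

end Supercritical

/-! ### The critical case -/

section Critical

variable {N : ℕ}

local notation "𝔼" => EuclideanSpace ℝ (Fin N)

theorem integral_critExp_pos {s : ℝ} (hs0 : 0 < s) (hN : 2 * s < (N : ℝ)) {u : 𝔼 → ℝ}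
    (hu : MemDs2 s u) (hne : ¬ u =ᵐ[volume] 0) : 0 < ∫ x, |u x| ^ critExp N s := by
  have hm := two_lt_critExp hs0 hN
  have h0 : 0 ≤ fun x => |u x| ^ critExp N s := fun x => by
    simp only [Pi.zero_apply]
    positivity
  refine (integral_nonneg h0).lt_of_ne fun h => hne ?_
  have h1 := (integral_eq_zero_iff_of_nonneg h0
    (integrable_rpow_abs_of_memLp (by linarith) hu.memLp)).1 h.symm
  filter_upwards [h1] with x hx
  exact abs_eq_zero.1 (((Real.rpow_eq_zero (abs_nonneg _) (by linarith)).1 hx))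

theorem exists_pos_le_sobolev_quotient {s : ℝ} (hs0 : 0 < s) (hs1 : s < 1)
    (hN : 2 * s < (N : ℝ)) : ∃ c : ℝ, 0 < c ∧ ∀ u : 𝔼 → ℝ, MemDs2 s u → ¬ u =ᵐ[volume] 0 →
      c ≤ gagliardoForm s u u / (∫ x, |u x| ^ critExp N s) ^ (2 / critExp N s) := by
  have hNr : (0 : ℝ) < N := by linarith
  have hN0 : 0 < N := by exact_mod_cast hNr
  obtain ⟨c, hc, hS⟩ := sobolev_inequality (N := N) hs0 hN
  refine ⟨c, hc, fun u hu hne => ?_⟩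
  have := integral_critExp_pos hs0 hN hu hne
  rw [le_div_iff₀ (by positivity)]
  exact hS u hu.memLp (hu.memLp_gagliardoQuotient hN0 hs0 hs1)

/-- Compactly supported trial functions come arbitrarily close to any Sobolev quotient. -/
theorem exists_trial_quotient_lt {s : ℝ} (hs0 : 0 < s) (hs1 : s < 1) (hN : 2 * s < (N : ℝ))
    {u : 𝔼 → ℝ} (hu : MemDs2 s u) (hne : ¬ u =ᵐ[volume] 0) {ε : ℝ} (hε : 0 < ε) :
    ∃ ψ : 𝔼 → ℝ, IsTrial s ψ ∧ 0 < ∫ x, |ψ x| ^ critExp N s ∧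
      gagliardoForm s ψ ψ / (∫ x, |ψ x| ^ critExp N s) ^ (2 / critExp N s) <
        gagliardoForm s u u / (∫ x, |u x| ^ critExp N s) ^ (2 / critExp N s) + ε := by
  have hm := two_lt_critExp hs0 hN
  have hpos := integral_critExp_pos hs0 hN hu hne
  obtain ⟨ψ, e, ht, hle, hae, he, hE⟩ := exists_trial_approx hs0 hs1 hN hu
  have hI := tendsto_integral_rpow_of_dominated (by linarith) (fun k => (ht k).1) hle hae
    (integrable_rpow_abs_of_memLp (by linarith) hu.memLp)
  have hG : Tendsto (fun k => (√(gagliardoForm s u u) + e k) ^ 2) atTop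
      (𝓝 (gagliardoForm s u u)) := by
    have := (he.const_add √(gagliardoForm s u u)).pow 2
    rwa [add_zero, Real.sq_sqrt (gagliardoForm_self_nonneg s u)] at this
  have hlim := hG.div (hI.rpow_const (p := 2 / critExp N s) (Or.inl hpos.ne')) (by positivity)
  obtain ⟨k, hk1, hk2⟩ := ((hlim.eventually (gt_mem_nhds (lt_add_of_pos_right _ hε))).and
    (hI.eventually (lt_mem_nhds hpos))).exists
  refine ⟨ψ k, ht k, hk2, lt_of_le_of_lt ?_ hk1⟩
  have h1 : gagliardoForm s (ψ k) (ψ k) ≤ (√(gagliardoForm s u u) + e k) ^ 2 := by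
    rw [← Real.sq_sqrt (gagliardoForm_self_nonneg s (ψ k))]
    exact pow_le_pow_left₀ (Real.sqrt_nonneg _) (hE k) 2
  simp only [Pi.div_apply]
  gcongr

/-- By the scale invariance of the Sobolev quotient, every trial function has a competitor in `Ω`
with the same quotient. -/
theorem exists_admissible_of_trial {s p : ℝ} (q : ℝ) (hs0 : 0 < s) (hN : 2 * s < (N : ℝ))
    (hp : p + 1 = critExp N s) {Ω : Set 𝔼} (hΩo : IsOpen Ω) {y : 𝔼} (hy : y ∈ Ω) {ψ : 𝔼 → ℝ}
    (hψ : IsTrial s ψ) (hI : 0 < ∫ x, |ψ x| ^ critExp N s) :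
    ∃ v : 𝔼 → ℝ, Admissible Ω s p q v ∧ gagliardoForm s v v =
      gagliardoForm s ψ ψ / (∫ x, |ψ x| ^ critExp N s) ^ (2 / critExp N s) := by
  have hm := two_lt_critExp hs0 hN
  have hm0 : critExp N s ≠ 0 := by linarith
  have hNs : (N : ℝ) - 2 * s ≠ 0 := by linarith
  obtain ⟨R, hR, hsupp⟩ := exists_rescale_support hΩo hy hψ
  have hmass := integral_abs_rescale_rpow (a := R ^ (((N : ℝ) - 2 * s) / 2)) (by positivity) hR y ψ
    (critExp N s)
  have hform := gagliardoForm_rescale (s := s) (a := R ^ (((N : ℝ) - 2 * s) / 2)) hR y ψ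
  set v := rescale (R ^ (((N : ℝ) - 2 * s) / 2)) R y ψ with hv
  have e1 : (N - 2 * s) / 2 * critExp N s + -(N : ℝ) = 0 := by
    rw [critExp]
    field_simp
    ring
  have e2 : ((N : ℝ) - 2 * s) / 2 * 2 + (2 * s - N) = 0 := by ring
  rw [← Real.rpow_mul hR.le, ← Real.rpow_add hR, e1, Real.rpow_zero, one_mul] at hmass
  rw [← Real.rpow_two, ← Real.rpow_mul hR.le, ← Real.rpow_add hR, e2, Real.rpow_zero,
    one_mul] at hform
  set I := ∫ x, |ψ x| ^ critExp N s with hIdef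
  have hvt : IsTrial s v := hψ.rescale _ hR y
  have hk : 0 < I ^ (-(1 / critExp N s)) := by positivity
  refine ⟨I ^ (-(1 / critExp N s)) • v, ⟨memX0_smul _ (hvt.memX0 (hsupp R le_rfl _)),
    (hvt.smul _).memLp _, ?_⟩, ?_⟩
  · rw [hp, integral_abs_smul_rpow, hmass, abs_of_pos hk, ← Real.rpow_mul hI.le, neg_mul,
      one_div_mul_cancel hm0, Real.rpow_neg_one, inv_mul_cancel₀ hI.ne']
  · rw [gagliardoForm_smul_smul, hform, ← Real.rpow_add hI, mul_comm,
      show -(1 / critExp N s) + -(1 / critExp N s) = -(2 / critExp N s) by ring,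
      Real.rpow_neg hI.le, ← div_eq_mul_inv]

/-- The solutions come from the constrained minimizers for `δ_n = 1 / (n + 1)`; the Sobolev quotients
of the minimizers converge to the infimum over `ℝ^N`. -/
theorem critical_solutions {s p q : ℝ} (hs0 : 0 < s) (hs1 : s < 1) (hN : 2 * s < (N : ℝ))
    (hp : p = critExp N s - 1) (hq : p < q) {Ω : Set 𝔼} (hΩo : IsOpen Ω)
    (hΩb : Bornology.IsBounded Ω) (hne : Ω.Nonempty) :
    ∃ (ε : ℕ → ℝ) (u : ℕ → 𝔼 → ℝ), (∀ n, 0 < ε n) ∧ Tendsto ε atTop (𝓝 0) ∧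
      (∀ n, IsWeakSolution Ω s p q (ε n) (u n)) ∧
      Tendsto (fun n => functionalS s p Ω (u n)) atTop (𝓝 (constS N s)) ∧
      ∃ A B : ℝ, 0 < A ∧ 0 < B ∧
        ∀ n, A < ∫ x in Ω, u n x ^ (p + 1) ∧ ∫ x in Ω, u n x ^ (p + 1) < B := by
  have hm := two_lt_critExp hs0 hN
  have hpm : p + 1 = critExp N s := by linarith
  have hp1 : 1 < p := by linarith
  have hp1' : 0 < p - 1 := by linarith
  have hq1 : 0 < q + 1 := by linarith
  obtain ⟨y, hy⟩ := hne
  set δ : ℕ → ℝ := fun n => 1 / ((n : ℝ) + 1) with hδdef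
  have hδ0 : ∀ n, 0 < δ n := fun n => by positivity
  have hδlim : Tendsto δ atTop (𝓝 0) := tendsto_one_div_add_atTop_nhds_zero_nat
  choose w hwt hw0 hwΩ hw hmin hpos hEL using fun n =>
    exists_positive_minimizer hs0 hs1 hN hp1 hq (hδ0 n) hΩo hΩb ⟨y, hy⟩
  set G : ℕ → ℝ := fun n => gagliardoForm s (w n) (w n) with hGdef
  set H : ℕ → ℝ := fun n => δ n * ∫ x, |w n x| ^ (q + 1) with hHdef
  set J : ℕ → ℝ := fun n => energyJ s q (δ n) (w n) with hJdef
  have hJ : ∀ n, J n = 1 / 2 * G n + H n / (q + 1) := fun n => by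
    simp only [hJdef, hHdef, hGdef]
    rw [energyJ, mul_div_right_comm (δ n)]
  have hH0 : ∀ n, 0 ≤ H n := fun n => mul_nonneg (hδ0 n).le (by positivity)
  have hnz : ∀ n, ¬ w n =ᵐ[volume] 0 := fun n h => by
    have h1 := (hw n).2.2
    rw [integral_abs_rpow_congr_ae h] at h1
    simp [Real.zero_rpow (by linarith : p + 1 ≠ 0)] at h1
  obtain ⟨c, hc, hcS⟩ := exists_pos_le_sobolev_quotient (N := N) hs0 hs1 hN
  set T := {r : ℝ | ∃ u : 𝔼 → ℝ, MemDs2 s u ∧ ¬ (u =ᵐ[volume] 0) ∧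
      r = gagliardoForm s u u / (∫ x, |u x| ^ critExp N s) ^ (2 / critExp N s)} with hT
  have hTne : T.Nonempty := ⟨_, w 0, (hwt 0).memDs2, hnz 0, rfl⟩
  have hTc : ∀ r ∈ T, c ≤ r := by
    rintro _ ⟨u, h1, h2, rfl⟩
    exact hcS u h1 h2
  set S := constS N s with hSdef
  have hS0 : 0 < S := hc.trans_le (le_csInf hTne hTc)
  have hSG : ∀ n, S ≤ G n := fun n => by
    refine csInf_le ⟨c, hTc⟩ ⟨w n, (hwt n).memDs2, hnz n, ?_⟩
    rw [← hpm, (hw n).2.2, Real.one_rpow, div_one]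
  have hSJ : ∀ n, S / 2 ≤ J n := fun n => by
    have := div_nonneg (hH0 n) hq1.le
    rw [hJ]
    linarith [hSG n]
  have hJlim : Tendsto J atTop (𝓝 (S / 2)) := by
    rw [Metric.tendsto_nhds]
    intro ε hε
    obtain ⟨_, ⟨u, h1, h2, rfl⟩, hlt⟩ := exists_lt_of_csInf_lt hTne
      (show sInf T < S + ε by
        have : S = sInf T := rfl
        linarith)
    obtain ⟨ψ, hψ, hψI, hψS⟩ := exists_trial_quotient_lt hs0 hs1 hN h1 h2 hε
    obtain ⟨v, hv, hvG⟩ := exists_admissible_of_trial q hs0 hN hpm hΩo hy hψ hψI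
    have h3 : Tendsto (fun n => energyJ s q (δ n) v) atTop (𝓝 (1 / 2 * gagliardoForm s v v)) := by
      have := ((hδlim.div_const (q + 1)).mul_const (∫ x, |v x| ^ (q + 1))).const_add
        (1 / 2 * gagliardoForm s v v)
      rwa [zero_div, zero_mul, add_zero] at this
    have h4 : 1 / 2 * gagliardoForm s v v < S / 2 + ε := by
      rw [hvG]
      linarith
    filter_upwards [h3.eventually (gt_mem_nhds h4)] with n hn
    rw [Real.dist_eq, abs_of_nonneg (by linarith [hSJ n])]
    have := hmin n v hv
    linarith
  have hGlim : Tendsto G atTop (𝓝 S) := by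
    refine tendsto_of_tendsto_of_tendsto_of_le_of_le (h := fun n => 2 * J n) tendsto_const_nhds ?_
      hSG fun n => ?_
    · have := hJlim.const_mul 2
      rwa [mul_div_cancel₀ S two_ne_zero] at this
    · have := div_nonneg (hH0 n) hq1.le
      simp only [hJ]
      linarith
  have hHlim : Tendsto H atTop (𝓝 0) := by
    have h1 := (hJlim.sub (hGlim.const_mul (1 / 2))).const_mul (q + 1)
    have h2 : (q + 1) * (S / 2 - 1 / 2 * S) = 0 := by ring
    rw [h2] at h1
    refine h1.congr fun n => ?_
    rw [hJ, add_sub_cancel_left, mul_div_cancel₀ _ hq1.ne']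
  set μ : ℕ → ℝ := fun n => G n + H n with hμdef
  have hμlim : Tendsto μ atTop (𝓝 S) := by simpa using hGlim.add hHlim
  have hμS : ∀ n, S ≤ μ n := fun n => (hSG n).trans (le_add_of_nonneg_right (hH0 n))
  have hμ0 : ∀ n, 0 < μ n := fun n => hS0.trans_le (hμS n)
  obtain ⟨C, hC⟩ := hμlim.bddAbove_range
  have hμC : ∀ n, μ n ≤ C := fun n => hC ⟨n, rfl⟩
  have hC0 : 0 < C := (hμ0 0).trans_le (hμC 0)
  set κ : ℕ → ℝ := fun n => μ n ^ (1 / (p - 1)) with hκdef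
  have hκ0 : ∀ n, 0 < κ n := fun n => Real.rpow_pos_of_pos (hμ0 n) _
  have hκμ : ∀ n, κ n ^ (p - 1) = μ n := fun n => by
    simp only [hκdef]
    rw [← Real.rpow_mul (hμ0 n).le, one_div_mul_cancel hp1'.ne', Real.rpow_one]
  have hae : ∀ n, positiveMultiple Ω (κ n) (w n) =ᵐ[volume] κ n • w n := fun n =>
    positiveMultiple_ae_eq (κ n) (hwΩ n) (hpos n)
  have hint : ∀ n, ∫ x in Ω, positiveMultiple Ω (κ n) (w n) x ^ (p + 1) = κ n ^ (p + 1) :=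
    fun n => integral_positiveMultiple_rpow hp1 (hκ0 n) (hw0 n) (hwΩ n) (hw n) (hpos n)
  refine ⟨fun n => δ n * κ n ^ (1 - q), fun n => positiveMultiple Ω (κ n) (w n),
    fun n => mul_pos (hδ0 n) (Real.rpow_pos_of_pos (hκ0 n) _), ?_,
    fun n => isWeakSolution_positiveMultiple hp1 hq (hκ0 n) (hκμ n) (hw0 n) (hwΩ n) (hw n)
      (hpos n) (hEL n), ?_, ?_⟩
  · have hS1 : 0 < S ^ (1 / (p - 1)) := by positivity
    have h1 := hδlim.mul ((hμlim.rpow_const (p := 1 / (p - 1)) (Or.inl hS0.ne')).rpow_const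
      (p := 1 - q) (Or.inl hS1.ne'))
    rwa [zero_mul] at h1
  · refine hGlim.congr fun n => ?_
    have h1 : ∫ x in Ω, |positiveMultiple Ω (κ n) (w n) x| ^ (p + 1) = κ n ^ (p + 1) := by
      rw [setIntegral_congr_of_ae_eq (g := fun x => |(κ n • w n) x| ^ (p + 1)) ?_ fun x hx => ?_,
        integral_abs_smul_rpow, (hw n).2.2, mul_one, abs_of_pos (hκ0 n)]
      · filter_upwards [hae n] with x hx
        rw [hx]
      · rw [Pi.smul_apply, hwΩ n x hx, smul_zero, abs_zero, Real.zero_rpow (by linarith)]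
    rw [functionalS, h1, gagliardoForm_congr_ae s (hae n) (hae n), gagliardoForm_smul_smul,
      ← Real.rpow_mul (hκ0 n).le, mul_div_cancel₀ _ (by linarith : p + 1 ≠ 0), Real.rpow_two, ← sq,
      mul_div_cancel_left₀ _ (pow_pos (hκ0 n) 2).ne']
  · simp only [hint]
    have hmono : ∀ a b : ℝ, 0 ≤ a → a < b →
        (a ^ (1 / (p - 1))) ^ (p + 1) < (b ^ (1 / (p - 1))) ^ (p + 1) := fun a b ha hab =>
      Real.rpow_lt_rpow (by positivity) (Real.rpow_lt_rpow ha hab (by positivity)) (by linarith)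
    exact ⟨((S / 2) ^ (1 / (p - 1))) ^ (p + 1), ((C + 1) ^ (1 / (p - 1))) ^ (p + 1), by positivity,
      by positivity, fun n => ⟨hmono _ _ (by positivity) (by linarith [hμS n]),
        hmono _ _ (hμ0 n).le (by linarith [hμC n])⟩⟩

end Critical

theorem theorem1p1 (N : ℕ) (s p q : ℝ) (hs0 : 0 < s) (hs1 : s < 1) (hN : 2 * s < (N : ℝ))
    (hp : critExp N s - 1 ≤ p) (hq : p < q)
    (Ω : Set (EuclideanSpace ℝ (Fin N))) (hΩo : IsOpen Ω) (hΩb : Bornology.IsBounded Ω)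
    (hΩs : HasSmoothBoundary Ω) (hΩstar : ∃ y ∈ Ω, StarConvex ℝ y Ω) :
    ∃ (ε lam : ℕ → ℝ) (u : ℕ → EuclideanSpace ℝ (Fin N) → ℝ),
      (∀ n, 0 < ε n) ∧ Tendsto ε atTop (𝓝 0) ∧
      (∃ a b : ℝ, 0 < a ∧ ∀ n, a ≤ lam n ∧ lam n ≤ b) ∧
      (∀ n, IsWeakSolution Ω s p q (ε n) (u n)) ∧
      (critExp N s - 1 < p →
        Tendsto (fun n => functionalF s p q Ω (fun x => lam n * u n x)) atTop
          (𝓝 (constK N s p q)) ∧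
        Tendsto (fun n => ∫ x in Ω, u n x ^ (p + 1)) atTop (𝓝 0)) ∧
      (p = critExp N s - 1 →
        Tendsto (fun n => functionalS s p Ω (u n)) atTop (𝓝 (constS N s)) ∧
        ∃ A B : ℝ, 0 < A ∧ 0 < B ∧
          ∀ n, A < ∫ x in Ω, u n x ^ (p + 1) ∧ ∫ x in Ω, u n x ^ (p + 1) < B) := by
  obtain ⟨y, hy, -⟩ := hΩstar
  rcases hp.lt_or_eq with h | h
  · obtain ⟨ε, lam, u, h1, h2, h3, h4, h5, h6⟩ :=
      supercritical_solutions hs0 hs1 hN h hq hΩo hΩb ⟨y, hy⟩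
    exact ⟨ε, lam, u, h1, h2, h3, h4, fun _ => ⟨h5, h6⟩, fun h' => absurd h'.symm h.ne⟩
  · obtain ⟨ε, u, h1, h2, h3, h4⟩ := critical_solutions hs0 hs1 hN h.symm hq hΩo hΩb ⟨y, hy⟩
    exact ⟨ε, fun _ => 1, u, h1, h2, ⟨1, 1, one_pos, fun _ => ⟨le_rfl, le_rfl⟩⟩, h3,
      fun h' => absurd h h'.ne, fun _ => h4⟩
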